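/- Let $\mathrm{Vir}=\mathrm{span}_{\mathbb C}\{z,e_j\mid j\in\mathbb Z\}$ be the Virasoro algebra, with $z$ central and $[e_j,e_k]=(k-j)e_{j+k}+\delta_{k,-j}\frac{j^3-j}{12}z$. Let $f=\sum_{i=0}^p a_it^i\in\mathbb C[t]$ with $p\ge 0$, $a_p=1$, $a_0\ne0$ (put $a_1=0$ if $p=0$), and write $f=\prod_{r=1}^k(t-\lambda_r)^{n_r}$ with distinct $\lambda_r$ and $n_r\ge1$. Put $x^f_j=\sum_{i=0}^p a_ie_{j+i}$ and, for $m\ge1$, let $$\mathrm{Vir}^f=\mathrm{span}\{z,x^f_j\mid j\in\mathbb Z\},\qquad \mathfrak b_m=\mathrm{span}\{z,e_j\mid j\ge m\},\qquad \mathfrak b^f_m=\mathrm{span}\{z,x^f_j\mid j\ge m\};$$ these are Lie subalgebras of $\mathrm{Vir}$. For Lie algebra homomorphisms $\mu:\mathfrak b_m^f\to\mathbb C$, $\nu:\mathrm{Vir}^f\to\mathbb C$, $\psi:\mathfrak b_m\to\mathbb C$ let $V^{f,m}_\mu=\mathrm{Ind}_{\mathfrak b_m^f}^{\mathrm{Vir}}\mathbb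 C_\mu$, $V^f_\nu=\mathrm{Ind}_{\mathrm{Vir}^f}^{\mathrm{Vir}}\mathbb C_\nu$, $L_\psi=\mathrm{Ind}_{\mathfrak b_m}^{\mathrm{Vir}}\mathbb C_\psi$ be the modules induced from the corresponding one-dimensional modules ($L_\psi$ is called a Whittaker module when $\psi\neq0$; the notation is also used for $\psi=0$). A homomorphism $\nu:\mathrm{Vir}^f\to\mathbb C$ has *large degree* if $\nu=\sum_{r=1}^k\nu_r|_{\mathrm{Vir}^f}$ for homomorphisms $\nu_r:\mathrm{Vir}^{(t-\lambda_r)^{n_r}}\to\mathbb C$ of the form $\nu_r\bigl(x_j^{(t-\lambda_r)^{n_r}}\bigr)=p_r(j)\lambda_r^j$ ($j\in\mathbb Z$), where each $p_r\in\mathbb C[t]$ is a nonzero polynomial with $\deg p_r\ge n_r-2$. Let $m\ge 1$, let $\mu:\mathfrak b^f_m\to\mathbb C$ be a Lie algebra homomorphism, and write $\mu_j=\mu(x^f_j)$ for $j\ge m$. There is a unique pair of Lie algebra homomorphisms $\ddot\mu:\mathrm{Vir}^f\to\mathbb C$, $\hat\mu:\mathfrak b_m\to\mathbb C$ such that: *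 for some polynomials $q_1,\dots,q_k\in\mathbb C[t]$ with $\deg q_r<n_r$ we have $\mu_j=\sum_r q_r(j)\lambda_r^j$ for all $j\ge 2m+1$ and $\ddot\mu(x^f_j)=\sum_r q_r(j)\lambda_r^j$ for all $j\in\mathbb Z$; and $\ddot\mu(z)=0$; * $\hat\mu(z)=\mu(z)$, $\hat\mu(e_j)=0$ for $j\ge 2m+1$, and $\sum_{i=0}^p a_i\hat\mu(e_{j+i})=\mu_j-\ddot\mu(x^f_j)$ for $m\le j\le 2m$. With these $\ddot\mu$ and $\hat\mu$, there is an isomorphism of $\mathrm{Vir}$-modules $$V^{f,m}_\mu\cong V^f_{\ddot\mu}\otimes L_{\hat\mu},$$ and this module is simple if and only if $\ddot\mu$ has large degree and $$\sum_{i=0}^p a_i\mu_{2m+i}\neq0\qquad\text{or}\qquad a_0\sum_{i=0}^p a_i\mu_{2m+i-1}-2a_1\sum_{i=0}^p a_i\mu_{2m+i}\neq0 .$$ -/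

import Mathlib

open Polynomial LaurentPolynomial TensorProduct LieAlgebra

noncomputable section

namespace VirasoroInduced

/-! ### The Virasoro algebra -/

/-- The derivation `t d/dt` of `ℂ[t, t⁻¹]`, i.e. `t ^ j ↦ j t ^ j`. -/
def euler : ℂ[T;T⁻¹] →ₗ[ℂ] ℂ[T;T⁻¹] where
  toFun u := AddMonoidAlgebra.ofCoeff
    (Finsupp.onFinset u.coeff.support (fun j => (j : ℂ) * u.coeff j) (by
      intro j hj
      simp only [Finsupp.mem_support_iff]
      exact right_ne_zero_of_mul hj))
  map_add' u v := by
    ext j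
    simp [mul_add]
  map_smul' c u := by
    ext j
    simp [mul_left_comm]

theorem euler_coeff (u : ℂ[T;T⁻¹]) (j : ℤ) : (euler u).coeff j = (j : ℂ) * u.coeff j := rfl

theorem euler_T (j : ℤ) : euler (T j) = (j : ℂ) • T j := by
  ext k
  simp only [euler_coeff, T_apply, AddMonoidAlgebra.coeff_smul, Finsupp.smul_apply, smul_eq_mul]
  split_ifs with h
  · rw [h]
  · simp

theorem euler_mul (u v : ℂ[T;T⁻¹]) : euler (u * v) = euler u * v + u * euler v := by
  induction u using LaurentPolynomial.induction_on' with
  | add p q hp hq => rw [add_mul, map_add, hp, hq, map_add]; ring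
  | C_mul_T n a =>
    induction v using LaurentPolynomial.induction_on' with
    | add p q hp hq => rw [mul_add, map_add, hp, hq, map_add]; ring
    | C_mul_T k b =>
      simp only [← LaurentPolynomial.smul_eq_C_mul, smul_mul_assoc, mul_smul_comm, map_smul,
        euler_T, ← T_add]
      simp only [smul_smul, ← add_smul]
      push_cast
      congr 1
      ring

/-- The coefficient of `t ^ 0`. -/
def constTerm : ℂ[T;T⁻¹] →ₗ[ℂ] ℂ where
  toFun u := u.coeff 0
  map_add' u v := by simp
  map_smul' c u := by simp

theorem constTerm_euler (u : ℂ[T;T⁻¹]) : constTerm (euler u) = 0 := by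
  change (euler u).coeff 0 = 0
  simp [euler_coeff]

/-- The underlying space of the Virasoro algebra: the pair `(u, c)` stands for
`∑ j, u_j e_j + c z`, where `u = ∑ j, u_j t ^ j`. -/
structure Vir where
  /-- the image in `ℂ[t, t⁻¹]` -/
  poly : ℂ[T;T⁻¹]
  /-- the coefficient of the central element -/
  cen : ℂ

namespace Vir

@[ext] theorem ext' {x y : Vir} (h : x.poly = y.poly) (h' : x.cen = y.cen) : x = y := by
  cases x; cases y; simp_all

/-- A vector of the Virasoro algebra as a pair. -/
def equivProd : Vir ≃ ℂ[T;T⁻¹] × ℂ where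
  toFun x := (x.poly, x.cen)
  invFun p := ⟨p.1, p.2⟩

instance : AddCommGroup Vir := equivProd.addCommGroup

instance : Module ℂ Vir := equivProd.module ℂ

@[simp] theorem add_poly (x y : Vir) : (x + y).poly = x.poly + y.poly := rfl
@[simp] theorem add_cen (x y : Vir) : (x + y).cen = x.cen + y.cen := rfl
@[simp] theorem zero_poly : (0 : Vir).poly = 0 := rfl
@[simp] theorem zero_cen : (0 : Vir).cen = 0 := rfl
@[simp] theorem smul_poly (c : ℂ) (x : Vir) : (c • x).poly = c • x.poly := rfl
@[simp] theorem sub_poly (x y : Vir) : (x - y).poly = x.poly - y.poly := rfl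
@[simp] theorem sub_cen (x y : Vir) : (x - y).cen = x.cen - y.cen := rfl
@[simp] theorem smul_cen (c : ℂ) (x : Vir) : (c • x).cen = c • x.cen := rfl

/-- The bilinear extension of `[e_j, e_k] = (k - j) e_{j+k} + δ_{k,-j} (j³ - j)/12 z`,
`[z, e_j] = 0`; see `lie_e_e` and `lie_z`. -/
instance : Bracket Vir Vir where
  bracket x y :=
    { poly := x.poly * euler y.poly - euler x.poly * y.poly
      cen := constTerm ((euler (euler (euler x.poly)) - euler x.poly) * y.poly) / 12 }

theorem lie_poly (x y : Vir) :
    ⁅x, y⁆.poly = x.poly * euler y.poly - euler x.poly * y.poly := rfl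

theorem lie_cen (x y : Vir) :
    ⁅x, y⁆.cen =
      constTerm ((euler (euler (euler x.poly)) - euler x.poly) * y.poly) / 12 := rfl

instance : LieRing Vir where
  add_lie x y w := by
    ext1
    · simp only [lie_poly, add_poly, map_add]; ring
    · simp only [lie_cen, add_cen, add_poly, map_add, ← add_div]
      rw [← constTerm.map_add]
      congr 2
      ring
  lie_add x y w := by
    ext1
    · simp only [lie_poly, add_poly, map_add]; ring
    · simp only [lie_cen, add_cen, add_poly, mul_add, map_add, ← add_div]
  lie_self x := by
    ext1
    · simp only [lie_poly, zero_poly]; ring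
    · simp only [lie_cen, zero_cen]
      have h : (euler (euler (euler x.poly)) - euler x.poly) * x.poly
          = euler (euler (euler x.poly) * x.poly - (1 / 2 : ℂ) • (euler x.poly * euler x.poly)
            - (1 / 2 : ℂ) • (x.poly * x.poly)) := by
        have h2 : ∀ u : ℂ[T;T⁻¹], (1 / 2 : ℂ) • (u + u) = u := by
          intro u
          rw [← two_smul ℂ u, smul_smul]
          norm_num
        rw [map_sub, map_sub, map_smul, map_smul, euler_mul, euler_mul, euler_mul,
          mul_comm (euler x.poly) (euler (euler x.poly)), h2, mul_comm x.poly (euler x.poly), h2]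
        ring
      rw [h, constTerm_euler, zero_div]
  leibniz_lie x y w := by
    ext1
    · simp only [lie_poly, add_poly, map_sub, euler_mul]; ring
    · simp only [lie_cen, lie_poly, add_cen, ← add_div]
      congr 1
      rw [← map_add, ← sub_eq_zero, ← map_sub]
      generalize x.poly = u
      generalize y.poly = v
      generalize w.poly = r
      have h : euler
          (u * (euler v * euler (euler r) - euler (euler v) * euler r)
            - v * (euler u * euler (euler r) - euler (euler u) * euler r)
            + r * (euler u * euler (euler v) - euler (euler u) * euler v)
            - (euler (euler (u * euler v - euler u * v)) * r
              - euler (u * euler v - euler u * v) * euler r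
              + (u * euler v - euler u * v) * euler (euler r))
            + (u * euler v - euler u * v) * r)
          = (euler (euler (euler u)) - euler u) * (v * euler r - euler v * r)
            - ((euler (euler (euler (u * euler v - euler u * v)))
                - euler (u * euler v - euler u * v)) * r
              + (euler (euler (euler v)) - euler v) * (u * euler r - euler u * r)) := by
        simp only [map_sub, map_add, euler_mul]
        ring
      rw [← constTerm_euler, h]

instance : LieAlgebra ℂ Vir where
  lie_smul c x y := by
    ext1
    · simp only [lie_poly, smul_poly, map_smul, smul_sub, mul_smul_comm]
    · simp only [lie_cen, smul_poly, smul_cen, map_smul, mul_smul_comm, smul_eq_mul, mul_div_assoc]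

end Vir

/-- The basis vector `e_j`. -/
def e (j : ℤ) : Vir := ⟨T j, 0⟩

/-- The central basis vector `z`. -/
def z : Vir := ⟨0, 1⟩

/-- The linear map `θ`, `θ e_j = t ^ j`, `θ z = 0`. -/
def theta : Vir →ₗ[ℂ] ℂ[T;T⁻¹] where
  toFun x := x.poly
  map_add' _ _ := rfl
  map_smul' _ _ := rfl

/-- The coefficient of `z`. -/
def central : Vir →ₗ[ℂ] ℂ where
  toFun x := x.cen
  map_add' _ _ := rfl
  map_smul' _ _ := rfl

theorem lie_e_e (j k : ℤ) :
    ⁅e j, e k⁆ = ((k : ℂ) - j) • e (j + k)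
      + (if k = -j then ((j : ℂ) ^ 3 - j) / 12 else 0) • z := by
  apply Vir.ext'
  · simp only [Vir.lie_poly, e, z, euler_T, mul_smul_comm, smul_mul_assoc, ← T_add,
      Vir.add_poly, Vir.smul_poly, smul_zero, add_zero, sub_smul, Vir.sub_poly]
  · have h : constTerm (T (j + k)) = if k = -j then 1 else 0 := by
      change (T (j + k) : ℂ[T;T⁻¹]).coeff 0 = _
      rw [T_apply]
      exact if_congr (by omega) rfl rfl
    simp only [Vir.lie_cen, e, z, euler_T, map_smul, ← sub_smul, smul_mul_assoc, ← T_add,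
      smul_smul, Vir.add_cen, Vir.smul_cen, h, smul_eq_mul]
    split_ifs <;> ring

theorem lie_z (x : Vir) : ⁅z, x⁆ = 0 := by
  apply Vir.ext' <;> simp [Vir.lie_poly, Vir.lie_cen, z]

theorem lie_z' (x : Vir) : ⁅x, z⁆ = 0 := by
  rw [← lie_skew, lie_z, neg_zero]

/-! ### Polynomial subalgebras and restricted polynomial subalgebras -/

/-- `x_j^f = a_0 e_j + a_1 e_{j+1} + ⋯ + a_p e_{j+p}` for `f = a_0 + a_1 t + ⋯ + a_p t ^ p`. -/
def xf (f : ℂ[X]) (j : ℤ) : Vir :=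
  ∑ i ∈ Finset.range (f.natDegree + 1), f.coeff i • e (j + i)

theorem theta_x (f : ℂ[X]) (j : ℤ) : theta (xf f j) = T j * toLaurent f := by
  conv_rhs => rw [f.as_sum_range_C_mul_X_pow]
  simp only [xf, map_sum, map_smul, Finset.mul_sum]
  refine Finset.sum_congr rfl fun i _ => ?_
  rw [toLaurent_C_mul_X_pow, LaurentPolynomial.smul_eq_C_mul]
  change _ * T _ = _
  rw [T_add]
  ring

theorem x_cen (f : ℂ[X]) (j : ℤ) : (xf f j).cen = 0 := by
  change central (xf f j) = 0
  simp only [xf, map_sum, map_smul]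
  exact Finset.sum_eq_zero fun i _ => by rw [show central (e (j + i)) = 0 from rfl, smul_zero]

/-- The polynomial subalgebra `Vir^f = θ⁻¹(⟨f⟩)`. -/
def polySub (f : ℂ[X]) : LieSubalgebra ℂ Vir where
  toSubmodule := ((Ideal.span {toLaurent f}).restrictScalars ℂ).comap theta
  lie_mem' := by
    intro v w hv hw
    simp only [AddSubsemigroup.mem_carrier, AddSubmonoid.mem_toSubsemigroup,
      Submodule.mem_toAddSubmonoid, Submodule.mem_comap, Submodule.restrictScalars_mem,
      Ideal.mem_span_singleton'] at hv hw ⊢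
    obtain ⟨a, ha⟩ := hv
    obtain ⟨b, hb⟩ := hw
    refine ⟨(a * euler b - euler a * b) * toLaurent f, ?_⟩
    change _ = theta v * euler (theta w) - euler (theta v) * theta w
    rw [← ha, ← hb, euler_mul, euler_mul]
    ring

theorem mem_polySub {f : ℂ[X]} {v : Vir} :
    v ∈ polySub f ↔ theta v ∈ Ideal.span {toLaurent f} := Iff.rfl

theorem x_mem_polySub (f : ℂ[X]) (j : ℤ) : xf f j ∈ polySub f := by
  rw [mem_polySub, theta_x]
  exact Ideal.mul_mem_left _ _ (Ideal.mem_span_singleton_self _)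

theorem z_mem_polySub (f : ℂ[X]) : z ∈ polySub f := by
  rw [mem_polySub]
  exact Submodule.zero_mem _

theorem polySub_le_of_dvd {f g : ℂ[X]} (h : g ∣ f) : polySub f ≤ polySub g := by
  intro v hv
  rw [mem_polySub] at hv ⊢
  exact Ideal.span_singleton_le_span_singleton.mpr (map_dvd _ h) hv

theorem lie_mem_span {S : Set Vir} (h : ∀ a ∈ S, ∀ b ∈ S, ⁅a, b⁆ ∈ Submodule.span ℂ S)
    {v w : Vir} (hv : v ∈ Submodule.span ℂ S) (hw : w ∈ Submodule.span ℂ S) :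
    ⁅v, w⁆ ∈ Submodule.span ℂ S := by
  induction hv, hw using Submodule.span_induction₂ with
  | mem_mem a b ha hb => exact h a ha b hb
  | zero_left y hy => simp
  | zero_right y hy => simp
  | add_left a b c _ _ _ h₁ h₂ => rw [add_lie]; exact Submodule.add_mem _ h₁ h₂
  | add_right a b c _ _ _ h₁ h₂ => rw [lie_add]; exact Submodule.add_mem _ h₁ h₂
  | smul_left r a b _ _ h₁ => rw [smul_lie]; exact Submodule.smul_mem _ _ h₁
  | smul_right r a b _ _ h₁ => rw [lie_smul]; exact Submodule.smul_mem _ _ h₁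

/-- `[x_j^f, x_k^f] = (k - j) ∑ i, a_i x_{j+k+i}^f + c z` for some scalar `c`. -/
theorem lie_x_x (f : ℂ[X]) (j k : ℤ) : ∃ c : ℂ,
    ⁅xf f j, xf f k⁆ = ((k : ℂ) - j) •
      (∑ i ∈ Finset.range (f.natDegree + 1), f.coeff i • xf f (j + k + i)) + c • z := by
  refine ⟨central ⁅xf f j, xf f k⁆, ?_⟩
  have hext : ∀ v w : Vir, theta v = theta w → central v = central w → v = w :=
    fun v w h h' => Vir.ext' h h'
  apply hext
  · change theta (xf f j) * euler (theta (xf f k)) - euler (theta (xf f j)) * theta (xf f k) = _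
    rw [map_add, map_smul, map_smul, map_sum]
    have hz : theta z = 0 := rfl
    simp only [map_smul, theta_x, hz, smul_zero, add_zero, euler_mul, euler_T]
    have hs : ∑ i ∈ Finset.range (f.natDegree + 1), f.coeff i • (T (j + k + i) * toLaurent f)
        = T (j + k) * toLaurent f * toLaurent f := by
      conv_rhs => rw [mul_assoc]; arg 2; arg 1; rw [f.as_sum_range_C_mul_X_pow]
      simp only [map_sum, Finset.mul_sum, Finset.sum_mul]
      refine Finset.sum_congr rfl fun i _ => ?_
      rw [toLaurent_C_mul_X_pow, LaurentPolynomial.smul_eq_C_mul, T_add (j + k)]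
      ring
    rw [hs, T_add]
    simp only [LaurentPolynomial.smul_eq_C_mul, map_sub]
    ring
  · rw [map_add, map_smul, map_smul, map_sum]
    have hx : ∀ j, central (xf f j) = 0 := fun j => x_cen f j
    simp only [map_smul, hx]
    have hz : central z = 1 := rfl
    simp [hz]

/-- `𝔟_m = span {z, e_j ∣ j ≥ m}`. -/
def bSub (m : ℕ) : LieSubalgebra ℂ Vir where
  toSubmodule := Submodule.span ℂ ({z} ∪ {v | ∃ j : ℤ, (m : ℤ) ≤ j ∧ v = e j})
  lie_mem' := by
    intro v w hv hw
    refine lie_mem_span ?_ hv hw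
    rintro a (rfl | ⟨j, hj, rfl⟩) b (rfl | ⟨k, hk, rfl⟩)
    · simp
    · rw [lie_z]; exact Submodule.zero_mem _
    · rw [lie_z']; exact Submodule.zero_mem _
    · rw [lie_e_e]
      exact Submodule.add_mem _
        (Submodule.smul_mem _ _ (Submodule.subset_span (Or.inr ⟨j + k, by omega, rfl⟩)))
        (Submodule.smul_mem _ _ (Submodule.subset_span (Or.inl rfl)))

theorem e_mem_bSub {m : ℕ} {j : ℤ} (hj : (m : ℤ) ≤ j) : e j ∈ bSub m :=
  Submodule.subset_span (Or.inr ⟨j, hj, rfl⟩)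

theorem z_mem_bSub (m : ℕ) : z ∈ bSub m :=
  Submodule.subset_span (Or.inl rfl)

/-- The restricted polynomial subalgebra `𝔟_m^f = span {z, x_j^f ∣ j ≥ m}`. -/
def bPolySub (f : ℂ[X]) (m : ℕ) : LieSubalgebra ℂ Vir where
  toSubmodule := Submodule.span ℂ ({z} ∪ {v | ∃ j : ℤ, (m : ℤ) ≤ j ∧ v = xf f j})
  lie_mem' := by
    intro v w hv hw
    refine lie_mem_span ?_ hv hw
    rintro a (rfl | ⟨j, hj, rfl⟩) b (rfl | ⟨k, hk, rfl⟩)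
    · simp
    · rw [lie_z]; exact Submodule.zero_mem _
    · rw [lie_z']; exact Submodule.zero_mem _
    · obtain ⟨c, hc⟩ := lie_x_x f j k
      rw [hc]
      refine Submodule.add_mem _ (Submodule.smul_mem _ _ (Submodule.sum_mem _ fun i _ =>
        Submodule.smul_mem _ _ (Submodule.subset_span (Or.inr ⟨j + k + i, by omega, rfl⟩))))
        (Submodule.smul_mem _ _ (Submodule.subset_span (Or.inl rfl)))

theorem x_mem_bPolySub (f : ℂ[X]) {m : ℕ} {j : ℤ} (hj : (m : ℤ) ≤ j) : xf f j ∈ bPolySub f m :=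
  Submodule.subset_span (Or.inr ⟨j, hj, rfl⟩)

theorem z_mem_bPolySub (f : ℂ[X]) (m : ℕ) : z ∈ bPolySub f m :=
  Submodule.subset_span (Or.inl rfl)

/-! ### Induced modules -/

section Induced

variable {L : Type} [LieRing L] [LieAlgebra ℂ L] (H : LieSubalgebra ℂ L)

section General

variable (M : Type) [AddCommGroup M] [Module ℂ M] [LieRingModule H M]

/-- The relations `u h ⊗ w = u ⊗ h w`, `u ∈ U(L)`, `h ∈ H`, `w ∈ M`. Since `H` generates `U(H)`,
the quotient of `U(L) ⊗_ℂ M` by them is `U(L) ⊗_{U(H)} M`. -/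
def balancing : Submodule (UniversalEnvelopingAlgebra ℂ L) (UniversalEnvelopingAlgebra ℂ L ⊗[ℂ] M) :=
  Submodule.span _ {v | ∃ (u : UniversalEnvelopingAlgebra ℂ L) (h : H) (w : M),
    v = (u * UniversalEnvelopingAlgebra.ι ℂ (h : L)) ⊗ₜ[ℂ] w - u ⊗ₜ[ℂ] ⁅h, w⁆}

/-- The induced module `Ind_H^L M = U(L) ⊗_{U(H)} M`. -/
def Ind : Type := (UniversalEnvelopingAlgebra ℂ L ⊗[ℂ] M) ⧸ balancing H M

instance : AddCommGroup (Ind H M) :=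
  inferInstanceAs (AddCommGroup ((UniversalEnvelopingAlgebra ℂ L ⊗[ℂ] M) ⧸ balancing H M))

instance : Module (UniversalEnvelopingAlgebra ℂ L) (Ind H M) :=
  inferInstanceAs (Module (UniversalEnvelopingAlgebra ℂ L)
    ((UniversalEnvelopingAlgebra ℂ L ⊗[ℂ] M) ⧸ balancing H M))

instance : Module ℂ (Ind H M) :=
  inferInstanceAs (Module ℂ ((UniversalEnvelopingAlgebra ℂ L ⊗[ℂ] M) ⧸ balancing H M))

instance : IsScalarTower ℂ (UniversalEnvelopingAlgebra ℂ L) (Ind H M) :=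
  inferInstanceAs (IsScalarTower ℂ (UniversalEnvelopingAlgebra ℂ L)
    ((UniversalEnvelopingAlgebra ℂ L ⊗[ℂ] M) ⧸ balancing H M))

/-- `L` acts on the induced module through `L → U(L)`. -/
instance : LieRingModule L (Ind H M) where
  bracket a v := UniversalEnvelopingAlgebra.ι ℂ a • v
  add_lie a b v := by rw [map_add, add_smul]
  lie_add a v w := smul_add _ v w
  leibniz_lie a b v := by
    change _ • _ • v = UniversalEnvelopingAlgebra.ι ℂ ⁅a, b⁆ • v + _ • _ • v
    let _ := LieRing.ofAssociativeRing (A := UniversalEnvelopingAlgebra ℂ L)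
    rw [LieHom.map_lie, LieRing.of_associative_ring_bracket, sub_smul, mul_smul, mul_smul]
    abel

theorem Ind.lie_def (a : L) (v : Ind H M) : ⁅a, v⁆ = UniversalEnvelopingAlgebra.ι ℂ a • v := rfl

instance : LieModule ℂ L (Ind H M) where
  smul_lie c a v := by
    rw [Ind.lie_def, Ind.lie_def, map_smul, smul_assoc]
  lie_smul c a v := by
    rw [Ind.lie_def, Ind.lie_def, ← algebraMap_smul (UniversalEnvelopingAlgebra ℂ L) c v,
      ← algebraMap_smul (UniversalEnvelopingAlgebra ℂ L) c (_ • v), smul_smul, smul_smul,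
      Algebra.commutes]

end General

variable {H}

/-- The one-dimensional `H`-module `ℂ_χ` on which `h ∈ H` acts as the scalar `χ h`. -/
def OneDim (_ : LieCharacter ℂ H) : Type := ℂ

variable (χ : LieCharacter ℂ H)

instance : AddCommGroup (OneDim χ) := inferInstanceAs (AddCommGroup ℂ)

instance : Module ℂ (OneDim χ) := inferInstanceAs (Module ℂ ℂ)

instance : LieRingModule H (OneDim χ) where
  bracket h w := χ h • w
  add_lie h k w := by
    change χ (h + k) • w = χ h • w + χ k • w
    rw [map_add, add_smul]
  lie_add h v w := smul_add (χ h) v w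
  leibniz_lie h k w := by
    change χ h • χ k • w = χ ⁅h, k⁆ • w + χ k • χ h • w
    rw [lieCharacter_apply_lie, zero_smul, zero_add, smul_comm]

instance : LieModule ℂ H (OneDim χ) where
  smul_lie c h w := by
    change χ (c • h) • w = c • χ h • w
    rw [map_smul, smul_assoc]
  lie_smul c h w := smul_comm (χ h) c w

end Induced

/-- `V^f_μ`, induced from the character `μ` of `Vir^f`. -/
abbrev VPoly (f : ℂ[X]) (μ : LieCharacter ℂ (polySub f)) : Type := Ind (polySub f) (OneDim μ)

/-- `V^{f,m}_μ`, induced from the character `μ` of `𝔟_m^f`. -/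
abbrev VRestricted (f : ℂ[X]) (m : ℕ) (μ : LieCharacter ℂ (bPolySub f m)) : Type :=
  Ind (bPolySub f m) (OneDim μ)

/-- `L_ψ`, induced from the character `ψ` of `𝔟_m` (a Whittaker module when `m ≥ 1`, `ψ ≠ 0`). -/
abbrev Whittaker (m : ℕ) (ψ : LieCharacter ℂ (bSub m)) : Type := Ind (bSub m) (OneDim ψ)

/-! ### Characters -/

/-- `μ_j = μ (x_j^f)` for a character `μ` of `𝔟_m^f` and `j ≥ m`. -/
def val {f : ℂ[X]} {m : ℕ} (μ : LieCharacter ℂ (bPolySub f m)) (j : ℤ) (hj : (m : ℤ) ≤ j) : ℂ :=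
  μ ⟨xf f j, x_mem_bPolySub f hj⟩

/-- `μ_j = μ (x_j^f)` for a character `μ` of `Vir^f`. -/
def polyVal {f : ℂ[X]} (μ : LieCharacter ℂ (polySub f)) (j : ℤ) : ℂ :=
  μ ⟨xf f j, x_mem_polySub f j⟩

/-- A character `μ` of `Vir^f` has large degree: with `f = ∏ (t - r) ^ n_r` over the distinct roots
`r` of `f`, one has `μ = ∑ ν_r` on `Vir^f`, where `ν_r` is a character of `Vir^{(t - r)^{n_r}}` with
`ν_r (x_j) = p_r(j) r ^ j` for a polynomial `p_r` with `deg p_r ≥ n_r - 2`, where `deg 0 = -∞`. -/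
def LargeDegree (f : ℂ[X]) (μ : LieCharacter ℂ (polySub f)) : Prop :=
  ∃ (ν : ∀ r : ℂ, LieCharacter ℂ (polySub ((X - Polynomial.C r) ^ f.rootMultiplicity r)))
    (p : ℂ → ℂ[X]),
    (∀ v : polySub f, μ v = ∑ r ∈ f.roots.toFinset,
      ν r ⟨v, polySub_le_of_dvd (pow_rootMultiplicity_dvd f r) v.2⟩) ∧
    (∀ r ∈ f.roots.toFinset, ∀ j : ℤ, polyVal (ν r) j = (p r).eval (j : ℂ) * r ^ j) ∧
    (∀ r ∈ f.roots.toFinset, p r ≠ 0 ∧ f.rootMultiplicity r ≤ (p r).natDegree + 2)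

/-- `μdd` is the character `μ̈` of `Vir^f` attached to the character `μ` of `𝔟_m^f`: if
`μ_j = ∑ q_r(j) r ^ j` for `j ≥ 2m + 1`, the sum being over the distinct roots `r` of `f`, with
polynomials `q_r` of degree less than the multiplicity of `r`, then `μ̈_j = ∑ q_r(j) r ^ j` for all
integers `j`, and `μ̈ z = 0`. -/
def IsDDot {f : ℂ[X]} {m : ℕ} (μ : LieCharacter ℂ (bPolySub f m))
    (μdd : LieCharacter ℂ (polySub f)) : Prop :=
  (∃ q : ℂ → ℂ[X],
    (∀ r ∈ f.roots.toFinset, (q r).degree < f.rootMultiplicity r) ∧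
    (∀ (j : ℤ) (hj : 2 * (m : ℤ) + 1 ≤ j),
      val μ j (by omega) = ∑ r ∈ f.roots.toFinset, (q r).eval (j : ℂ) * r ^ j) ∧
    (∀ j : ℤ, polyVal μdd j = ∑ r ∈ f.roots.toFinset, (q r).eval (j : ℂ) * r ^ j)) ∧
  μdd ⟨z, z_mem_polySub f⟩ = 0

/-- `μh` is the character `μ̂` of `𝔟_m` attached to `μ` and `μ̈`: `μ̂ z = μ z`, `μ̂_j = 0` for
`j ≥ 2m + 1`, and `∑ i, a_i μ̂_{j+i} = μ_j - μ̈_j` for `m ≤ j ≤ 2m`. -/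
def IsHat {f : ℂ[X]} {m : ℕ} (μ : LieCharacter ℂ (bPolySub f m))
    (μdd : LieCharacter ℂ (polySub f)) (μh : LieCharacter ℂ (bSub m)) : Prop :=
  μh ⟨z, z_mem_bSub m⟩ = μ ⟨z, z_mem_bPolySub f m⟩ ∧
  (∀ (j : ℤ) (hj : 2 * (m : ℤ) + 1 ≤ j), μh ⟨e j, e_mem_bSub (by omega)⟩ = 0) ∧
  (∀ (j : ℤ) (hj : (m : ℤ) ≤ j), j ≤ 2 * (m : ℤ) →
    ∑ i ∈ Finset.range (f.natDegree + 1), f.coeff i * μh ⟨e (j + i), e_mem_bSub (by omega)⟩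
      = val μ j hj - polyVal μdd j)

end VirasoroInduced

end

open VirasoroInduced

/-! The mechanism is a separation principle. The subalgebras `Vir^(f^k)` and `span {e_j | j ≥ k}`
shrink as `k` grows, yet for every `k` they span `Vir` together, because `t` and `f` are coprime
when `a_0 ≠ 0`. On a module where each vector is killed by the intersection of the two for some `k`,
an element may act through a representative in either family. This splits the action into two
commuting actions whose sum is the original one. On `𝔟_m^f = Vir^f ∩ 𝔟_m` one has `μ = μ̈ + μ̂`,
where `μ̈` kills `Vir^(f^2)` and `μ̂` kills `e_j` for `j ≥ 2m + 1`. The splitting then gives the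
tensor isomorphism (`Adapted.nonempty_equiv`). Conversely, every submodule of the tensor product is
stable under `Vir` acting on either factor alone (`Separating.rTensor_mem`,
`Separating.lTensor_mem`). The same principle for powers of coprime polynomials separates the roots
of `f`.

A character of `Vir^f` kills `z` and all multiples of `f^2`, so it is a linear form on
`ℂ[t,t⁻¹]/(f)` (`char_z`, `form_mul`, `exists_char`), that is, a sum of exponential polynomials
(`exists_eq_sum_forms`, `exists_expForm`). The relations on `μ` say the same on `t^(2m+1) ℂ[t]`,
which surjects onto this quotient; this determines `μ̈`. What remains of `μ` determines `μ̂` through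
a triangular system with diagonal entry `a_0`.

For simplicity, `Descends χ` strengthens irreducibility so that it passes to tensor products with a
simple module (`Adapted.isIrreducible`). It is proved by filtering words in a complement of `H`: a
dual vector minus its scalar acts on top-degree terms as a derivative along one letter, so a nonzero
vector can be lowered to degree zero (`DescentData.descends`). This covers the Whittaker factor and
the multiple roots. At a simple root the degree argument breaks down, and `descends_simple_root`
uses the polynomial dependence of the action of `e_j` on `j` instead.

For necessity, a character that extends to a larger subalgebra gives a nonzero map of induced
modules with nonzero kernel (`Ind.not_isIrreducible_of_extension`). This requires the stabiliser of
the generating line to be no larger than `H`, a consequence of a Poincaré-Birkhoff-Witt argument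
(`model_isRep`, `exists_model`). If `μ̂` vanishes at `e_(2m)` and `e_(2m-1)`, then `μ` extends to
`𝔟_(m-1)^f`; if `μ̈` lacks large degree, `μ` extends to `𝔟_m^G` with `G = f/(t - r)` for some root
`r`.

Finally, the sums in the criterion are values of `μ̂` at `t^n f^2`, and only the two lowest
coefficients of `f^2` matter there (`IsHat.sum_eq`, `IsHat.apply_sq`). -/

noncomputable section

namespace VirasoroInduced

/-! ### Representations and the universal property of induced modules -/

section Representations

variable {L : Type} [LieRing L] [LieAlgebra ℂ L]

/-- A linear map `ρ : L → End X` is a representation of the Lie algebra `L`. -/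
def IsRep {X : Type} [AddCommGroup X] [Module ℂ X] (ρ : L →ₗ[ℂ] Module.End ℂ X) : Prop :=
  ∀ a b x, ρ ⁅a, b⁆ x = ρ a (ρ b x) - ρ b (ρ a x)

/-- The representation given by a Lie module. -/
def lieRep (X : Type) [AddCommGroup X] [Module ℂ X] [LieRingModule L X] [LieModule ℂ L X] :
    L →ₗ[ℂ] Module.End ℂ X where
  toFun a :=
    { toFun := fun x => ⁅a, x⁆
      map_add' := fun x y => lie_add a x y
      map_smul' := fun c x => lie_smul c a x }
  map_add' a b := by ext x; exact add_lie a b x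
  map_smul' c a := by ext x; exact smul_lie c a x

section

variable {X : Type} [AddCommGroup X] [Module ℂ X] [LieRingModule L X] [LieModule ℂ L X]

@[simp] theorem lieRep_apply (a : L) (x : X) : lieRep X a x = ⁅a, x⁆ := rfl

theorem isRep_lieRep : IsRep (lieRep X : L →ₗ[ℂ] Module.End ℂ X) := fun a b x => by
  simp only [lieRep_apply, lie_lie]

end

attribute [local instance 100] LieRing.ofAssociativeRing

/-- The action of the universal enveloping algebra attached to a representation. -/
def IsRep.extend {X : Type} [AddCommGroup X] [Module ℂ X] {ρ : L →ₗ[ℂ] Module.End ℂ X}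
    (h : IsRep ρ) : UniversalEnvelopingAlgebra ℂ L →ₐ[ℂ] Module.End ℂ X :=
  UniversalEnvelopingAlgebra.lift ℂ
    { ρ with
      map_lie' := by
        intro a b
        ext x
        exact h a b x }

theorem IsRep.extend_ι {X : Type} [AddCommGroup X] [Module ℂ X] {ρ : L →ₗ[ℂ] Module.End ℂ X}
    (h : IsRep ρ) (a : L) : h.extend (UniversalEnvelopingAlgebra.ι ℂ a) = ρ a :=
  UniversalEnvelopingAlgebra.lift_ι_apply ℂ _ a

/-- A subalgebra of `U(L)` containing `L` is everything. -/
theorem UEA_subalgebra_eq_top (S : Subalgebra ℂ (UniversalEnvelopingAlgebra ℂ L))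
    (h : ∀ a : L, UniversalEnvelopingAlgebra.ι ℂ a ∈ S) : S = ⊤ := by
  let g : L →ₗ⁅ℂ⁆ S :=
    { toFun := fun a => ⟨UniversalEnvelopingAlgebra.ι ℂ a, h a⟩
      map_add' := fun a b => Subtype.ext (map_add _ a b)
      map_smul' := fun c a => Subtype.ext (map_smul _ c a)
      map_lie' := fun {a b} => Subtype.ext (LieHom.map_lie _ a b) }
  have hg : S.val.comp (UniversalEnvelopingAlgebra.lift ℂ g) = AlgHom.id ℂ _ := by
    apply UniversalEnvelopingAlgebra.hom_ext
    ext a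
    change ((UniversalEnvelopingAlgebra.lift ℂ g (UniversalEnvelopingAlgebra.ι ℂ a) : S) :
      UniversalEnvelopingAlgebra ℂ L) = UniversalEnvelopingAlgebra.ι ℂ a
    rw [UniversalEnvelopingAlgebra.lift_ι_apply]
    rfl
  rw [eq_top_iff]
  intro u _
  have := DFunLike.congr_fun hg u
  rw [← show _ = u from this]
  exact (UniversalEnvelopingAlgebra.lift ℂ g u).2

variable {H : LieSubalgebra ℂ L} (χ : LieCharacter ℂ H)

/-- The underlying complex number of a vector of `ℂ_χ`. -/
def OneDim.toComplex : OneDim χ →ₗ[ℂ] ℂ := (LinearMap.id : ℂ →ₗ[ℂ] ℂ)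

/-- The canonical generator of `Ind_H ℂ_χ`. -/
def Ind.gen : Ind H (OneDim χ) :=
  Submodule.Quotient.mk (1 ⊗ₜ[ℂ] (show OneDim χ from (1 : ℂ)))

theorem Ind.mk_tmul (u : UniversalEnvelopingAlgebra ℂ L) (c : ℂ) :
    (Submodule.Quotient.mk (u ⊗ₜ[ℂ] (show OneDim χ from c)) : Ind H (OneDim χ))
      = (c • u) • Ind.gen χ := by
  change _ = Submodule.Quotient.mk ((c • u) • (1 ⊗ₜ[ℂ] (show OneDim χ from (1 : ℂ))))
  rw [TensorProduct.smul_tmul', smul_eq_mul, mul_one, TensorProduct.smul_tmul]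
  congr 2
  change c = c * 1
  rw [mul_one]

theorem Ind.lie_gen (h : L) (hh : h ∈ H) : ⁅h, Ind.gen χ⁆ = χ ⟨h, hh⟩ • Ind.gen χ := by
  have h1 : ⁅h, Ind.gen χ⁆ = (Submodule.Quotient.mk
      ((1 * UniversalEnvelopingAlgebra.ι ℂ h) ⊗ₜ[ℂ] (show OneDim χ from (1 : ℂ))) :
        Ind H (OneDim χ)) := by
    rw [one_mul, Ind.mk_tmul, one_smul]
    rfl
  have h2 : χ ⟨h, hh⟩ • Ind.gen χ = (Submodule.Quotient.mk
      (1 ⊗ₜ[ℂ] ⁅(⟨h, hh⟩ : H), (show OneDim χ from (1 : ℂ))⁆) : Ind H (OneDim χ)) := by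
    have : (⁅(⟨h, hh⟩ : H), (show OneDim χ from (1 : ℂ))⁆ : OneDim χ)
        = (show OneDim χ from χ ⟨h, hh⟩) := by
      change χ ⟨h, hh⟩ * (1 : ℂ) = χ ⟨h, hh⟩
      rw [mul_one]
    rw [this, Ind.mk_tmul, smul_assoc, one_smul]
  rw [h1, h2]
  refine (Submodule.Quotient.eq _).mpr (Submodule.subset_span ⟨1, ⟨h, hh⟩, _, rfl⟩)

/-- An `L`-stable subspace of `Ind_H ℂ_χ` containing the generator is everything. -/
theorem Ind.eq_top_of_gen_mem (N : Submodule ℂ (Ind H (OneDim χ))) (h0 : Ind.gen χ ∈ N)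
    (hN : ∀ (a : L), ∀ v ∈ N, ⁅a, v⁆ ∈ N) : N = ⊤ := by
  let S : Subalgebra ℂ (UniversalEnvelopingAlgebra ℂ L) :=
    { carrier := {u | ∀ v ∈ N, u • v ∈ N}
      mul_mem' := fun {a b} ha hb v hv => by rw [mul_smul]; exact ha _ (hb v hv)
      add_mem' := fun {a b} ha hb v hv => by rw [add_smul]; exact N.add_mem (ha v hv) (hb v hv)
      algebraMap_mem' := fun c v hv => by rw [algebraMap_smul]; exact N.smul_mem c hv }
  have hS : S = ⊤ := UEA_subalgebra_eq_top S hN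
  have hgen : ∀ u : UniversalEnvelopingAlgebra ℂ L, u • Ind.gen χ ∈ N := fun u =>
    (show u ∈ S by rw [hS]; trivial) _ h0
  rw [eq_top_iff]
  intro v _
  induction v using Submodule.Quotient.induction_on with
  | _ t =>
    induction t using TensorProduct.induction_on with
    | zero => exact N.zero_mem
    | tmul u c => exact (Ind.mk_tmul χ u c).symm ▸ hgen _
    | add s t hs ht => exact N.add_mem (hs trivial) (ht trivial)

/-- The universal property of `Ind_H ℂ_χ`. -/
theorem Ind.exists_lift {X : Type} [AddCommGroup X] [Module ℂ X] {ρ : L →ₗ[ℂ] Module.End ℂ X}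
    (hρ : IsRep ρ) (x₀ : X) (hx : ∀ h : H, ρ h x₀ = χ h • x₀) :
    ∃ φ : Ind H (OneDim χ) →ₗ[ℂ] X, φ (Ind.gen χ) = x₀ ∧ ∀ a v, φ ⁅a, v⁆ = ρ a (φ v) := by
  let A := hρ.extend
  let φ₀ : UniversalEnvelopingAlgebra ℂ L ⊗[ℂ] OneDim χ →ₗ[ℂ] X :=
    TensorProduct.lift (LinearMap.mk₂ ℂ (fun u c => OneDim.toComplex χ c • A u x₀)
      (fun u v c => by rw [map_add, LinearMap.add_apply, smul_add])
      (fun r u c => by rw [map_smul, LinearMap.smul_apply, smul_comm])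
      (fun u c d => by rw [map_add, add_smul])
      (fun r u c => by rw [map_smul, smul_assoc]))
  have hA : ∀ a t, φ₀ (a • t) = A a (φ₀ t) := by
    intro a t
    induction t using TensorProduct.induction_on with
    | zero => simp
    | tmul u c =>
      rw [TensorProduct.smul_tmul', smul_eq_mul]
      change OneDim.toComplex χ c • A (a * u) x₀ = A a (OneDim.toComplex χ c • A u x₀)
      rw [map_mul, Module.End.mul_apply, map_smul]
    | add s t hs ht => rw [smul_add, map_add, map_add, map_add, hs, ht]
  have hker : ∀ t ∈ balancing H (OneDim χ), φ₀ t = 0 := by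
    intro t ht
    induction ht using Submodule.span_induction with
    | mem t ht =>
      obtain ⟨u, h, c, rfl⟩ := ht
      rw [map_sub, sub_eq_zero]
      change OneDim.toComplex χ c • A (u * UniversalEnvelopingAlgebra.ι ℂ (h : L)) x₀
        = (χ h * OneDim.toComplex χ c) • A u x₀
      rw [map_mul, Module.End.mul_apply, hρ.extend_ι, hx, map_smul, smul_smul, mul_comm]
    | zero => exact map_zero _
    | add s t _ _ hs ht => rw [map_add, hs, ht, add_zero]
    | smul a t _ ht => rw [hA, ht, map_zero]
  let φ : Ind H (OneDim χ) →ₗ[ℂ] X :=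
    Submodule.liftQ ((balancing H (OneDim χ)).restrictScalars ℂ) φ₀ hker
  have hφ : ∀ t, φ (Submodule.Quotient.mk t) = φ₀ t := fun t => rfl
  refine ⟨φ, ?_, ?_⟩
  · rw [Ind.gen, hφ]
    change (1 : ℂ) • A 1 x₀ = x₀
    rw [map_one, one_smul, Module.End.one_apply]
  · intro a v
    induction v using Submodule.Quotient.induction_on with
    | _ t =>
      change φ (Submodule.Quotient.mk (UniversalEnvelopingAlgebra.ι ℂ a • t))
        = ρ a (φ (Submodule.Quotient.mk t))
      rw [hφ, hφ, hA, hρ.extend_ι]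

/-- Two equivariant maps out of `Ind_H ℂ_χ` that agree on the generator are equal. -/
theorem Ind.hom_ext {X : Type} [AddCommGroup X] [Module ℂ X] (ρ : L →ₗ[ℂ] Module.End ℂ X)
    {φ ψ : Ind H (OneDim χ) →ₗ[ℂ] X} (hφ : ∀ a v, φ ⁅a, v⁆ = ρ a (φ v))
    (hψ : ∀ a v, ψ ⁅a, v⁆ = ρ a (ψ v)) (h : φ (Ind.gen χ) = ψ (Ind.gen χ)) : φ = ψ := by
  have := Ind.eq_top_of_gen_mem χ (LinearMap.eqLocus φ ψ) h fun a v hv => by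
    rw [LinearMap.mem_eqLocus] at hv ⊢
    rw [hφ, hψ, hv]
  ext v
  exact (show v ∈ LinearMap.eqLocus φ ψ by rw [this]; trivial)

end Representations

end VirasoroInduced

end

noncomputable section

namespace VirasoroInduced

/-! ### A polynomial model of an induced module -/

section PolynomialModel

open Module

variable {L : Type} [LieRing L] [LieAlgebra ℂ L] {C D : Type}

/-- The monomial attached to a multiset of generators. -/
abbrev mono (M : Multiset C) : Multiset C →₀ ℂ := Finsupp.single M 1

/-- The leading term of the action of a basis vector on a monomial. -/
def leading : C ⊕ D → Multiset C → (Multiset C →₀ ℂ)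
  | Sum.inl c, M => mono (c ::ₘ M)
  | Sum.inr _, _ => 0

/-- The polynomials of degree less than `n`. -/
abbrev degLT (C : Type) (n : ℕ) : Submodule ℂ (Multiset C →₀ ℂ) :=
  Finsupp.supported ℂ ℂ {M | Multiset.card M < n}

theorem mono_mem_degLT {n : ℕ} {M : Multiset C} (h : Multiset.card M < n) :
    mono M ∈ degLT C n :=
  Finsupp.single_mem_supported ℂ 1 h

theorem degLT_mono {n m : ℕ} (h : n ≤ m) : degLT C n ≤ degLT C m :=
  Finsupp.supported_mono fun _ hM => lt_of_lt_of_le hM h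

theorem leading_mem (i : C ⊕ D) {n : ℕ} {M : Multiset C} (h : Multiset.card M + 1 < n) :
    leading i M ∈ degLT C n := by
  cases i with
  | inl c => exact mono_mem_degLT (by rwa [Multiset.card_cons])
  | inr d => exact Submodule.zero_mem _

theorem degLT_induction {n : ℕ} (P : Submodule ℂ (Multiset C →₀ ℂ))
    (h : ∀ M : Multiset C, Multiset.card M < n → mono M ∈ P) : degLT C n ≤ P := by
  rw [degLT, Finsupp.supported_eq_span_single, Submodule.span_le]
  rintro _ ⟨M, hM, rfl⟩
  exact h M hM

variable (b : Basis (C ⊕ D) ℂ L) (χ : D → ℂ)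

theorem basis_lift_mem {P : Submodule ℂ (Multiset C →₀ ℂ)}
    (f : L →ₗ[ℂ] (Multiset C →₀ ℂ)) (h : ∀ i, f (b i) ∈ P) (x : L) : f x ∈ P := by
  have : (⊤ : Submodule ℂ L) ≤ P.comap f := by
    rw [← b.span_eq, Submodule.span_le]
    rintro _ ⟨i, rfl⟩
    exact h i
  exact this trivial

theorem comm_of_basis {X : Type} [AddCommGroup X] [Module ℂ X] (A : L →ₗ[ℂ] Module.End ℂ X) (p : X)
    (h : ∀ i j, A (b i) (A (b j) p) - A (b j) (A (b i) p) = A ⁅b i, b j⁆ p) (x y : L) :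
    A x (A y p) - A y (A x p) = A ⁅x, y⁆ p := by
  have hx : x ∈ Submodule.span ℂ (Set.range b) := by rw [b.span_eq]; trivial
  have hy : y ∈ Submodule.span ℂ (Set.range b) := by rw [b.span_eq]; trivial
  induction hx, hy using Submodule.span_induction₂ with
  | mem_mem x y hx hy =>
    obtain ⟨i, rfl⟩ := hx
    obtain ⟨j, rfl⟩ := hy
    exact h i j
  | zero_left => simp
  | zero_right => simp
  | add_left x y z _ _ _ h₁ h₂ =>
    simp only [map_add, LinearMap.add_apply, add_lie, ← h₁, ← h₂]
    abel
  | add_right x y z _ _ _ h₁ h₂ =>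
    simp only [map_add, LinearMap.add_apply, lie_add, ← h₁, ← h₂]
    abel
  | smul_left r x y _ _ h₁ =>
    simp only [map_smul, LinearMap.smul_apply, smul_lie, ← h₁, smul_sub]
  | smul_right r x y _ _ h₁ =>
    simp only [map_smul, LinearMap.smul_apply, lie_smul, ← h₁, smul_sub]

variable [LinearOrder C]

theorem Multiset.exists_least {M : Multiset C} (h : M ≠ 0) : ∃ j ∈ M, ∀ k ∈ M, j ≤ k := by
  classical
  obtain ⟨a, ha⟩ := Multiset.exists_mem_of_ne_zero h
  have hne : M.toFinset.Nonempty := ⟨a, Multiset.mem_toFinset.mpr ha⟩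
  exact ⟨_, Multiset.mem_toFinset.mp (M.toFinset.min'_mem hne),
    fun k hk => M.toFinset.min'_le k (Multiset.mem_toFinset.mpr hk)⟩

/-- The basis vector is a generator which is at most every generator in the monomial. -/
def IsLow : C ⊕ D → Multiset C → Prop
  | Sum.inl c, M => ∀ k ∈ M, c ≤ k
  | Sum.inr _, _ => False

/-- The scalar by which a vector of the inducing subalgebra acts on the empty monomial. -/
def charTerm (χ : D → ℂ) : C ⊕ D → ℂ
  | Sum.inl _ => 0
  | Sum.inr d => χ d

open Classical in
/-- One step of the recursion that determines the action on the polynomial model. -/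
def modelStep (act : L →ₗ[ℂ] (Multiset C →₀ ℂ) →ₗ[ℂ] (Multiset C →₀ ℂ)) (i : C ⊕ D)
    (M : Multiset C) : Multiset C →₀ ℂ :=
  if h : M = 0 then leading i 0 + charTerm χ i • mono 0
  else if IsLow i M then leading i M
  else
    let j := (Multiset.exists_least h).choose
    let N := M.erase j
    -- This is `b_i b_j N = b_j b_i N + [b_i, b_j] N`. The leading part of `b_i N` turns into
    -- `leading i M` under `b_j`, so only the remainder is passed to `act`.
    leading i M + act (b (Sum.inl j)) (act (b i) (mono N) - leading i N)
      + act ⁅b i, b (Sum.inl j)⁆ (mono N)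

theorem modelStep_zero (act : L →ₗ[ℂ] (Multiset C →₀ ℂ) →ₗ[ℂ] (Multiset C →₀ ℂ)) (i : C ⊕ D) :
    modelStep b χ act i 0 = leading i 0 + charTerm χ i • mono 0 := by
  rw [modelStep, dif_pos rfl]

theorem modelStep_of_isLow (act : L →ₗ[ℂ] (Multiset C →₀ ℂ) →ₗ[ℂ] (Multiset C →₀ ℂ)) {i : C ⊕ D}
    {M : Multiset C} (h : IsLow i M) : modelStep b χ act i M = leading i M := by
  rw [modelStep]
  split_ifs with h0
  · subst h0
    cases i with
    | inl c => simp [charTerm]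
    | inr d => exact h.elim
  · rfl

theorem modelStep_cons (act : L →ₗ[ℂ] (Multiset C →₀ ℂ) →ₗ[ℂ] (Multiset C →₀ ℂ)) {i : C ⊕ D}
    {j : C} {N : Multiset C} (hj : ∀ k ∈ N, j ≤ k) (h : ¬ IsLow i (j ::ₘ N)) :
    modelStep b χ act i (j ::ₘ N) = leading i (j ::ₘ N)
      + act (b (Sum.inl j)) (act (b i) (mono N) - leading i N)
      + act ⁅b i, b (Sum.inl j)⁆ (mono N) := by
  have h0 : j ::ₘ N ≠ 0 := Multiset.cons_ne_zero
  have hs := (Multiset.exists_least h0).choose_spec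
  have : (Multiset.exists_least h0).choose = j := by
    refine le_antisymm (hs.2 j (Multiset.mem_cons_self j N)) ?_
    rcases Multiset.mem_cons.mp hs.1 with h1 | h1
    · exact h1.ge
    · exact hj _ h1
  rw [modelStep, dif_neg h0, if_neg h]
  simp only [this, Multiset.erase_cons_head]

/-- Successive approximations to the action on the polynomial model. -/
def modelApprox : ℕ → L →ₗ[ℂ] (Multiset C →₀ ℂ) →ₗ[ℂ] (Multiset C →₀ ℂ)
  | 0 => 0
  | n + 1 => b.constr ℂ fun i => Finsupp.linearCombination ℂ (modelStep b χ (modelApprox n) i)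

theorem modelApprox_succ (n : ℕ) (i : C ⊕ D) (M : Multiset C) :
    modelApprox b χ (n + 1) (b i) (mono M) = modelStep b χ (modelApprox b χ n) i M := by
  rw [modelApprox, Basis.constr_basis, Finsupp.linearCombination_single, one_smul]

/-- This bound makes the recursion well founded: for `M = j ::ₘ N`, `modelStep` consults the
previous approximation only on `N` and on the remainder of `b_i N`, both of degree at most `|N| <
|M|`. -/
theorem modelApprox_sub_leading (n : ℕ) : ∀ (i : C ⊕ D) (M : Multiset C), Multiset.card M < n →
    modelApprox b χ n (b i) (mono M) - leading i M ∈ degLT C (Multiset.card M + 1) := by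
  induction n with
  | zero => intro i M h; omega
  | succ n ih =>
    have key : ∀ (x : L) (d : ℕ), d ≤ n → ∀ p ∈ degLT C d,
        modelApprox b χ n x p ∈ degLT C (d + 1) := by
      intro x d hd p hp
      refine basis_lift_mem b ((modelApprox b χ n).flip p) (fun i => ?_) x
      rw [LinearMap.flip_apply]
      refine degLT_induction ((degLT C (d + 1)).comap (modelApprox b χ n (b i)))
        (fun M hM => ?_) hp
      rw [Submodule.mem_comap]
      have := Submodule.add_mem _ (degLT_mono (show Multiset.card M + 1 ≤ d + 1 by omega)
        (ih i M (by omega))) (leading_mem i (show Multiset.card M + 1 < d + 1 by omega))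
      rwa [sub_add_cancel] at this
    intro i M hM
    rw [modelApprox_succ]
    by_cases h0 : M = 0
    · subst h0
      rw [modelStep_zero, add_sub_cancel_left]
      exact Submodule.smul_mem _ _ (mono_mem_degLT (by simp))
    by_cases hl : IsLow i M
    · rw [modelStep_of_isLow b χ _ hl, sub_self]
      exact Submodule.zero_mem _
    obtain ⟨j, hj, hmin⟩ := Multiset.exists_least h0
    obtain ⟨N, rfl⟩ := Multiset.exists_cons_of_mem hj
    rw [Multiset.card_cons] at hM
    rw [modelStep_cons b χ _ (fun k hk => hmin k (Multiset.mem_cons_of_mem hk)) hl,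
      add_assoc, add_sub_cancel_left, Multiset.card_cons]
    refine Submodule.add_mem _ ?_ ?_
    · exact key _ _ (by omega) _ (ih i N (by omega))
    · exact key _ _ (by omega) _ (mono_mem_degLT (by omega))

theorem modelApprox_stable (n : ℕ) : ∀ (x : L), ∀ p ∈ degLT C n,
    modelApprox b χ (n + 1) x p = modelApprox b χ n x p := by
  induction n with
  | zero =>
    intro x p hp
    have : p ∈ (⊥ : Submodule ℂ (Multiset C →₀ ℂ)) :=
      degLT_induction ⊥ (fun M hM => absurd hM (Nat.not_lt_zero _)) hp
    rw [(Submodule.mem_bot ℂ).mp this, map_zero, map_zero]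
  | succ n ih =>
    intro x p hp
    rw [← sub_eq_zero, ← Submodule.mem_bot ℂ]
    refine basis_lift_mem b
      ((modelApprox b χ (n + 1 + 1)).flip p - (modelApprox b χ (n + 1)).flip p) (fun i => ?_) x
    rw [LinearMap.sub_apply, LinearMap.flip_apply, LinearMap.flip_apply, Submodule.mem_bot,
      sub_eq_zero]
    refine degLT_induction (LinearMap.eqLocus (modelApprox b χ (n + 1 + 1) (b i))
      (modelApprox b χ (n + 1) (b i))) (fun M hM => ?_) hp
    rw [LinearMap.mem_eqLocus, modelApprox_succ, modelApprox_succ]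
    by_cases h0 : M = 0
    · subst h0
      rw [modelStep_zero, modelStep_zero]
    by_cases hl : IsLow i M
    · rw [modelStep_of_isLow b χ _ hl, modelStep_of_isLow b χ _ hl]
    obtain ⟨j, hj, hmin⟩ := Multiset.exists_least h0
    obtain ⟨N, rfl⟩ := Multiset.exists_cons_of_mem hj
    rw [Multiset.card_cons] at hM
    have hN : mono N ∈ degLT C n := mono_mem_degLT (by omega)
    rw [modelStep_cons b χ _ (fun k hk => hmin k (Multiset.mem_cons_of_mem hk)) hl,
      modelStep_cons b χ _ (fun k hk => hmin k (Multiset.mem_cons_of_mem hk)) hl,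
      ih _ _ hN, ih _ _ hN, ih]
    exact degLT_mono (by omega) (modelApprox_sub_leading b χ n i N (by omega))

/-- The action on the polynomial model. -/
def model : L →ₗ[ℂ] (Multiset C →₀ ℂ) →ₗ[ℂ] (Multiset C →₀ ℂ) :=
  b.constr ℂ fun i =>
    Finsupp.linearCombination ℂ fun M => modelApprox b χ (Multiset.card M + 1) (b i) (mono M)

theorem model_eq_approx {n : ℕ} (x : L) {p : Multiset C →₀ ℂ} (hp : p ∈ degLT C n) :
    model b χ x p = modelApprox b χ n x p := by
  have hst : ∀ m k (x : L), ∀ p ∈ degLT C m, modelApprox b χ (m + k) x p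
      = modelApprox b χ m x p := by
    intro m k
    induction k with
    | zero => intro x p _; rfl
    | succ k ih =>
      intro x p hp
      rw [← add_assoc, modelApprox_stable b χ _ _ _ (degLT_mono (by omega) hp), ih _ _ hp]
  rw [← sub_eq_zero, ← Submodule.mem_bot ℂ]
  refine basis_lift_mem b ((model b χ).flip p - (modelApprox b χ n).flip p) (fun i => ?_) x
  rw [LinearMap.sub_apply, LinearMap.flip_apply, LinearMap.flip_apply, Submodule.mem_bot,
    sub_eq_zero]
  refine degLT_induction (LinearMap.eqLocus (model b χ (b i)) (modelApprox b χ n (b i)))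
    (fun M hM => ?_) hp
  rw [LinearMap.mem_eqLocus, model, Basis.constr_basis, Finsupp.linearCombination_single, one_smul]
  obtain ⟨k, rfl⟩ := Nat.exists_eq_add_of_lt hM
  rw [add_right_comm, hst (Multiset.card M + 1) k _ _ (mono_mem_degLT (by omega))]

theorem model_basis (i : C ⊕ D) (M : Multiset C) :
    model b χ (b i) (mono M) = modelStep b χ (model b χ) i M := by
  rw [model_eq_approx b χ (n := Multiset.card M + 1) _ (mono_mem_degLT (by omega)),
    modelApprox_succ]
  by_cases h0 : M = 0
  · subst h0
    rw [modelStep_zero, modelStep_zero]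
  by_cases hl : IsLow i M
  · rw [modelStep_of_isLow b χ _ hl, modelStep_of_isLow b χ _ hl]
  obtain ⟨j, hj, hmin⟩ := Multiset.exists_least h0
  obtain ⟨N, rfl⟩ := Multiset.exists_cons_of_mem hj
  rw [Multiset.card_cons]
  have hN : mono N ∈ degLT C (Multiset.card N + 1) := mono_mem_degLT (by omega)
  rw [modelStep_cons b χ _ (fun k hk => hmin k (Multiset.mem_cons_of_mem hk)) hl,
    modelStep_cons b χ _ (fun k hk => hmin k (Multiset.mem_cons_of_mem hk)) hl,
    model_eq_approx b χ _ hN, model_eq_approx b χ _ hN,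
    model_eq_approx b χ _ (modelApprox_sub_leading b χ _ i N (Nat.lt_succ_self _))]

theorem model_low {i : C ⊕ D} {M : Multiset C} (h : IsLow i M) :
    model b χ (b i) (mono M) = leading i M := by
  rw [model_basis, modelStep_of_isLow b χ _ h]

theorem model_zero (i : C ⊕ D) :
    model b χ (b i) (mono 0) = leading i 0 + charTerm χ i • mono 0 := by
  rw [model_basis, modelStep_zero]

theorem model_sub_leading (i : C ⊕ D) (M : Multiset C) :
    model b χ (b i) (mono M) - leading i M ∈ degLT C (Multiset.card M + 1) := by
  rw [model_eq_approx b χ (n := Multiset.card M + 1) _ (mono_mem_degLT (by omega))]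
  exact modelApprox_sub_leading b χ _ i M (Nat.lt_succ_self _)

/-- The commutation relation holds when one of the vectors is lower than the other one and than
all generators of the monomial. -/
theorem model_comm_of_low {i : C ⊕ D} {j : C} {N : Multiset C} (hj : ∀ k ∈ N, j ≤ k)
    (hi : ∀ c, i = Sum.inl c → j < c) :
    model b χ (b i) (model b χ (b (Sum.inl j)) (mono N))
      - model b χ (b (Sum.inl j)) (model b χ (b i) (mono N))
      = model b χ ⁅b i, b (Sum.inl j)⁆ (mono N) := by
  have hl : ¬ IsLow i (j ::ₘ N) := by
    cases i with
    | inl c => exact fun h => absurd (h j (Multiset.mem_cons_self j N)) (not_le.mpr (hi c rfl))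
    | inr d => exact fun h => h
  -- Since `j` is below `i` and below every letter of `N`, it is low for the leading monomial, and
  -- its action merely inserts `j`.
  have h2 : model b χ (b (Sum.inl j)) (leading i N) = leading i (j ::ₘ N) := by
    cases i with
    | inl c =>
      rw [leading, leading, model_low, leading, Multiset.cons_swap]
      intro k hk
      rcases Multiset.mem_cons.mp hk with rfl | hk
      · exact (hi _ rfl).le
      · exact hj k hk
    | inr d => exact map_zero _
  rw [model_low b χ (show IsLow (Sum.inl j : C ⊕ D) N from hj)]
  change model b χ (b i) (mono (j ::ₘ N)) - _ = _
  rw [model_basis, modelStep_cons b χ _ hj hl, map_sub, h2]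
  abel

variable (hD : ∀ d d' c, b.repr ⁅b (Sum.inr d), b (Sum.inr d')⁆ (Sum.inl c) = 0)
  (hχ : ∀ d d', b.constr ℂ (charTerm χ) ⁅b (Sum.inr d), b (Sum.inr d')⁆ = 0)

/-- The coordinates of `x` along the complement reappear as degree-one monomials, so only vectors of
the inducing subalgebra can preserve the line of the empty monomial. -/
theorem model_apply_zero (x : L) : model b χ x (mono 0)
    = Finsupp.mapDomain (fun c => {c}) (Finsupp.comapDomain Sum.inl (b.repr x)
        Sum.inl_injective.injOn) + b.constr ℂ (charTerm χ) x • mono 0 := by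
  have : (model b χ).flip (mono 0) =
      (Finsupp.lmapDomain ℂ ℂ (fun c : C => ({c} : Multiset C))).comp
        ((Finsupp.lcomapDomain Sum.inl Sum.inl_injective).comp b.repr.toLinearMap)
      + (LinearMap.toSpanSingleton ℂ _ (mono 0)).comp (b.constr ℂ (charTerm χ)) := by
    refine b.ext fun i => ?_
    rw [LinearMap.flip_apply, model_zero, LinearMap.add_apply, LinearMap.comp_apply,
      LinearMap.comp_apply, LinearMap.comp_apply, Basis.constr_basis,
      LinearMap.toSpanSingleton_apply]
    congr 1
    rw [LinearEquiv.coe_coe, Basis.repr_self]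
    cases i with
    | inl c =>
      rw [show Finsupp.lcomapDomain Sum.inl Sum.inl_injective (Finsupp.single (Sum.inl c : C ⊕ D)
        (1 : ℂ)) = Finsupp.single c 1 from Finsupp.comapDomain_single _ _ _ _]
      rw [Finsupp.lmapDomain_apply, Finsupp.mapDomain_single]
      rfl
    | inr d =>
      rw [show Finsupp.lcomapDomain Sum.inl Sum.inl_injective (Finsupp.single (Sum.inr d : C ⊕ D)
        (1 : ℂ)) = 0 from ?_, map_zero]
      · rfl
      · ext c
        exact Finsupp.single_eq_of_ne (by simp)
  exact DFunLike.congr_fun this x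

-- Induction on the degree of the monomial. If one of the two vectors is low, the relation is built
-- into the recursion; on the empty monomial it is the closure of `H` under brackets and the
-- character property; otherwise the least letter `k` lies below both vectors and the Jacobi
-- identity reduces the claim to `Q`.
include hD hχ in
theorem model_isRep : IsRep (model b χ : L →ₗ[ℂ] Module.End ℂ (Multiset C →₀ ℂ)) := by
  let A : L →ₗ[ℂ] Module.End ℂ (Multiset C →₀ ℂ) := model b χ
  have key : ∀ n (M : Multiset C), Multiset.card M < n → ∀ x y : L,
      A x (A y (mono M)) - A y (A x (mono M)) = A ⁅x, y⁆ (mono M) := by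
    intro n
    induction n with
    | zero => intro M h; omega
    | succ n ih =>
      have ih' : ∀ p ∈ degLT C n, ∀ x y, A x (A y p) - A y (A x p) = A ⁅x, y⁆ p := by
        intro p hp x y
        have := degLT_induction (LinearMap.eqLocus (A x * A y - A y * A x) (A ⁅x, y⁆))
          (fun M hM => ih M hM x y) hp
        exact this
      intro M hM
      suffices hb : ∀ i j, A (b i) (A (b j) (mono M)) - A (b j) (A (b i) (mono M))
          = A ⁅b i, b j⁆ (mono M) by
        intro x y
        exact comm_of_basis b A _ hb x y
      have hlow : ∀ (i : C ⊕ D) (c : C), (∀ k ∈ M, c ≤ k) →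
          (∀ c', i = Sum.inl c' → ¬ c' < c) →
          A (b i) (A (b (Sum.inl c)) (mono M)) - A (b (Sum.inl c)) (A (b i) (mono M))
          = A ⁅b i, b (Sum.inl c)⁆ (mono M) := by
        intro i c hc hi
        by_cases hic : i = Sum.inl c
        · rw [hic, sub_self, lie_self, map_zero, LinearMap.zero_apply]
        · refine model_comm_of_low b χ hc fun c' hc' => ?_
          refine lt_of_le_of_ne (not_lt.mp (hi c' hc')) ?_
          rintro rfl
          exact hic hc'
      have hlow' : ∀ (i : C ⊕ D) (c : C), (∀ k ∈ M, c ≤ k) →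
          A (b i) (A (b (Sum.inl c)) (mono M)) - A (b (Sum.inl c)) (A (b i) (mono M))
          = A ⁅b i, b (Sum.inl c)⁆ (mono M) := by
        intro i c hc
        by_cases hi : ∃ c', i = Sum.inl c' ∧ c' < c
        · obtain ⟨c', rfl, hcc⟩ := hi
          rw [← neg_sub, hlow (Sum.inl c) c' (fun k hk => hcc.le.trans (hc k hk)) (by
            rintro c'' h h'
            rw [Sum.inl.inj h] at hcc
            exact absurd hcc (not_lt.mpr h'.le)),
            ← lie_skew, map_neg, LinearMap.neg_apply, neg_neg]
        · push Not at hi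
          exact hlow i c hc fun c' h => not_lt.mpr (hi c' h)
      intro i j
      by_cases hj : IsLow j M
      · cases j with
        | inl c => exact hlow' i c hj
        | inr d => exact hj.elim
      by_cases hi : IsLow i M
      · cases i with
        | inl c =>
          rw [← neg_sub, hlow' j c hi, ← lie_skew, map_neg, LinearMap.neg_apply, neg_neg]
        | inr d => exact hi.elim
      by_cases h0 : M = 0
      · subst h0
        cases i with
        | inl c => exact (hi (fun k hk => absurd hk (Multiset.notMem_zero k))).elim
        | inr d =>
          cases j with
          | inl c => exact (hj (fun k hk => absurd hk (Multiset.notMem_zero k))).elim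
          | inr d' =>
            have h1 : ∀ d, A (b (Sum.inr d)) (mono 0) = χ d • mono 0 := by
              intro d
              change model b χ _ _ = _
              rw [model_zero]
              exact zero_add _
            have h2 : A ⁅b (Sum.inr d), b (Sum.inr d')⁆ (mono 0) = 0 := by
              change model b χ _ _ = _
              rw [model_apply_zero, hχ, zero_smul, add_zero]
              rw [show Finsupp.comapDomain Sum.inl (b.repr ⁅b (Sum.inr d), b (Sum.inr d')⁆)
                Sum.inl_injective.injOn = 0 from Finsupp.ext fun c => hD d d' c,
                Finsupp.mapDomain_zero]
            rw [h2, h1, h1, map_smul, map_smul, h1, h1, smul_comm, sub_self]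
      obtain ⟨k, hk, hmin⟩ := Multiset.exists_least h0
      obtain ⟨Q, rfl⟩ := Multiset.exists_cons_of_mem hk
      rw [Multiset.card_cons] at hM
      have hkQ : ∀ l ∈ Q, k ≤ l := fun l hl => hmin l (Multiset.mem_cons_of_mem hl)
      have hlt : ∀ i : C ⊕ D, ¬ IsLow i (k ::ₘ Q) → ∀ c, i = Sum.inl c → k < c := by
        rintro _ h c rfl
        by_contra hc
        exact h fun l hl => (not_lt.mp hc).trans (hmin l hl)
      -- The vector `b_j Q` has too high a degree for the induction hypothesis. Its leading monomial
      -- is treated by `model_comm_of_low`, and the remainder, of degree at most `|Q|`, by `ih'`.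
      have hcK : ∀ i j : C ⊕ D, ¬ IsLow i (k ::ₘ Q) → ¬ IsLow j (k ::ₘ Q) →
          A (b i) (A (b (Sum.inl k)) (A (b j) (mono Q)))
            - A (b (Sum.inl k)) (A (b i) (A (b j) (mono Q)))
          = A ⁅b i, b (Sum.inl k)⁆ (A (b j) (mono Q)) := by
        intro i j hi hj
        have h1 : A (b i) (A (b (Sum.inl k)) (leading j Q))
            - A (b (Sum.inl k)) (A (b i) (leading j Q))
            = A ⁅b i, b (Sum.inl k)⁆ (leading j Q) := by
          cases j with
          | inl c =>
            refine model_comm_of_low b χ (fun l hl => ?_) (hlt i hi)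
            rcases Multiset.mem_cons.mp hl with rfl | hl
            · exact (hlt _ hj _ rfl).le
            · exact hkQ l hl
          | inr d => simp [leading]
        have h2 := ih' _ (degLT_mono (by omega) (model_sub_leading b χ j Q)) (b i) (b (Sum.inl k))
        change A (b i) (A (b (Sum.inl k)) (A (b j) (mono Q) - leading j Q))
          - A (b (Sum.inl k)) (A (b i) (A (b j) (mono Q) - leading j Q))
          = A ⁅b i, b (Sum.inl k)⁆ (A (b j) (mono Q) - leading j Q) at h2
        simp only [map_sub] at h2
        rw [← sub_eq_zero] at h1 h2 ⊢
        rw [← add_zero (0 : Multiset C →₀ ℂ)]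
        nth_rewrite 1 [← h1]
        rw [← h2]
        abel
      have hq : mono Q ∈ degLT C n := mono_mem_degLT (by omega)
      have hM' : mono (k ::ₘ Q) = A (b (Sum.inl k)) (mono Q) :=
        (model_low b χ (show IsLow (Sum.inl k : C ⊕ D) Q from hkQ)).symm
      have e1 := model_comm_of_low b χ hkQ (hlt i hi)
      have e2 := model_comm_of_low b χ hkQ (hlt j hj)
      change A (b i) (A (b (Sum.inl k)) (mono Q)) - A (b (Sum.inl k)) (A (b i) (mono Q))
        = A ⁅b i, b (Sum.inl k)⁆ (mono Q) at e1
      change A (b j) (A (b (Sum.inl k)) (mono Q)) - A (b (Sum.inl k)) (A (b j) (mono Q))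
        = A ⁅b j, b (Sum.inl k)⁆ (mono Q) at e2
      have e3 := hcK i j hi hj
      have e4 := hcK j i hj hi
      have e5 := ih' _ hq (b i) ⁅b j, b (Sum.inl k)⁆
      have e6 := ih' _ hq (b j) ⁅b i, b (Sum.inl k)⁆
      have e7 := ih' _ hq ⁅b i, b j⁆ (b (Sum.inl k))
      have e8 := congrArg (A (b (Sum.inl k))) (ih' _ hq (b i) (b j))
      have e9 := congrArg (fun x => A x (mono Q)) (leibniz_lie (b i) (b j) (b (Sum.inl k)))
      simp only [map_add, map_sub, LinearMap.add_apply] at e8 e9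
      rw [sub_eq_iff_eq_add] at e1 e2
      rw [hM', e1, e2, map_add, map_add, ← sub_eq_zero]
      rw [← sub_eq_zero] at e3 e4 e5 e6 e7 e8 e9
      -- Moving `b_k` to the left of `b_i b_j` and of `b_j b_i` leaves commutators that are
      -- controlled by the relations on `Q`; the double brackets cancel by the Jacobi identity `e9`.
      have hcomb := congrArg₂ (· + ·) (congrArg₂ (· + ·) (congrArg₂ (· - ·) e3 e4)
        (congrArg₂ (· - ·) e5 e6)) (congrArg₂ (· + ·) (congrArg₂ (· - ·) e8 e7) e9)
      simp only [sub_zero, add_zero] at hcomb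
      rw [← hcomb]
      abel
  intro x y p
  have := degLT_induction (n := p.support.sup (fun M => Multiset.card M) + 1)
    (LinearMap.eqLocus (A x * A y - A y * A x) (A ⁅x, y⁆))
    (fun M _ => key _ M (Nat.lt_succ_self _) x y)
    (show p ∈ _ from fun M hM => Nat.lt_succ_of_le
      (Finset.le_sup (f := fun M => Multiset.card M) hM))
  exact (this : (A x * A y - A y * A x) p = A ⁅x, y⁆ p).symm

end PolynomialModel

/-! ### The generator of an induced module and the stabiliser of its line -/

section Existence

open Module

variable {L : Type} [LieRing L] [LieAlgebra ℂ L] {H : LieSubalgebra ℂ L} (χ : LieCharacter ℂ H)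

/-- There is an `L`-module with a nonzero vector on which `H` acts by `χ` and which spans a line
that is stable under no vector outside `H`. -/
theorem exists_model : ∃ (X : Type) (_ : AddCommGroup X) (_ : Module ℂ X)
    (ρ : L →ₗ[ℂ] Module.End ℂ X) (x₀ : X), IsRep ρ ∧ x₀ ≠ 0 ∧
      (∀ h : H, ρ h x₀ = χ h • x₀) ∧ ∀ (y : L) (c : ℂ), ρ y x₀ = c • x₀ → y ∈ H := by
  -- A basis of `L` adapted to `K ⊕ H` is fed to the polynomial model; the order on the basis of `K`
  -- is arbitrary.
  obtain ⟨K, hK⟩ := Submodule.exists_isCompl H.toSubmodule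
  let bK := Basis.ofVectorSpace ℂ K
  let bH : Basis _ ℂ H.toSubmodule := Basis.ofVectorSpace ℂ H.toSubmodule
  let _ : LinearOrder (Basis.ofVectorSpaceIndex ℂ K) := IsWellOrder.linearOrder WellOrderingRel
  let b := (bK.prod bH).map (Submodule.prodEquivOfIsCompl K H.toSubmodule hK.symm)
  have hbH : ∀ d, b (Sum.inr d) = bH d := by
    intro d
    simp [b]
  have hrepr : ∀ x : L, x ∈ H ↔ ∀ c, b.repr x (Sum.inl c) = 0 := by
    intro x
    obtain ⟨⟨u, v⟩, rfl⟩ := (Submodule.prodEquivOfIsCompl K H.toSubmodule hK.symm).surjective x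
    have h1 : ∀ c, b.repr (Submodule.prodEquivOfIsCompl K H.toSubmodule hK.symm (u, v))
        (Sum.inl c) = bK.repr u c := by
      intro c
      simp [b]
    simp only [h1]
    rw [Submodule.coe_prodEquivOfIsCompl']
    constructor
    · intro h c
      have hu : (u : L) ∈ H.toSubmodule := by
        have := H.toSubmodule.sub_mem h v.2
        rwa [add_sub_cancel_right] at this
      have : u = 0 := Subtype.ext (Submodule.disjoint_def.mp hK.disjoint _ hu u.2)
      rw [this, map_zero]
      rfl
    · intro h
      have : u = 0 := by
        apply bK.repr.injective
        ext c
        rw [h c, map_zero]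
        rfl
      rw [this]
      change (0 : L) + (v : L) ∈ H
      rw [zero_add]
      exact v.2
  let χ' := fun d => χ (bH d)
  have hconstr : ∀ h : H, b.constr ℂ (charTerm χ') (h : L) = χ h := by
    have : (b.constr ℂ (charTerm χ')).comp H.toSubmodule.subtype = (χ : H →ₗ[ℂ] ℂ) := by
      refine bH.ext fun d => ?_
      rw [LinearMap.comp_apply, Submodule.subtype_apply, ← hbH, Basis.constr_basis]
      rfl
    intro h
    exact DFunLike.congr_fun this h
  have hmem : ∀ d, b (Sum.inr d) ∈ H := fun d => hbH d ▸ (bH d).2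
  refine ⟨_, _, _, model b χ', mono 0, model_isRep b χ' ?_ ?_, ?_, ?_, ?_⟩
  · intro d d' c
    exact (hrepr _).mp (H.lie_mem (hmem d) (hmem d')) c
  · intro d d'
    have := hconstr ⁅(⟨_, hmem d⟩ : H), (⟨_, hmem d'⟩ : H)⁆
    rwa [lieCharacter_apply_lie] at this
  · simp
  · intro h
    rw [model_apply_zero, hconstr]
    rw [show Finsupp.comapDomain Sum.inl (b.repr (h : L)) Sum.inl_injective.injOn = 0 from
      Finsupp.ext fun c => (hrepr h).mp h.2 c, Finsupp.mapDomain_zero, zero_add]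
  · intro y c hy
    rw [hrepr]
    intro k
    -- The coefficient at the singleton `{k}` is the `k`-th coordinate of `y` along `K`, and the
    -- empty monomial does not contribute to it.
    have := DFunLike.congr_fun hy {k}
    rw [model_apply_zero, Finsupp.add_apply, Finsupp.smul_apply, Finsupp.smul_apply,
      Finsupp.single_apply, if_neg (Multiset.singleton_ne_zero k).symm, smul_zero, smul_zero,
      add_zero, Finsupp.mapDomain_apply (fun a b h => Multiset.singleton_inj.mp h)] at this
    exact this

/-- The quotient defining `Ind` might a priori collapse; its universal map to the model sends the
generator to a nonzero vector. -/
theorem Ind.gen_ne_zero : Ind.gen χ ≠ 0 := by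
  obtain ⟨X, _, _, ρ, x₀, hρ, h0, hx, -⟩ := exists_model χ
  obtain ⟨φ, hφ, -⟩ := Ind.exists_lift χ hρ x₀ hx
  intro h
  rw [h, map_zero] at hφ
  exact h0 hφ.symm

theorem Ind.mem_of_lie_gen {y : L} {c : ℂ} (h : ⁅y, Ind.gen χ⁆ = c • Ind.gen χ) : y ∈ H := by
  obtain ⟨X, _, _, ρ, x₀, hρ, -, hx, hy⟩ := exists_model χ
  obtain ⟨φ, hφ, hφ'⟩ := Ind.exists_lift χ hρ x₀ hx
  refine hy y c ?_
  rw [← hφ, ← hφ', h, map_smul]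

instance : Nontrivial (Ind H (OneDim χ)) := ⟨Ind.gen χ, 0, Ind.gen_ne_zero χ⟩

/-- If `χ` extends to a strictly larger subalgebra then `Ind_H ℂ_χ` is not irreducible. -/
theorem Ind.not_isIrreducible_of_extension {H' : LieSubalgebra ℂ L} (hle : H ≤ H')
    (χ' : LieCharacter ℂ H') (hχ : ∀ h : H, χ' ⟨h, hle h.2⟩ = χ h) (hne : ¬ H' ≤ H) :
    ¬ LieModule.IsIrreducible ℂ L (Ind H (OneDim χ)) := by
  intro hirr
  obtain ⟨φ, hφ, hφ'⟩ := Ind.exists_lift χ (isRep_lieRep (X := Ind H' (OneDim χ')))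
    (Ind.gen χ') (fun h => by
      rw [lieRep_apply, Ind.lie_gen χ' h (hle h.2), hχ])
  let Φ : Ind H (OneDim χ) →ₗ⁅ℂ,L⁆ Ind H' (OneDim χ') :=
    { φ with map_lie' := fun {a v} => hφ' a v }
  have hker : Φ.ker = ⊥ := by
    rcases hirr.eq_bot_or_eq_top Φ.ker with h | h
    · exact h
    · have : Ind.gen χ ∈ Φ.ker := by rw [h]; trivial
      rw [LieModuleHom.mem_ker] at this
      exact absurd (hφ.symm.trans this) (Ind.gen_ne_zero χ')
  obtain ⟨y, hy, hyH⟩ := Set.not_subset.mp hne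
  -- For `y` in `H'` outside `H`, the vector `y · gen - χ'(y) gen` dies in the larger induced
  -- module. Injectivity would make it zero and put `y` in `H`.
  refine hyH (Ind.mem_of_lie_gen χ (c := χ' ⟨y, hy⟩) ?_)
  rw [← sub_eq_zero]
  have : ⁅y, Ind.gen χ⁆ - χ' ⟨y, hy⟩ • Ind.gen χ ∈ Φ.ker := by
    rw [LieModuleHom.mem_ker]
    change φ _ = 0
    rw [map_sub, map_smul, hφ', hφ, lieRep_apply, Ind.lie_gen χ' y hy, sub_self]
  rwa [hker] at this

end Existence

end VirasoroInduced

end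

noncomputable section

namespace VirasoroInduced

/-! ### Separating the two factors of a tensor product -/

section Separation

variable {L : Type} [LieRing L] [LieAlgebra ℂ L]

/-- Two decreasing sequences of subalgebras which are stable under brackets up to a shift and any
two members of which span `L`. -/
structure Separating (A B : ℕ → LieSubalgebra ℂ L) : Prop where
  antitone_left : Antitone A
  antitone_right : Antitone B
  ad_left : ∀ (x : L) (k : ℕ), ∃ l, ∀ a ∈ A l, ⁅x, a⁆ ∈ A k
  ad_right : ∀ (x : L) (k : ℕ), ∃ l, ∀ a ∈ B l, ⁅x, a⁆ ∈ B k
  exists_sub_mem : ∀ (k : ℕ) (x : L), ∃ y ∈ B k, x - y ∈ A k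

variable {A B : ℕ → LieSubalgebra ℂ L}

theorem Separating.symm (h : Separating A B) : Separating B A where
  antitone_left := h.antitone_right
  antitone_right := h.antitone_left
  ad_left := h.ad_right
  ad_right := h.ad_left
  exists_sub_mem k x := by
    obtain ⟨y, hy, hxy⟩ := h.exists_sub_mem k x
    exact ⟨x - y, hxy, by rwa [sub_sub_cancel]⟩

/-! ### Splitting an action into two commuting actions -/

section Local

variable {X : Type} [AddCommGroup X] [Module ℂ X] {ρ : L →ₗ[ℂ] Module.End ℂ X}

/-- The intersection `A k ∩ B k` annihilates `x`. -/
def Killed (ρ : L →ₗ[ℂ] Module.End ℂ X) (A B : ℕ → LieSubalgebra ℂ L) (k : ℕ) (x : X) : Prop :=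
  ∀ u ∈ A k, u ∈ B k → ρ u x = 0

theorem Killed.symm {k : ℕ} {x : X} (h : Killed ρ A B k x) : Killed ρ B A k x :=
  fun u hu hu' => h u hu' hu

theorem Separating.killed_mono (h : Separating A B) {k l : ℕ} (hkl : k ≤ l) {x : X}
    (hx : Killed ρ A B k x) : Killed ρ A B l x :=
  fun u hu hu' => hx u (h.antitone_left hkl hu) (h.antitone_right hkl hu')

/-- `ρ'` is the action of `L` on `X` through its quotients by the subspaces `A k`. -/
def IsLocal (ρ : L →ₗ[ℂ] Module.End ℂ X) (A B : ℕ → LieSubalgebra ℂ L)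
    (ρ' : L →ₗ[ℂ] Module.End ℂ X) : Prop :=
  ∀ (u : L) (x : X) (k : ℕ), Killed ρ A B k x → ∀ y ∈ B k, u - y ∈ A k → ρ' u x = ρ y x

/-- Two representatives of `u` in the right-hand family differ by an element of both families, which
kills the vector; hence the action of a representative does not depend on its choice. -/
theorem Separating.exists_isLocal (h : Separating A B) (hX : ∀ x : X, ∃ k, Killed ρ A B k x) :
    ∃ ρ', IsLocal ρ A B ρ' := by
  choose K hK using hX
  choose Y hY hY' using h.exists_sub_mem
  have spec : ∀ (u : L) (x : X) (k : ℕ), Killed ρ A B k x → ∀ y ∈ B k, u - y ∈ A k →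
      ρ (Y (K x) u) x = ρ y x := by
    intro u x k hk y hy hy'
    -- The two representatives come from different levels, and their difference is only known to lie
    -- in the intersection at the smaller level, which is one of the two where `x` is killed.
    have hm : Killed ρ A B (min k (K x)) x := by
      rcases min_choice k (K x) with h1 | h1 <;> rw [h1]
      · exact hk
      · exact hK x
    have := hm (Y (K x) u - y)
      (by
        have h1 := h.antitone_left (min_le_left k (K x)) hy'
        have h2 := h.antitone_left (min_le_right k (K x)) (hY' (K x) u)
        have h3 := (A (min k (K x))).sub_mem h1 h2
        rwa [sub_sub_sub_cancel_left] at h3)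
      ((B (min k (K x))).sub_mem (h.antitone_right (min_le_right k (K x)) (hY (K x) u))
        (h.antitone_right (min_le_left k (K x)) hy))
    rwa [map_sub, LinearMap.sub_apply, sub_eq_zero] at this
  refine ⟨LinearMap.mk₂ ℂ (fun u x => ρ (Y (K x) u) x) ?_ ?_ ?_ ?_, ?_⟩
  · intro u v x
    rw [← LinearMap.add_apply, ← map_add]
    refine spec _ _ _ (hK x) _ ((B _).add_mem (hY _ u) (hY _ v)) ?_
    rw [add_sub_add_comm]
    exact (A _).add_mem (hY' _ u) (hY' _ v)
  · intro c u x
    rw [← LinearMap.smul_apply, ← map_smul]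
    refine spec _ _ _ (hK x) _ ((B _).smul_mem c (hY _ u)) ?_
    rw [← smul_sub]
    exact (A _).smul_mem c (hY' _ u)
  · intro u x x'
    let k := max (K x) (K x')
    have h1 := h.killed_mono (le_max_left (K x) (K x')) (hK x)
    have h2 := h.killed_mono (le_max_right (K x) (K x')) (hK x')
    rw [spec u x k h1 _ (hY k u) (hY' k u), spec u x' k h2 _ (hY k u) (hY' k u), ← map_add]
    exact spec u _ k (fun v hv hv' => by rw [map_add, h1 v hv hv', h2 v hv hv', add_zero]) _
      (hY k u) (hY' k u)
  · intro c u x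
    rw [← map_smul]
    exact spec u _ (K x) (fun v hv hv' => by rw [map_smul, hK x v hv hv', smul_zero]) _
      (hY _ u) (hY' _ u)
  · exact spec

variable {ρ' ρ'' : L →ₗ[ℂ] Module.End ℂ X}

/-- If `y` represents `u` for the first action, then `u - y` represents it for the second. -/
theorem IsLocal.add_eq (h : Separating A B) (hX : ∀ x : X, ∃ k, Killed ρ A B k x)
    (h' : IsLocal ρ A B ρ') (h'' : IsLocal ρ B A ρ'') (u : L) (x : X) :
    ρ' u x + ρ'' u x = ρ u x := by
  obtain ⟨k, hk⟩ := hX x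
  obtain ⟨y, hy, hy'⟩ := h.exists_sub_mem k u
  rw [h' u x k hk y hy hy', h'' u x k hk.symm (u - y) hy' (by rwa [sub_sub_cancel]),
    map_sub, LinearMap.sub_apply, add_sub_cancel]

theorem IsLocal.isRep (h : Separating A B) (hX : ∀ x : X, ∃ k, Killed ρ A B k x) (hρ : IsRep ρ)
    (h' : IsLocal ρ A B ρ') : IsRep ρ' := by
  intro u v x
  obtain ⟨k₁, h₁⟩ := hX x
  obtain ⟨k₂, h₂⟩ := hX (ρ' u x)
  obtain ⟨k₃, h₃⟩ := hX (ρ' v x)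
  obtain ⟨l₁, hl₁⟩ := h.ad_left u k₁
  obtain ⟨l₂, hl₂⟩ := h.ad_left v k₁
  let k := max (max k₁ (max k₂ k₃)) (max l₁ l₂)
  obtain ⟨a, ha, ha'⟩ := h.exists_sub_mem k u
  obtain ⟨b, hb, hb'⟩ := h.exists_sub_mem k v
  have e₁ := h.killed_mono (show k₁ ≤ k by omega) h₁
  rw [h' u _ k (h.killed_mono (by omega) h₃) a ha ha', h' v _ k (h.killed_mono (by omega) h₂) b hb hb',
    h' u x k e₁ a ha ha', h' v x k e₁ b hb hb', ← hρ]
  refine h' _ _ k₁ h₁ _ (h.antitone_right (show k₁ ≤ k by omega) ((B k).lie_mem ha hb)) ?_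
  -- Every term on the right has a factor in `A k`, so `[a, b]` is an admissible representative of
  -- `[u, v]` at level `k₁`.
  have e : ⁅u, v⁆ - ⁅a, b⁆ = ⁅u, v - b⁆ - ⁅v, u - a⁆ - ⁅u - a, v - b⁆ := by
    rw [← lie_skew v (u - a)]
    simp only [lie_sub, sub_lie]
    abel
  rw [e]
  refine (A k₁).sub_mem ((A k₁).sub_mem
    (hl₁ _ (h.antitone_left (show l₁ ≤ k by omega) hb'))
    (hl₂ _ (h.antitone_left (show l₂ ≤ k by omega) ha')))
    (h.antitone_left (show k₁ ≤ k by omega) ((A k).lie_mem ha' hb'))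

/-- Take `a ∈ B k` acting for `u` and `v - b ∈ A k` acting for `v`. For large `k` their bracket lies
in both families at level `k₁`, so it kills `x`. -/
theorem IsLocal.commute (h : Separating A B) (hX : ∀ x : X, ∃ k, Killed ρ A B k x) (hρ : IsRep ρ)
    (h' : IsLocal ρ A B ρ') (h'' : IsLocal ρ B A ρ'') (u v : L) (x : X) :
    ρ' u (ρ'' v x) = ρ'' v (ρ' u x) := by
  obtain ⟨k₁, h₁⟩ := hX x
  obtain ⟨k₂, h₂⟩ := hX (ρ' u x)
  obtain ⟨k₃, h₃⟩ := hX (ρ'' v x)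
  obtain ⟨l₁, hl₁⟩ := h.ad_left u k₁
  obtain ⟨l₂, hl₂⟩ := h.ad_right v k₁
  let k := max (max k₁ (max k₂ k₃)) (max l₁ l₂)
  obtain ⟨a, ha, ha'⟩ := h.exists_sub_mem k u
  obtain ⟨b, hb, hb'⟩ := h.exists_sub_mem k v
  have e₁ := h.killed_mono (show k₁ ≤ k by omega) h₁
  have hb'' : v - (v - b) ∈ B k := by rwa [sub_sub_cancel]
  rw [h' u _ k (h.killed_mono (by omega) h₃) a ha ha',
    h'' v _ k (h.killed_mono (by omega) h₂).symm (v - b) hb' hb'',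
    h' u x k e₁ a ha ha', h'' v x k e₁.symm (v - b) hb' hb'', ← sub_eq_zero, ← hρ]
  refine h₁ _ ?_ ?_
  · have e : ⁅a, v - b⁆ = ⁅u, v - b⁆ - ⁅u - a, v - b⁆ := by rw [sub_lie, sub_sub_cancel]
    rw [e]
    exact (A k₁).sub_mem (hl₁ _ (h.antitone_left (show l₁ ≤ k by omega) hb'))
      (h.antitone_left (show k₁ ≤ k by omega) ((A k).lie_mem ha' hb'))
  · have e : ⁅a, v - b⁆ = -⁅v, a⁆ - ⁅a, b⁆ := by rw [lie_skew, lie_sub]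
    rw [e]
    exact (B k₁).sub_mem ((B k₁).neg_mem (hl₂ _ (h.antitone_right (show l₂ ≤ k by omega) ha)))
      (h.antitone_right (show k₁ ≤ k by omega) ((B k).lie_mem ha hb))

end Local

/-! ### Propagation of local annihilation from the generator -/

section Smooth

variable {H : LieSubalgebra ℂ L} {χ : LieCharacter ℂ H}

/-- The vectors annihilated by some `C k` form a submodule, since a bracket with a fixed `x` only
shifts the level. -/
theorem Ind.killed_of_gen (C : ℕ → Submodule ℂ L) (hC : Antitone C)
    (had : ∀ (x : L) (k : ℕ), ∃ l, ∀ a ∈ C l, ⁅x, a⁆ ∈ C k)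
    {k₀ : ℕ} (h : ∀ a ∈ C k₀, ⁅a, Ind.gen χ⁆ = 0) (v : Ind H (OneDim χ)) :
    ∃ k, ∀ a ∈ C k, ⁅a, v⁆ = 0 := by
  let N : Submodule ℂ (Ind H (OneDim χ)) :=
    { carrier := {v | ∃ k, ∀ a ∈ C k, ⁅a, v⁆ = 0}
      zero_mem' := ⟨0, fun a _ => lie_zero a⟩
      add_mem' := by
        rintro v w ⟨k, hk⟩ ⟨l, hl⟩
        refine ⟨max k l, fun a ha => ?_⟩
        rw [lie_add, hk a (hC (le_max_left k l) ha), hl a (hC (le_max_right k l) ha), add_zero]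
      smul_mem' := by
        rintro c v ⟨k, hk⟩
        exact ⟨k, fun a ha => by rw [lie_smul, hk a ha, smul_zero]⟩ }
  have hN : N = ⊤ := by
    refine Ind.eq_top_of_gen_mem χ N ⟨k₀, h⟩ ?_
    rintro x v ⟨k, hk⟩
    obtain ⟨l, hl⟩ := had x k
    refine ⟨max k l, fun a ha => ?_⟩
    rw [leibniz_lie, hk a (hC (le_max_left k l) ha), lie_zero, add_zero, ← lie_skew, neg_lie,
      hk _ (hl a (hC (le_max_right k l) ha)), neg_zero]
  exact (show v ∈ N by rw [hN]; trivial)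

end Smooth

/-! ### Tensor products of modules that are smooth for opposite families -/

section Tensor

variable {H₁ H₂ : LieSubalgebra ℂ L} {χ₁ : LieCharacter ℂ H₁} {χ₂ : LieCharacter ℂ H₂}

/-- A subspace stable under the action on the left factor and containing `gen ⊗ r` contains
`v ⊗ r` for all `v`. -/
theorem Ind.tmul_mem_of_gen {R : Type} [AddCommGroup R] [Module ℂ R]
    (N : Submodule ℂ (Ind H₁ (OneDim χ₁) ⊗[ℂ] R))
    (hN : ∀ u : L, ∀ t ∈ N, (lieRep (Ind H₁ (OneDim χ₁)) u).rTensor R t ∈ N) {r : R}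
    (h : Ind.gen χ₁ ⊗ₜ r ∈ N) (v : Ind H₁ (OneDim χ₁)) : v ⊗ₜ r ∈ N := by
  have := Ind.eq_top_of_gen_mem χ₁
    (N.comap ((TensorProduct.mk ℂ (Ind H₁ (OneDim χ₁)) R).flip r)) h
    (fun a _ hv => hN a _ hv)
  exact (show v ∈ N.comap ((TensorProduct.mk ℂ (Ind H₁ (OneDim χ₁)) R).flip r) by
    rw [this]; trivial)

section

variable {R S : Type} [AddCommGroup R] [Module ℂ R] [LieRingModule L R] [LieModule ℂ L R]
  [AddCommGroup S] [Module ℂ S] [LieRingModule L S] [LieModule ℂ L S]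

theorem lie_tensor (u : L) (t : R ⊗[ℂ] S) :
    ⁅u, t⁆ = (lieRep R u).rTensor S t + (lieRep S u).lTensor R t := by
  induction t using TensorProduct.induction_on with
  | zero => simp
  | tmul v w => simp
  | add s t hs ht => rw [lie_add, hs, ht, map_add, map_add]; abel

/-- For large `k`, the difference `u - y` kills the left components of `t` and `y` kills the right
ones, so `y` acts on `t` as `u ⊗ 1`. Hence the factor actions are available inside any submodule. -/
theorem Separating.exists_lie_tensor (h : Separating A B)
    (hR : ∀ v : R, ∃ k, ∀ a ∈ A k, ⁅a, v⁆ = 0) (hS : ∀ w : S, ∃ k, ∀ a ∈ B k, ⁅a, w⁆ = 0)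
    (t : R ⊗[ℂ] S) : ∃ K, ∀ k ≥ K, ∀ u, ∀ y ∈ B k, u - y ∈ A k →
      ⁅y, t⁆ = (lieRep R u).rTensor S t := by
  induction t using TensorProduct.induction_on with
  | zero => exact ⟨0, fun k _ u y _ _ => by simp⟩
  | tmul v w =>
    obtain ⟨k₁, h₁⟩ := hR v
    obtain ⟨k₂, h₂⟩ := hS w
    refine ⟨max k₁ k₂, fun k hk u y hy hy' => ?_⟩
    have e := h₁ _ (h.antitone_left (show k₁ ≤ k by omega) hy')
    rw [sub_lie, sub_eq_zero] at e
    rw [TensorProduct.LieModule.lie_tmul_right,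
      h₂ y (h.antitone_right (show k₂ ≤ k by omega) hy), tmul_zero, add_zero,
      LinearMap.rTensor_tmul, lieRep_apply, e]
  | add s t hs ht =>
    obtain ⟨k₁, h₁⟩ := hs
    obtain ⟨k₂, h₂⟩ := ht
    refine ⟨max k₁ k₂, fun k hk u y hy hy' => ?_⟩
    rw [lie_add, map_add, h₁ k (by omega) u y hy hy', h₂ k (by omega) u y hy hy']

/-- A submodule of the tensor product is stable under the action on the left factor. -/
theorem Separating.rTensor_mem (h : Separating A B)
    (hR : ∀ v : R, ∃ k, ∀ a ∈ A k, ⁅a, v⁆ = 0) (hS : ∀ w : S, ∃ k, ∀ a ∈ B k, ⁅a, w⁆ = 0)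
    (N : Submodule ℂ (R ⊗[ℂ] S)) (hN : ∀ (u : L), ∀ t ∈ N, ⁅u, t⁆ ∈ N) (u : L) {t : R ⊗[ℂ] S}
    (ht : t ∈ N) : (lieRep R u).rTensor S t ∈ N := by
  obtain ⟨K, hK⟩ := h.exists_lie_tensor hR hS t
  obtain ⟨y, hy, hy'⟩ := h.exists_sub_mem K u
  rw [← hK K le_rfl u y hy hy']
  exact hN y t ht

/-- A submodule of the tensor product is stable under the action on the right factor. -/
theorem Separating.lTensor_mem (h : Separating A B)
    (hR : ∀ v : R, ∃ k, ∀ a ∈ A k, ⁅a, v⁆ = 0) (hS : ∀ w : S, ∃ k, ∀ a ∈ B k, ⁅a, w⁆ = 0)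
    (N : Submodule ℂ (R ⊗[ℂ] S)) (hN : ∀ (u : L), ∀ t ∈ N, ⁅u, t⁆ ∈ N) (u : L) {t : R ⊗[ℂ] S}
    (ht : t ∈ N) : (lieRep S u).lTensor R t ∈ N := by
  have e := lie_tensor u t
  rw [← sub_eq_iff_eq_add'] at e
  rw [← e]
  exact N.sub_mem (hN u t ht) (h.rTensor_mem hR hS N hN u ht)

end

/-- The characters `χ₁`, `χ₂` and their sum `χ` on the intersection are adapted to the separating
sequences `A`, `B`. -/
structure Adapted (A B : ℕ → LieSubalgebra ℂ L) (χ₁ : LieCharacter ℂ H₁) (χ₂ : LieCharacter ℂ H₂)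
    {H : LieSubalgebra ℂ L} (χ : LieCharacter ℂ H) : Prop where
  separating : Separating A B
  left : ∃ k, ∀ a ∈ A k, ∃ h : a ∈ H₁, χ₁ ⟨a, h⟩ = 0
  right : ∃ k, ∀ a ∈ B k, ∃ h : a ∈ H₂, χ₂ ⟨a, h⟩ = 0
  mem_iff : ∀ a, a ∈ H ↔ a ∈ H₁ ∧ a ∈ H₂
  eq_add : ∀ a (h : a ∈ H) (h₁ : a ∈ H₁) (h₂ : a ∈ H₂), χ ⟨a, h⟩ = χ₁ ⟨a, h₁⟩ + χ₂ ⟨a, h₂⟩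

variable {H : LieSubalgebra ℂ L} {χ : LieCharacter ℂ H}

theorem Adapted.symm (h : Adapted A B χ₁ χ₂ χ) : Adapted B A χ₂ χ₁ χ where
  separating := h.separating.symm
  left := h.right
  right := h.left
  mem_iff a := (h.mem_iff a).trans and_comm
  eq_add a ha h₁ h₂ := (h.eq_add a ha h₂ h₁).trans (add_comm _ _)

theorem Adapted.killed_left (h : Adapted A B χ₁ χ₂ χ) (v : Ind H₁ (OneDim χ₁)) :
    ∃ k, ∀ a ∈ A k, ⁅a, v⁆ = 0 := by
  obtain ⟨k, hk⟩ := h.left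
  refine Ind.killed_of_gen (fun k => (A k).toSubmodule)
    (fun _ _ hkl => h.separating.antitone_left hkl) h.separating.ad_left (k₀ := k)
    (fun a ha => ?_) v
  obtain ⟨ha₁, ha₂⟩ := hk a ha
  rw [Ind.lie_gen χ₁ a ha₁, ha₂, zero_smul]

theorem Adapted.killed (h : Adapted A B χ₁ χ₂ χ) (x : Ind H (OneDim χ)) :
    ∃ k, Killed (lieRep (Ind H (OneDim χ))) A B k x := by
  obtain ⟨k, hk⟩ := h.left
  obtain ⟨l, hl⟩ := h.right
  have hs := h.separating
  have := Ind.killed_of_gen (χ := χ) (fun k => (A k).toSubmodule ⊓ (B k).toSubmodule)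
    (fun _ _ hkl => inf_le_inf (hs.antitone_left hkl) (hs.antitone_right hkl))
    (fun x k => by
      obtain ⟨k₁, h₁⟩ := hs.ad_left x k
      obtain ⟨k₂, h₂⟩ := hs.ad_right x k
      exact ⟨max k₁ k₂, fun a ha => ⟨h₁ a (hs.antitone_left (le_max_left _ _) ha.1),
        h₂ a (hs.antitone_right (le_max_right _ _) ha.2)⟩⟩)
    (k₀ := max k l)
    (fun a ha => by
      obtain ⟨h₁, h₁'⟩ := hk a (hs.antitone_left (le_max_left _ _) ha.1)
      obtain ⟨h₂, h₂'⟩ := hl a (hs.antitone_right (le_max_right _ _) ha.2)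
      have hH := (h.mem_iff a).mpr ⟨h₁, h₂⟩
      rw [Ind.lie_gen χ a hH, h.eq_add a hH h₁ h₂, h₁', h₂', add_zero, zero_smul]) x
  obtain ⟨k, hk⟩ := this
  exact ⟨k, fun u hu hu' => hk u ⟨hu, hu'⟩⟩

/-- A representative `y` of `a ∈ H₁` lies in `H₁ ∩ H₂`. There `χ₂ y = 0`, and `χ₁ y = χ₁ a` because
`a - y` is in the kernel of `χ₁`. -/
theorem Adapted.local_gen (h : Adapted A B χ₁ χ₂ χ)
    {ρ' : L →ₗ[ℂ] Module.End ℂ (Ind H (OneDim χ))}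
    (h' : IsLocal (lieRep (Ind H (OneDim χ))) A B ρ') (a : H₁) :
    ρ' a (Ind.gen χ) = χ₁ a • Ind.gen χ := by
  obtain ⟨k, hk⟩ := h.left
  obtain ⟨l, hl⟩ := h.right
  obtain ⟨n, hn⟩ := h.killed (Ind.gen χ)
  let m := max n (max k l)
  have hs := h.separating
  obtain ⟨y, hy, hy'⟩ := hs.exists_sub_mem m (a : L)
  rw [h' a _ m (hs.killed_mono (le_max_left _ _) hn) y hy hy', lieRep_apply]
  obtain ⟨h₁, h₁'⟩ := hk _ (hs.antitone_left (show k ≤ m by omega) hy')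
  obtain ⟨h₂, h₂'⟩ := hl _ (hs.antitone_right (show l ≤ m by omega) hy)
  have hy₁ : y ∈ H₁ := by
    have := H₁.sub_mem a.2 h₁
    rwa [sub_sub_cancel] at this
  have hyH := (h.mem_iff y).mpr ⟨hy₁, h₂⟩
  rw [Ind.lie_gen χ y hyH, h.eq_add y hyH hy₁ h₂, h₂', add_zero]
  congr 1
  rw [← sub_eq_zero, ← neg_eq_zero, neg_sub, ← h₁', ← map_sub]
  rfl

/-- `Ind (χ₁ + χ₂) ≅ Ind χ₁ ⊗ Ind χ₂` for adapted characters. -/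
theorem Adapted.nonempty_equiv (h : Adapted A B χ₁ χ₂ χ) :
    Nonempty (Ind H (OneDim χ) ≃ₗ⁅ℂ,L⁆ Ind H₁ (OneDim χ₁) ⊗[ℂ] Ind H₂ (OneDim χ₂)) := by
  have hs := h.separating
  have hX := h.killed
  have hρ : IsRep (lieRep (Ind H (OneDim χ)) : L →ₗ[ℂ] _) := isRep_lieRep
  obtain ⟨ρ₁, h₁⟩ := hs.exists_isLocal hX
  obtain ⟨ρ₂, h₂⟩ := hs.symm.exists_isLocal fun x => (hX x).imp fun _ hk => hk.symm
  have r₁ : IsRep ρ₁ := h₁.isRep hs hX hρ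
  have r₂ : IsRep ρ₂ := h₂.isRep hs.symm (fun x => (hX x).imp fun _ hk => hk.symm) hρ
  have hc := h₁.commute hs hX hρ h₂
  obtain ⟨F, hF, hF'⟩ := Ind.exists_lift χ
    (isRep_lieRep (X := Ind H₁ (OneDim χ₁) ⊗[ℂ] Ind H₂ (OneDim χ₂)))
    (Ind.gen χ₁ ⊗ₜ Ind.gen χ₂) (fun a => by
      obtain ⟨m₁, m₂⟩ := (h.mem_iff a).mp a.2
      rw [lieRep_apply, TensorProduct.LieModule.lie_tmul_right, Ind.lie_gen χ₁ _ m₁,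
        Ind.lie_gen χ₂ _ m₂, tmul_smul, ← smul_tmul', ← add_smul, ← h.eq_add _ a.2 m₁ m₂])
  -- The inverse is built one factor at a time: `Ind χ₂` maps in through the action `ρ₂`, and then
  -- `Ind χ₁` maps to linear maps `Ind χ₂ → Ind χ`, on which `L` acts by composition with `ρ₁`.
  -- Commutation of `ρ₁` and `ρ₂` makes the two steps compatible.
  obtain ⟨φ, hφ, hφ'⟩ := Ind.exists_lift χ₂ r₂ (Ind.gen χ) (h.symm.local_gen h₂)
  let E : L →ₗ[ℂ] Module.End ℂ (Ind H₂ (OneDim χ₂) →ₗ[ℂ] Ind H (OneDim χ)) :=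
    { toFun := fun u =>
        { toFun := fun g => (ρ₁ u).comp g
          map_add' := fun g g' => LinearMap.comp_add _ _ _
          map_smul' := fun c g => LinearMap.comp_smul _ _ _ }
      map_add' := fun u v => by
        ext g w
        change ρ₁ (u + v) (g w) = ρ₁ u (g w) + ρ₁ v (g w)
        rw [map_add, LinearMap.add_apply]
      map_smul' := fun c u => by
        ext g w
        change ρ₁ (c • u) (g w) = c • ρ₁ u (g w)
        rw [map_smul, LinearMap.smul_apply] }
  have hE : ∀ u g w, E u g w = ρ₁ u (g w) := fun _ _ _ => rfl
  obtain ⟨Ψ, hΨ, hΨ'⟩ := Ind.exists_lift χ₁ (ρ := E) (fun a b g => by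
      ext w
      exact r₁ a b (g w)) φ (fun a => by
      refine Ind.hom_ext χ₂ ρ₂ (fun b v => ?_) (fun b v => ?_) ?_
      · rw [hE, hφ', hc, hE]
      · rw [LinearMap.smul_apply, hφ', LinearMap.smul_apply, map_smul]
      · rw [hE, hφ, h.local_gen h₁, LinearMap.smul_apply, hφ])
  have hΨ₂ : ∀ v a w, Ψ v ⁅a, w⁆ = ρ₂ a (Ψ v w) := by
    let N : Submodule ℂ (Ind H₁ (OneDim χ₁)) :=
      { carrier := {v | ∀ a w, Ψ v ⁅a, w⁆ = ρ₂ a (Ψ v w)}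
        zero_mem' := fun a w => by simp
        add_mem' := fun {v v'} hv hv' a w => by
          rw [map_add, LinearMap.add_apply, LinearMap.add_apply, hv, hv', map_add]
        smul_mem' := fun c v hv a w => by
          rw [map_smul, LinearMap.smul_apply, LinearMap.smul_apply, hv, map_smul] }
    have hN : N = ⊤ := by
      refine Ind.eq_top_of_gen_mem χ₁ N (fun a w => ?_) (fun b v hv a w => ?_)
      · rw [hΨ, hφ']
      · rw [hΨ', hE, hE, hv, hc]
    exact fun v => (show v ∈ N by rw [hN]; trivial)
  let G : Ind H₁ (OneDim χ₁) ⊗[ℂ] Ind H₂ (OneDim χ₂) →ₗ[ℂ] Ind H (OneDim χ) :=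
    TensorProduct.lift Ψ
  have hG : ∀ (a : L) t, G ⁅a, t⁆ = ⁅a, G t⁆ := by
    intro a t
    induction t using TensorProduct.induction_on with
    | zero => simp
    | tmul v w =>
      change G _ = ⁅a, Ψ v w⁆
      rw [TensorProduct.LieModule.lie_tmul_right, map_add]
      change Ψ ⁅a, v⁆ w + Ψ v ⁅a, w⁆ = _
      rw [hΨ', hE, hΨ₂, h₁.add_eq hs hX h₂, lieRep_apply]
    | add s t hs ht => rw [lie_add, map_add, map_add, lie_add, hs, ht]
  have hGF : G.comp F = LinearMap.id := by
    refine Ind.hom_ext χ (lieRep _) (fun a v => ?_) (fun a v => rfl) ?_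
    · rw [LinearMap.comp_apply, hF', lieRep_apply, hG]
      rfl
    · rw [LinearMap.comp_apply, hF]
      change Ψ (Ind.gen χ₁) (Ind.gen χ₂) = _
      rw [hΨ, hφ]
      rfl
  have hinj : Function.Injective F :=
    Function.LeftInverse.injective (g := G) fun v => DFunLike.congr_fun hGF v
  have hstab : ∀ (u : L), ∀ t ∈ LinearMap.range F, ⁅u, t⁆ ∈ LinearMap.range F := by
    rintro u _ ⟨v, rfl⟩
    exact ⟨⁅u, v⁆, hF' u v⟩
  -- The range is stable under both factor actions, and these generate everything from `gen ⊗ gen`.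
  have hsurj : Function.Surjective F := by
    have hl := fun u (t) (ht : t ∈ LinearMap.range F) =>
      hs.rTensor_mem h.killed_left h.symm.killed_left (LinearMap.range F) hstab u ht
    have hr := fun u (t) (ht : t ∈ LinearMap.range F) =>
      hs.lTensor_mem h.killed_left h.symm.killed_left (LinearMap.range F) hstab u ht
    have hgen : ∀ w, Ind.gen χ₁ ⊗ₜ w ∈ LinearMap.range F := by
      have := Ind.eq_top_of_gen_mem χ₂
        ((LinearMap.range F).comap (TensorProduct.mk ℂ _ _ (Ind.gen χ₁))) ⟨_, hF⟩
        (fun a v hv => hr a _ hv)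
      intro w
      exact (show w ∈ (LinearMap.range F).comap (TensorProduct.mk ℂ _ _ (Ind.gen χ₁)) by
        rw [this]; trivial)
    intro t
    change t ∈ LinearMap.range F
    induction t using TensorProduct.induction_on with
    | zero => exact Submodule.zero_mem _
    | tmul v w => exact Ind.tmul_mem_of_gen _ hl (hgen w) v
    | add s t hs ht => exact Submodule.add_mem _ hs ht
  let e := LinearEquiv.ofBijective F ⟨hinj, hsurj⟩
  exact ⟨{ e with map_lie' := fun {a v} => hF' a v }⟩

end Tensor

end Separation

end VirasoroInduced

end

noncomputable section

namespace VirasoroInduced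

/-! ### Descent to the space of `χ`-vectors -/

section Descent

variable {L : Type} [LieRing L] [LieAlgebra ℂ L] {H : LieSubalgebra ℂ L}

/-- In any module generated by a space `Y` of `χ`-vectors, every nonzero submodule meets `Y`. -/
def Descends (χ : LieCharacter ℂ H) : Prop :=
  ∀ (X : Type) [AddCommGroup X] [Module ℂ X] (ρ : L →ₗ[ℂ] Module.End ℂ X), IsRep ρ →
    ∀ Y : Submodule ℂ X, (∀ h : H, ∀ y ∈ Y, ρ h y = χ h • y) →
    (∀ P : Submodule ℂ X, Y ≤ P → (∀ u, ∀ x ∈ P, ρ u x ∈ P) → P = ⊤) →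
    ∀ N : Submodule ℂ X, (∀ u, ∀ x ∈ N, ρ u x ∈ N) → N ≠ ⊥ → ∃ y ∈ N, y ∈ Y ∧ y ≠ 0

theorem Descends.isIrreducible {χ : LieCharacter ℂ H} (h : Descends χ) :
    LieModule.IsIrreducible ℂ L (Ind H (OneDim χ)) := by
  refine LieModule.IsIrreducible.mk fun N hN => ?_
  obtain ⟨y, hy, hy', hy0⟩ := h _ (lieRep (Ind H (OneDim χ))) isRep_lieRep
    (Submodule.span ℂ {Ind.gen χ})
    (fun a y hy => by
      obtain ⟨c, rfl⟩ := Submodule.mem_span_singleton.mp hy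
      rw [lieRep_apply, lie_smul, Ind.lie_gen χ a a.2, smul_comm])
    (fun P hP hP' => Ind.eq_top_of_gen_mem χ P (hP (Submodule.mem_span_singleton_self _)) hP')
    N.toSubmodule (fun u x hx => N.lie_mem hx)
    (fun h0 => hN ((LieSubmodule.toSubmodule_eq_bot N).mp h0))
  obtain ⟨c, rfl⟩ := Submodule.mem_span_singleton.mp hy'
  have hc : c ≠ 0 := fun hc => hy0 (by rw [hc, zero_smul])
  have hg : Ind.gen χ ∈ N := by
    have := N.smul_mem c⁻¹ hy
    rwa [smul_smul, inv_mul_cancel₀ hc, one_smul] at this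
  have := Ind.eq_top_of_gen_mem χ N.toSubmodule hg (fun u x hx => N.lie_mem hx)
  exact (LieSubmodule.toSubmodule_eq_top N).mp this

/-! ### Irreducibility of tensor products from descent in one factor -/

section Tensor

variable {H₁ H₂ : LieSubalgebra ℂ L} {χ₁ : LieCharacter ℂ H₁} {χ₂ : LieCharacter ℂ H₂}
  {χ : LieCharacter ℂ H} {A B : ℕ → LieSubalgebra ℂ L}

theorem isRep_rTensor (R S : Type) [AddCommGroup R] [Module ℂ R] [LieRingModule L R]
    [LieModule ℂ L R] [AddCommGroup S] [Module ℂ S] :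
    IsRep ((LinearMap.rTensorHom S).comp (lieRep R : L →ₗ[ℂ] _)) := by
  intro a b t
  induction t using TensorProduct.induction_on with
  | zero => simp
  | tmul v w =>
    simp only [LinearMap.comp_apply, LinearMap.coe_rTensorHom, LinearMap.rTensor_tmul,
      lieRep_apply, ← sub_tmul, lie_lie]
  | add s t hs ht =>
    rw [map_add, hs, ht]
    simp only [map_add]
    abel

/-- Under the left action the tensor product is generated by `gen ⊗ w`, all of which are
`χ₁`-vectors. Descent puts some nonzero `gen ⊗ w` in the given submodule, and simplicity of the
right factor then yields all of them. -/
theorem Adapted.isIrreducible (h : Adapted A B χ₁ χ₂ χ) (h₁ : Descends χ₁)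
    (h₂ : LieModule.IsIrreducible ℂ L (Ind H₂ (OneDim χ₂))) :
    LieModule.IsIrreducible ℂ L (Ind H (OneDim χ)) := by
  obtain ⟨e⟩ := h.nonempty_equiv
  have hs := h.separating
  have main : ∀ N : Submodule ℂ (Ind H₁ (OneDim χ₁) ⊗[ℂ] Ind H₂ (OneDim χ₂)),
      (∀ u : L, ∀ t ∈ N, ⁅u, t⁆ ∈ N) → N ≠ ⊥ → N = ⊤ := by
    intro N hN hN0
    have hr := fun u (t) (ht : t ∈ N) =>
      hs.rTensor_mem h.killed_left h.symm.killed_left N hN u ht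
    have hl := fun u (t) (ht : t ∈ N) =>
      hs.lTensor_mem h.killed_left h.symm.killed_left N hN u ht
    obtain ⟨t, htN, htY, ht0⟩ := h₁ _ _
      (isRep_rTensor (Ind H₁ (OneDim χ₁)) (Ind H₂ (OneDim χ₂)))
      (LinearMap.range (TensorProduct.mk ℂ (Ind H₁ (OneDim χ₁)) (Ind H₂ (OneDim χ₂))
        (Ind.gen χ₁)))
      (by
        rintro a _ ⟨w, rfl⟩
        simp only [LinearMap.comp_apply, LinearMap.coe_rTensorHom, TensorProduct.mk_apply,
          LinearMap.rTensor_tmul, lieRep_apply, Ind.lie_gen χ₁ a a.2, smul_tmul'])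
      (fun P hP hP' => by
        rw [eq_top_iff]
        intro t _
        induction t using TensorProduct.induction_on with
        | zero => exact P.zero_mem
        | tmul v w => exact Ind.tmul_mem_of_gen P hP' (hP ⟨w, rfl⟩) v
        | add s t hs ht => exact P.add_mem (hs trivial) (ht trivial))
      N hr hN0
    obtain ⟨w, rfl⟩ := htY
    let K : LieSubmodule ℂ L (Ind H₂ (OneDim χ₂)) :=
      { N.comap (TensorProduct.mk ℂ (Ind H₁ (OneDim χ₁)) (Ind H₂ (OneDim χ₂)) (Ind.gen χ₁)) with
        lie_mem := fun {u w} hw => hl u _ hw }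
    have hK : K = ⊤ := by
      refine (h₂.eq_bot_or_eq_top K).resolve_left fun hK => ht0 ?_
      have : w ∈ K := htN
      rw [hK, LieSubmodule.mem_bot] at this
      rw [this, map_zero]
    rw [eq_top_iff]
    intro t _
    induction t using TensorProduct.induction_on with
    | zero => exact N.zero_mem
    | tmul v w => exact Ind.tmul_mem_of_gen N hr (show w ∈ K by rw [hK]; trivial) v
    | add s t hs ht => exact N.add_mem (hs trivial) (ht trivial)
  refine LieModule.IsIrreducible.mk fun N hN => ?_
  have hmap := main (N.toSubmodule.map (e.toLieModuleHom : _ →ₗ[ℂ] _))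
    (by
      rintro u _ ⟨x, hx, rfl⟩
      exact ⟨⁅u, x⁆, N.lie_mem hx, e.toLieModuleHom.map_lie u x⟩)
    (fun h0 => hN (by
      rw [eq_bot_iff]
      intro x hx
      have : e.toLieModuleHom x ∈ N.toSubmodule.map (e.toLieModuleHom : _ →ₗ[ℂ] _) := ⟨x, hx, rfl⟩
      rw [h0, Submodule.mem_bot] at this
      rw [LieSubmodule.mem_bot]
      exact e.injective (this.trans (map_zero e.toLieModuleHom).symm)))
  rw [eq_top_iff]
  intro x _
  have : e.toLieModuleHom x ∈ N.toSubmodule.map (e.toLieModuleHom : _ →ₗ[ℂ] _) := by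
    rw [hmap]; trivial
  obtain ⟨x', hx', hxx⟩ := this
  rw [← e.injective hxx]
  exact hx'

end Tensor

/-- A filtration of `L` and a family of vectors spanning a complement of `H`, together with dual
elements of `H` on which `χ` detects the vectors. -/
structure DescentData (χ : LieCharacter ℂ H) (C : Type) where
  /-- the filtration -/
  F : ℤ → Submodule ℂ L
  /-- the last level on which `χ` does not vanish -/
  M : ℤ
  /-- vectors spanning a complement of `H` -/
  y : C → L
  /-- the levels of these vectors -/
  a : C → ℤ
  lie_mem : ∀ {i j : ℤ} {u v : L}, u ∈ F i → v ∈ F j → ⁅u, v⁆ ∈ F (i + j)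
  anti : Antitone F
  exhaust : ∀ u, ∃ i, u ∈ F i
  one_le : 1 ≤ M
  y_mem : ∀ c, y c ∈ F (a c)
  a_lt : ∀ c, a c < M
  a_inj : Function.Injective a
  decomp : ∀ (i : ℤ), ∀ u ∈ F i, ∃ v ∈ Submodule.span ℂ {w | ∃ c, i ≤ a c ∧ w = y c},
    u - v ∈ H ∧ u - v ∈ F i
  le : ∀ u ∈ F M, u ∈ H
  kill : ∀ u (h : u ∈ H), u ∈ F (M + 1) → χ ⟨u, h⟩ = 0
  dual : C → L
  dual_mem : ∀ c, dual c ∈ H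
  dual_mem_F : ∀ c, dual c ∈ F (M - a c)
  pairing : ∀ c (h : ⁅dual c, y c⁆ ∈ H), χ ⟨_, h⟩ ≠ 0

/-! ### Lowering the degree of words with dual vectors -/

namespace DescentData

variable {χ : LieCharacter ℂ H} {C : Type} (D : DescentData χ C)

/-- The degree of a word in the generators. -/
def deg (l : List C) : ℤ := (l.map fun c => D.M - D.a c).sum

@[simp] theorem deg_nil : D.deg [] = 0 := rfl

@[simp] theorem deg_cons (c : C) (l : List C) : D.deg (c :: l) = (D.M - D.a c) + D.deg l := by
  simp [deg]

theorem deg_perm {l l' : List C} (h : l.Perm l') : D.deg l = D.deg l' :=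
  (h.map _).sum_eq

theorem length_le_deg (l : List C) : (l.length : ℤ) ≤ D.deg l := by
  induction l with
  | nil => simp
  | cons c l ih =>
    rw [deg_cons, List.length_cons]
    have := D.a_lt c
    push_cast
    omega

variable {X : Type} [AddCommGroup X] [Module ℂ X] (ρ : L →ₗ[ℂ] Module.End ℂ X)
  (Y : Submodule ℂ X)

/-- The action of a word in the generators. -/
def word : List C → X →ₗ[ℂ] X
  | [] => LinearMap.id
  | c :: l => (ρ (D.y c)).comp (word l)

@[simp] theorem word_nil (x : X) : D.word ρ [] x = x := rfl

@[simp] theorem word_cons (c : C) (l : List C) (x : X) :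
    D.word ρ (c :: l) x = ρ (D.y c) (D.word ρ l x) := rfl

/-- The span of the words of degree at most `d` applied to `Y`. -/
def fil (d : ℤ) : Submodule ℂ X :=
  Submodule.span ℂ {x | ∃ l : List C, D.deg l ≤ d ∧ ∃ y ∈ Y, x = D.word ρ l y}

variable {ρ Y}

theorem word_mem {l : List C} {d : ℤ} (h : D.deg l ≤ d) {y : X} (hy : y ∈ Y) :
    D.word ρ l y ∈ D.fil ρ Y d :=
  Submodule.subset_span ⟨l, h, y, hy, rfl⟩

theorem fil_mono {d e : ℤ} (h : d ≤ e) : D.fil ρ Y d ≤ D.fil ρ Y e :=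
  Submodule.span_mono fun _ ⟨l, hl, hy⟩ => ⟨l, hl.trans h, hy⟩

theorem fil_le {d : ℤ} {P : Submodule ℂ X}
    (h : ∀ l : List C, D.deg l ≤ d → ∀ y ∈ Y, D.word ρ l y ∈ P) : D.fil ρ Y d ≤ P := by
  rw [fil, Submodule.span_le]
  rintro _ ⟨l, hl, y, hy, rfl⟩
  exact h l hl y hy

theorem y_fil {c : C} {d e : ℤ} (h : d + (D.M - D.a c) ≤ e) {x : X} (hx : x ∈ D.fil ρ Y d) :
    ρ (D.y c) x ∈ D.fil ρ Y e :=
  D.fil_le (P := (D.fil ρ Y e).comap (ρ (D.y c)))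
    (fun l hl y hy => D.word_mem (l := c :: l) (by rw [deg_cons]; omega) hy) hx

variable (hρ : IsRep ρ) (hY : ∀ h : H, ∀ y ∈ Y, ρ h y = χ h • y)

include hρ hY

/-- An element of level `i` counts as at most one letter of degree `M - i`. Moving it past `y c`
creates a commutator of level `i + a c`, which costs no extra degree because `M` is positive. -/
theorem act_word (l : List C) : ∀ (i : ℤ) (u : L), u ∈ D.F i → ∀ y ∈ Y, ∀ d,
    D.deg l + (D.M - i) ≤ d → ρ u (D.word ρ l y) ∈ D.fil ρ Y d := by
  induction l with
  | nil =>
    intro i u hu y hy d hd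
    obtain ⟨v, hv, hH, hF⟩ := D.decomp i u hu
    have e : ρ u (D.word ρ [] y) = ρ v (D.word ρ [] y) + ρ (u - v) y := by
      rw [map_sub, LinearMap.sub_apply]; simp
    rw [e]
    refine Submodule.add_mem _ ?_ ?_
    · have : Submodule.span ℂ {w | ∃ c, i ≤ D.a c ∧ w = D.y c}
          ≤ (D.fil ρ Y d).comap (ρ.flip (D.word ρ [] y)) := by
        rw [Submodule.span_le]
        rintro _ ⟨c, hc, rfl⟩
        exact D.word_mem (l := [c]) (by rw [deg_cons]; omega) hy
      exact this hv
    · rw [hY ⟨u - v, hH⟩ y hy]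
      by_cases hi : D.M + 1 ≤ i
      · rw [D.kill _ hH (D.anti hi hF), zero_smul]
        exact Submodule.zero_mem _
      · exact Submodule.smul_mem _ _ (D.word_mem (l := []) (by rw [deg_nil] at *; omega) hy)
  | cons c l ih =>
    intro i u hu y hy d hd
    rw [deg_cons] at hd
    have e : ρ u (D.word ρ (c :: l) y)
        = ρ ⁅u, D.y c⁆ (D.word ρ l y) + ρ (D.y c) (ρ u (D.word ρ l y)) := by
      rw [hρ, word_cons, sub_add_cancel]
    rw [e]
    refine Submodule.add_mem _ ?_ ?_
    · exact ih _ _ (D.lie_mem hu (D.y_mem c)) y hy d (by have := D.one_le; omega)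
    · exact D.y_fil (by omega) (ih i u hu y hy _ le_rfl)

theorem act_fil {i : ℤ} {u : L} (hu : u ∈ D.F i) {d e : ℤ} (h : d + (D.M - i) ≤ e) {x : X}
    (hx : x ∈ D.fil ρ Y d) : ρ u x ∈ D.fil ρ Y e :=
  D.fil_le (P := (D.fil ρ Y e).comap (ρ u))
    (fun l _ y hy => D.act_word hρ hY l i u hu y hy e (by omega)) hx

/-- As `u - χ(u)` kills `Y`, only commutators with letters survive. Each replaces a letter of degree
`M - a c` by an element of degree at most `M - i - a c`, a net change of `-i`. -/
theorem sub_word (l : List C) {i : ℤ} {u : L} (hu : u ∈ D.F i) (hH : u ∈ H) : ∀ y ∈ Y, ∀ d,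
    D.deg l - i ≤ d → ρ u (D.word ρ l y) - χ ⟨u, hH⟩ • D.word ρ l y ∈ D.fil ρ Y d := by
  induction l with
  | nil =>
    intro y hy d _
    rw [word_nil, hY ⟨u, hH⟩ y hy, sub_self]
    exact Submodule.zero_mem _
  | cons c l ih =>
    intro y hy d hd
    rw [deg_cons] at hd
    have e : ρ u (D.word ρ (c :: l) y) - χ ⟨u, hH⟩ • D.word ρ (c :: l) y
        = ρ ⁅u, D.y c⁆ (D.word ρ l y)
          + ρ (D.y c) (ρ u (D.word ρ l y) - χ ⟨u, hH⟩ • D.word ρ l y) := by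
      rw [hρ, word_cons, map_sub, map_smul]
      abel
    rw [e]
    refine Submodule.add_mem _ ?_ ?_
    · exact D.act_word hρ hY l _ _ (D.lie_mem hu (D.y_mem c)) y hy d (by omega)
    · exact D.y_fil (by omega) (ih y hy _ le_rfl)

/-- Exchanging two neighbours costs their commutator, whose degree is smaller by `M ≥ 1` than that
of the two letters. -/
theorem word_perm {l l' : List C} (h : l.Perm l') : ∀ y ∈ Y, ∀ d, D.deg l - 1 ≤ d →
    D.word ρ l y - D.word ρ l' y ∈ D.fil ρ Y d := by
  induction h with
  | nil => intro y _ d _; rw [sub_self]; exact Submodule.zero_mem _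
  | cons c _ ih =>
    intro y hy d hd
    rw [deg_cons] at hd
    rw [word_cons, word_cons, ← map_sub]
    exact D.y_fil (by omega) (ih y hy _ le_rfl)
  | swap c c' l =>
    intro y hy d hd
    rw [deg_cons, deg_cons] at hd
    simp only [word_cons]
    rw [← hρ]
    refine D.act_word hρ hY l _ _ (D.lie_mem (D.y_mem c') (D.y_mem c)) y hy d ?_
    have := D.one_le
    omega
  | trans h₁ h₂ ih₁ ih₂ =>
    intro y hy d hd
    have := Submodule.add_mem _ (ih₁ y hy d hd) (ih₂ y hy d (by rwa [← D.deg_perm h₁]))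
    rwa [sub_add_sub_cancel] at this

/-- The leading term of the action of a dual vector. -/
theorem dual_word [DecidableEq C] (c : C) (hm : ⁅D.dual c, D.y c⁆ ∈ H) (l : List C) :
    (∀ c' ∈ l, D.a c ≤ D.a c') → ∀ y ∈ Y, ∀ d, D.deg l - (D.M - D.a c) - 1 ≤ d →
    ρ (D.dual c) (D.word ρ l y) - χ ⟨D.dual c, D.dual_mem c⟩ • D.word ρ l y
      - (χ ⟨_, hm⟩ * l.count c) • D.word ρ (l.erase c) y ∈ D.fil ρ Y d := by
  induction l with
  | nil =>
    intro _ y hy d _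
    rw [word_nil, hY ⟨_, D.dual_mem c⟩ y hy, sub_self, List.count_nil, Nat.cast_zero, mul_zero,
      zero_smul, sub_zero]
    exact Submodule.zero_mem _
  | cons c' l ih =>
    intro hl y hy d hd
    rw [deg_cons] at hd
    have ih' := ih (fun b hb => hl b (List.mem_cons_of_mem c' hb)) y hy _ le_rfl
    have hF := D.lie_mem (D.dual_mem_F c) (D.y_mem c')
    have hac := hl c' List.mem_cons_self
    have hH : ⁅D.dual c, D.y c'⁆ ∈ H := D.le _ (D.anti (by omega) hF)
    have s := D.sub_word hρ hY l hF hH y hy _ le_rfl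
    have M1 := D.one_le
    have a1 := D.a_lt c'
    have hy' := D.y_fil (c := c') (e := d) (by omega) ih'
    have e0 : ρ (D.dual c) (D.word ρ (c' :: l) y)
        = ρ ⁅D.dual c, D.y c'⁆ (D.word ρ l y) + ρ (D.y c') (ρ (D.dual c) (D.word ρ l y)) := by
      rw [hρ, word_cons, sub_add_cancel]
    by_cases hcc : c' = c
    · subst hcc
      have s' := D.fil_mono (show _ ≤ d by omega) s
      by_cases hcl : c' ∈ l
      · have p := D.word_perm hρ hY (List.perm_cons_erase hcl) y hy d (by omega)
        have := Submodule.sub_mem _ (Submodule.add_mem _ s' hy')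
          (Submodule.smul_mem _ (χ ⟨_, hm⟩ * l.count c') p)
        refine (congrArg (· ∈ D.fil ρ Y d) ?_).mp this
        rw [e0, List.count_cons_self, List.erase_cons_head]
        simp only [word_cons, map_sub, map_smul, smul_sub, Nat.cast_add, Nat.cast_one, mul_add,
          mul_one, add_smul]
        abel
      · have h0 : l.count c' = 0 := List.count_eq_zero_of_not_mem hcl
        rw [h0, Nat.cast_zero, mul_zero, zero_smul, sub_zero] at hy'
        have := Submodule.add_mem _ s' hy'
        refine (congrArg (· ∈ D.fil ρ Y d) ?_).mp this
        rw [e0, List.count_cons_self, List.erase_cons_head, h0]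
        simp only [word_cons, map_sub, map_smul, zero_add, Nat.cast_one, mul_one]
        abel
    -- Levels are distinct, so another letter has strictly higher level; its bracket with the dual
    -- vector lies in `F (M + 1)`, where `χ` vanishes, and it does not contribute to the leading
    -- term.
    · have hlt : D.a c < D.a c' := lt_of_le_of_ne hac fun h => hcc (D.a_inj h.symm)
      have h0 : χ ⟨_, hH⟩ = 0 := D.kill _ hH (D.anti (by omega) hF)
      rw [h0, zero_smul, sub_zero] at s
      have := Submodule.add_mem _ (D.fil_mono (show _ ≤ d by omega) s) hy'
      refine (congrArg (· ∈ D.fil ρ Y d) ?_).mp this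
      rw [e0, List.count_cons_of_ne (by simpa using hcc), List.erase_cons_tail (by simpa using hcc)]
      simp only [word_cons, map_sub, map_smul]
      abel

omit hρ hY in
theorem fil_neg {d : ℤ} (hd : d < 0) : D.fil ρ Y d = ⊥ := by
  rw [eq_bot_iff]
  refine D.fil_le fun l hl y hy => ?_
  have := D.length_le_deg l
  omega

/-- The degree of a multiset of generators. -/
def mdeg (s : Multiset C) : ℤ := D.deg s.toList

variable (ρ Y) in
/-- The element represented by a family of coefficients in `Y`. -/
def combine : (Multiset C →₀ Y) →ₗ[ℂ] X :=
  Finsupp.lsum ℂ fun s => (D.word ρ s.toList).comp Y.subtype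

/-- Reordering a word changes it only in lower degree, so one chosen ordering per multiset suffices.
No uniqueness of the coefficients is claimed. -/
theorem exists_combine : ∀ (n : ℕ) (d : ℤ), d < n → ∀ x ∈ D.fil ρ Y d,
    ∃ g : Multiset C →₀ Y, (∀ s ∈ g.support, D.mdeg s ≤ d) ∧ D.combine ρ Y g = x := by
  intro n
  induction n with
  | zero =>
    intro d hd x hx
    rw [D.fil_neg (by omega), Submodule.mem_bot] at hx
    exact ⟨0, by simp, by rw [map_zero, hx]⟩
  | succ n ih =>
    intro d hd x hx
    let P : Submodule ℂ X := (Finsupp.supported Y ℂ {s | D.mdeg s ≤ d}).map (D.combine ρ Y)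
    have hP : D.fil ρ Y d ≤ P := by
      refine D.fil_le fun l hl y hy => ?_
      have hperm : l.Perm (l : Multiset C).toList :=
        Multiset.coe_eq_coe.mp (Multiset.coe_toList (l : Multiset C)).symm
      obtain ⟨g, hg, hg'⟩ := ih (D.deg l - 1) (by push_cast at hd; omega) _
        (D.word_perm hρ hY hperm y hy _ le_rfl)
      rw [← sub_add_cancel (D.word ρ l y) (D.word ρ (l : Multiset C).toList y), ← hg']
      refine P.add_mem ⟨g, fun s hs => ?_, rfl⟩ ⟨Finsupp.single (l : Multiset C) ⟨y, hy⟩, ?_, ?_⟩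
      · have := hg s hs
        change D.mdeg s ≤ d
        omega
      · refine Finsupp.single_mem_supported ℂ _ ?_
        change D.deg (l : Multiset C).toList ≤ d
        rwa [← D.deg_perm hperm]
      · rw [combine, Finsupp.lsum_single]
        rfl
    obtain ⟨g, hg, rfl⟩ := hP hx
    exact ⟨g, fun s hs => hg hs, rfl⟩

/-- The induction runs over coefficient families rather than over the vectors they represent, so
linear independence of the words is never needed. Each round differentiates the top-degree part
along one letter. -/
theorem descend {N : Submodule ℂ X} (hN : ∀ u, ∀ x ∈ N, ρ u x ∈ N) : ∀ (n : ℕ)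
    (g : Multiset C →₀ Y), g ≠ 0 → (∀ s ∈ g.support, D.mdeg s < n) → D.combine ρ Y g ∈ N →
    ∃ y ∈ N, y ∈ Y ∧ y ≠ 0 := by
  classical
  intro n
  induction n with
  | zero =>
    intro g hg0 hg _
    obtain ⟨s, hs⟩ := Finsupp.support_nonempty_iff.mpr hg0
    have h1 := hg s hs
    have h2 := D.length_le_deg s.toList
    rw [mdeg] at h1
    omega
  | succ n ih =>
    intro g hg0 hg hgN
    by_cases htop : ∀ s ∈ g.support, D.mdeg s < n
    · exact ih g hg0 htop hgN
    let S := g.support.filter fun s => D.mdeg s = n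
    have hS : ∀ {s}, s ∈ S ↔ g s ≠ 0 ∧ D.mdeg s = n := fun {s} => by
      rw [Finset.mem_filter, Finsupp.mem_support_iff]
    obtain ⟨s₁, hs₁⟩ : ∃ s, s ∈ S := by
      push Not at htop
      obtain ⟨s, hs, hs'⟩ := htop
      have := hg s hs
      exact ⟨s, hS.mpr ⟨Finsupp.mem_support_iff.mp hs, by push_cast at this; omega⟩⟩
    rcases Nat.eq_zero_or_pos n with rfl | hn
    · have hz : ∀ s ∈ g.support, s = 0 := by
        intro s hs
        have h1 := hg s hs
        have h2 := D.length_le_deg s.toList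
        rw [mdeg] at h1
        rw [Multiset.length_toList] at h2
        push_cast at h1
        exact Multiset.card_eq_zero.mp (by omega)
      have hg' : g = Finsupp.single 0 (g 0) := by
        rw [← Finsupp.support_subset_singleton]
        exact fun s hs => Finset.mem_singleton.mpr (hz s hs)
      refine ⟨g 0, ?_, (g 0).2, ?_⟩
      · rw [hg', combine, Finsupp.lsum_single] at hgN
        simpa using hgN
      · intro h0
        rw [Submodule.coe_eq_zero] at h0
        rw [h0, Finsupp.single_zero] at hg'
        exact hg0 hg'
    -- The letter of least level among the top-degree terms is chosen so that `dual_word` applies to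
    -- all of them.
    · obtain ⟨c, hc, hmin⟩ := Finset.exists_min_image (S.biUnion Multiset.toFinset) D.a (by
        have : s₁ ≠ 0 := by
          rintro rfl
          have := (hS.mp hs₁).2
          rw [mdeg, Multiset.toList_zero, deg_nil] at this
          omega
        obtain ⟨b, hb⟩ := Multiset.exists_mem_of_ne_zero this
        exact ⟨b, Finset.mem_biUnion.mpr ⟨s₁, hs₁, Multiset.mem_toFinset.mpr hb⟩⟩)
      obtain ⟨s₀, hs₀, hcs₀⟩ := Finset.mem_biUnion.mp hc
      rw [Multiset.mem_toFinset] at hcs₀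
      have hm : ⁅D.dual c, D.y c⁆ ∈ H :=
        D.le _ (D.anti (by omega) (D.lie_mem (D.dual_mem_F c) (D.y_mem c)))
      let κ := χ ⟨_, hm⟩
      have hκ : κ ≠ 0 := D.pairing c hm
      let Δ : X →ₗ[ℂ] X := ρ (D.dual c) - χ ⟨D.dual c, D.dual_mem c⟩ • LinearMap.id
      let e : ℤ := n - (D.M - D.a c)
      -- This is `κ` times the formal derivative, along `c`, of the top-degree part of `g`.
      let g₁ : Multiset C →₀ Y :=
        ∑ s ∈ S, Finsupp.single (s.erase c) ((κ * s.count c) • g s)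
      have hac := D.a_lt c
      have hlist : ∀ s : Multiset C, (s.erase c).toList.Perm (s.toList.erase c) := fun s =>
        Multiset.coe_eq_coe.mp (by
          rw [Multiset.coe_toList, ← Multiset.coe_erase, Multiset.coe_toList])
      have hdeg : ∀ s : Multiset C, c ∈ s → D.mdeg (s.erase c) = D.mdeg s - (D.M - D.a c) := by
        intro s hs
        rw [mdeg, mdeg, D.deg_perm (hlist s),
          D.deg_perm (List.perm_cons_erase (Multiset.mem_toList.mpr hs)), deg_cons]
        ring
      have hterm : ∀ s ∈ S, Δ (D.word ρ s.toList (g s))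
          - D.combine ρ Y (Finsupp.single (s.erase c) ((κ * s.count c) • g s))
          ∈ D.fil ρ Y (e - 1) := by
        intro s hs
        have hsn := (hS.mp hs).2
        have h1 := D.dual_word hρ hY c hm s.toList (fun c' hc' => hmin c'
          (Finset.mem_biUnion.mpr ⟨s, hs, Multiset.mem_toFinset.mpr (Multiset.mem_toList.mp hc')⟩))
          (g s) (g s).2 (e - 1) (by change D.mdeg s - _ - 1 ≤ _; omega)
        have hcount : s.toList.count c = s.count c := by
          rw [← Multiset.coe_count, Multiset.coe_toList]
        rw [combine, Finsupp.lsum_single, LinearMap.comp_apply, Submodule.subtype_apply,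
          Submodule.coe_smul, map_smul]
        rw [hcount] at h1
        by_cases hcs : c ∈ s
        · have h2 := D.word_perm hρ hY (hlist s) (g s) (g s).2 (e - 1) (by
            change D.mdeg (s.erase c) - 1 ≤ _
            rw [hdeg s hcs, hsn])
          have := Submodule.sub_mem _ h1 (Submodule.smul_mem _ (κ * s.count c) h2)
          refine (congrArg (· ∈ D.fil ρ Y (e - 1)) ?_).mp this
          change _ = ρ (D.dual c) _ - χ ⟨D.dual c, D.dual_mem c⟩ • D.word ρ s.toList (g s) - _
          rw [smul_sub]
          abel
        · rw [Multiset.count_eq_zero_of_notMem hcs, Nat.cast_zero, mul_zero, zero_smul, sub_zero]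
            at h1 ⊢
          exact h1
      have hlow : ∀ s ∈ g.support \ S, Δ (D.word ρ s.toList (g s)) ∈ D.fil ρ Y (e - 1) := by
        intro s hs
        rw [Finset.mem_sdiff] at hs
        have h1 := hg s hs.1
        have h2 : D.mdeg s ≠ n := fun h => hs.2 (hS.mpr ⟨Finsupp.mem_support_iff.mp hs.1, h⟩)
        push_cast at h1
        exact D.sub_word hρ hY s.toList (D.dual_mem_F c) (D.dual_mem c) (g s) (g s).2 (e - 1)
          (by change D.mdeg s - _ ≤ _; omega)
      have hdiff : Δ (D.combine ρ Y g) - D.combine ρ Y g₁ ∈ D.fil ρ Y (e - 1) := by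
        have hsplit : Δ (D.combine ρ Y g) = ∑ s ∈ g.support \ S, Δ (D.word ρ s.toList (g s))
            + ∑ s ∈ S, Δ (D.word ρ s.toList (g s)) := by
          rw [Finset.sum_sdiff (Finset.filter_subset _ _), combine, Finsupp.lsum_apply,
            Finsupp.sum, map_sum]
          rfl
        rw [hsplit, map_sum, add_sub_assoc, ← Finset.sum_sub_distrib]
        exact Submodule.add_mem _ (Submodule.sum_mem _ hlow) (Submodule.sum_mem _ hterm)
      obtain ⟨g₂, hg₂, hg₂'⟩ := D.exists_combine hρ hY n (e - 1) (by omega) _ hdiff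
      have hg₁ : ∀ s ∈ g₁.support, D.mdeg s ≤ e := by
        intro s hs
        by_contra hse
        refine Finsupp.mem_support_iff.mp hs ?_
        rw [Finsupp.finsetSum_apply]
        refine Finset.sum_eq_zero fun s' hs' => ?_
        by_cases hcs : c ∈ s'
        · rw [Finsupp.single_apply, if_neg]
          rintro rfl
          rw [hdeg s' hcs, (hS.mp hs').2] at hse
          exact hse le_rfl
        · rw [Multiset.count_eq_zero_of_notMem hcs, Nat.cast_zero, mul_zero, zero_smul,
            Finsupp.single_zero]
          rfl
      refine ih (g₁ + g₂) ?_ ?_ ?_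
      -- The coefficient at `s₀.erase c` survives: `g₂` lives in degrees below `e`, and erasing `c`
      -- is injective on the multisets containing `c`.
      · intro h0
        have h1 := DFunLike.congr_fun h0 (s₀.erase c)
        have h2 : g₂ (s₀.erase c) = 0 := by
          by_contra h
          have := hg₂ _ (Finsupp.mem_support_iff.mpr h)
          rw [hdeg s₀ hcs₀, (hS.mp hs₀).2] at this
          omega
        rw [Finsupp.add_apply, h2, add_zero, Finsupp.finsetSum_apply, Finset.sum_eq_single s₀] at h1
        · rw [Finsupp.single_eq_same, Finsupp.zero_apply, smul_eq_zero] at h1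
          rcases h1 with h1 | h1
          · refine mul_ne_zero hκ ?_ h1
            exact_mod_cast (Multiset.count_pos.mpr hcs₀).ne'
          · exact (hS.mp hs₀).1 h1
        · intro s hs hne
          by_cases hcs : c ∈ s
          · rw [Finsupp.single_apply, if_neg]
            intro h
            refine hne ?_
            rw [← Multiset.cons_erase hcs, h, Multiset.cons_erase hcs₀]
          · rw [Multiset.count_eq_zero_of_notMem hcs, Nat.cast_zero, mul_zero, zero_smul,
              Finsupp.single_zero]
            rfl
        · exact fun h => (h hs₀).elim
      · intro s hs
        rcases Finset.mem_union.mp (Finsupp.support_add hs) with h | h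
        · have := hg₁ s h
          omega
        · have := hg₂ s h
          omega
      · rw [map_add, hg₂', add_sub_cancel]
        exact N.sub_mem (hN _ _ hgN) (N.smul_mem _ hgN)

omit hρ hY in
include D in
theorem descends : Descends χ := by
  intro X _ _ ρ hρ Y hY hgen N hN hN0
  obtain ⟨x, hxN, hx0⟩ := Submodule.exists_mem_ne_zero_of_ne_bot hN0
  let P : Submodule ℂ X :=
    { carrier := {x | ∃ d, x ∈ D.fil ρ Y d}
      zero_mem' := ⟨0, Submodule.zero_mem _⟩
      add_mem' := by
        rintro a b ⟨d, hd⟩ ⟨e, he⟩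
        exact ⟨max d e, Submodule.add_mem _ (D.fil_mono (le_max_left d e) hd)
          (D.fil_mono (le_max_right d e) he)⟩
      smul_mem' := by
        rintro c a ⟨d, hd⟩
        exact ⟨d, Submodule.smul_mem _ c hd⟩ }
  have hP : P = ⊤ := by
    refine hgen P (fun y hy => ⟨0, D.word_mem (l := []) le_rfl hy⟩) ?_
    rintro u x ⟨d, hd⟩
    obtain ⟨i, hi⟩ := D.exhaust u
    exact ⟨_, D.act_fil hρ hY hi le_rfl hd⟩
  obtain ⟨d, hd⟩ : x ∈ P := by rw [hP]; trivial
  obtain ⟨g, hg, rfl⟩ := D.exists_combine hρ hY (d.toNat + 1) d (by push_cast; omega) x hd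
  refine D.descend hρ hY hN (d.toNat + 1) g ?_ (fun s hs => ?_) hxN
  · rintro rfl
    exact hx0 (map_zero _)
  · have := hg s hs
    push_cast
    omega

end DescentData

end Descent

end VirasoroInduced

end

noncomputable section

namespace VirasoroInduced

/-! ### The subalgebras -/

/-- The vector `∑ j, u_j e_j` attached to `u = ∑ j, u_j t ^ j`. -/
def ofPoly : ℂ[T;T⁻¹] →ₗ[ℂ] Vir where
  toFun u := ⟨u, 0⟩
  map_add' u v := Vir.ext' rfl (by simp)
  map_smul' c u := Vir.ext' rfl (by simp)

@[simp] theorem ofPoly_poly (u : ℂ[T;T⁻¹]) : (ofPoly u).poly = u := rfl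

@[simp] theorem ofPoly_cen (u : ℂ[T;T⁻¹]) : (ofPoly u).cen = 0 := rfl

theorem ofPoly_T (j : ℤ) : ofPoly (T j) = e j := rfl

@[simp] theorem e_poly (j : ℤ) : (e j).poly = T j := rfl

@[simp] theorem e_cen (j : ℤ) : (e j).cen = 0 := rfl

@[simp] theorem z_poly : z.poly = 0 := rfl

@[simp] theorem z_cen : z.cen = 1 := rfl

theorem eq_ofPoly_add (v : Vir) : v = ofPoly v.poly + v.cen • z := by
  apply Vir.ext' <;> simp

theorem laurent_eq_sum (w : ℂ[T;T⁻¹]) :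
    w = ∑ j ∈ w.coeff.support, w.coeff j • (T j : ℂ[T;T⁻¹]) := by
  ext k
  simp [T_apply, AddMonoidAlgebra.coeff_sum]

theorem laurent_mem (P : Submodule ℂ ℂ[T;T⁻¹]) (w : ℂ[T;T⁻¹])
    (h : ∀ j, w.coeff j ≠ 0 → T j ∈ P) : w ∈ P := by
  rw [laurent_eq_sum w]
  exact P.sum_mem fun j hj => P.smul_mem _ (h j (Finsupp.mem_support_iff.mp hj))

theorem laurent_eq_top {P : Submodule ℂ ℂ[T;T⁻¹]} (h : ∀ j, T j ∈ P) (w : ℂ[T;T⁻¹]) : w ∈ P :=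
  laurent_mem P w fun j _ => h j

theorem laurent_hom_ext {V : Type} [AddCommGroup V] [Module ℂ V] {φ ψ : ℂ[T;T⁻¹] →ₗ[ℂ] V}
    (h : ∀ j, φ (T j) = ψ (T j)) : φ = ψ :=
  LinearMap.ext fun w => laurent_eq_top (P := LinearMap.eqLocus φ ψ) h w

theorem Vir.mem_of_basis {P : Submodule ℂ Vir} (hz : z ∈ P) (he : ∀ j, e j ∈ P) (v : Vir) :
    v ∈ P := by
  rw [eq_ofPoly_add v]
  exact P.add_mem (laurent_eq_top (P := P.comap ofPoly) he v.poly) (P.smul_mem _ hz)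

/-! ### Order of vanishing of Laurent polynomials at zero -/

section LowOrder

/-- All terms of `w` have degree at least `l`. -/
def LowOrder (l : ℤ) (w : ℂ[T;T⁻¹]) : Prop := ∀ j < l, w.coeff j = 0

theorem lowOrder_T {l j : ℤ} (h : l ≤ j) : LowOrder l (T j) := fun i hi => by
  rw [T_apply, if_neg (by omega)]

theorem LowOrder.mem {l : ℤ} {w : ℂ[T;T⁻¹]} (hw : LowOrder l w) (P : Submodule ℂ ℂ[T;T⁻¹])
    (h : ∀ j, l ≤ j → T j ∈ P) : w ∈ P :=
  laurent_mem P w fun j hj => h j (by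
    by_contra hlt
    exact hj (hw j (by omega)))

/-- The Laurent polynomials all of whose terms have degree at least `l`. -/
def lowOrderSub (l : ℤ) : Submodule ℂ ℂ[T;T⁻¹] where
  carrier := {w | LowOrder l w}
  zero_mem' := fun j _ => by simp
  add_mem' := fun {v w} hv hw j hj => by simp [hv j hj, hw j hj]
  smul_mem' := fun c w hw j hj => by simp [hw j hj]

theorem lowOrder_iff {l : ℤ} {w : ℂ[T;T⁻¹]} : LowOrder l w ↔ ∃ P : ℂ[X], w = T l * toLaurent P := by
  constructor
  · intro h
    have := h.mem (LinearMap.range ((LinearMap.mulLeft ℂ (T l)).comp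
      toLaurentAlg.toLinearMap)) (fun j hj => ⟨X ^ (j - l).toNat, by
        change T l * toLaurent _ = _
        rw [toLaurent_X_pow, ← T_add]
        congr 1
        omega⟩)
    obtain ⟨P, hP⟩ := this
    exact ⟨P, hP.symm⟩
  · rintro ⟨P, rfl⟩
    change _ ∈ lowOrderSub l
    induction P using Polynomial.induction_on' with
    | add p q hp hq => rw [map_add, mul_add]; exact Submodule.add_mem _ hp hq
    | monomial n a =>
      rw [← Polynomial.C_mul_X_pow_eq_monomial, toLaurent_C_mul_X_pow, mul_left_comm,
        ← LaurentPolynomial.smul_eq_C_mul, ← T_add]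
      exact Submodule.smul_mem _ _ (lowOrder_T (by omega))

/-- Since `f(0) ≠ 0`, the variable is coprime to `f`, so a power of it dividing a multiple of `f`
divides the cofactor. -/
theorem lowOrder_of_mul {f : ℂ[X]} (hf0 : f.coeff 0 ≠ 0) {m : ℕ} {w : ℂ[T;T⁻¹]}
    (h : LowOrder m (w * toLaurent f)) : LowOrder m w := by
  obtain ⟨P, hP⟩ := lowOrder_iff.mp h
  obtain ⟨N, Q, hQ⟩ := w.exists_T_pow
  have h1 : toLaurent (Q * f) = toLaurent (X ^ (m + N) * P) := by
    rw [map_mul, hQ, map_mul, toLaurent_X_pow, Nat.cast_add, T_add, mul_right_comm, hP]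
    ring
  have h2 : X ^ (m + N) ∣ Q * f := ⟨P, toLaurent_injective h1⟩
  have hcop : IsCoprime (X : ℂ[X]) f := by
    refine (Polynomial.irreducible_X.coprime_iff_not_dvd).mpr ?_
    rwa [Polynomial.X_dvd_iff]
  obtain ⟨R, hR⟩ := (hcop.pow_left).dvd_of_dvd_mul_right h2
  refine lowOrder_iff.mpr ⟨R, ?_⟩
  have h3 : w = toLaurent Q * T (-N) := by
    rw [hQ, mul_assoc, ← T_add, add_neg_cancel, T_zero, mul_one]
  rw [h3, hR, map_mul, toLaurent_X_pow, Nat.cast_add, T_add, mul_right_comm, mul_assoc (T (m : ℤ)),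
    ← T_add, add_neg_cancel, T_zero, mul_one]

end LowOrder

theorem mem_bSub_iff {m : ℕ} {v : Vir} : v ∈ bSub m ↔ LowOrder m v.poly := by
  constructor
  · intro h
    change v ∈ (lowOrderSub m).comap theta
    revert h
    change v ∈ Submodule.span ℂ _ → _
    intro h
    refine Submodule.span_le.mpr ?_ h
    rintro _ (rfl | ⟨j, hj, rfl⟩)
    · exact Submodule.zero_mem ((lowOrderSub m).comap theta)
    · exact lowOrder_T hj
  · intro h
    rw [eq_ofPoly_add v]
    exact (bSub m).add_mem (h.mem ((bSub m).toSubmodule.comap ofPoly) fun j hj => e_mem_bSub hj)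
      ((bSub m).smul_mem _ (z_mem_bSub m))

theorem mem_polySub_iff {f : ℂ[X]} {v : Vir} : v ∈ polySub f ↔ ∃ w, v.poly = w * toLaurent f := by
  rw [mem_polySub, Ideal.mem_span_singleton']
  exact ⟨fun ⟨w, hw⟩ => ⟨w, hw.symm⟩, fun ⟨w, hw⟩ => ⟨w, hw.symm⟩⟩

theorem ofPoly_mul_mem_polySub (f : ℂ[X]) (w : ℂ[T;T⁻¹]) :
    ofPoly (w * toLaurent f) ∈ polySub f :=
  mem_polySub_iff.mpr ⟨w, rfl⟩

theorem ofPoly_T_mul (f : ℂ[X]) (j : ℤ) : ofPoly (T j * toLaurent f) = xf f j :=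
  Vir.ext' (theta_x f j).symm (x_cen f j).symm

theorem mem_bPolySub_iff {f : ℂ[X]} (hf0 : f.coeff 0 ≠ 0) {m : ℕ} {v : Vir} :
    v ∈ bPolySub f m ↔ v ∈ polySub f ∧ v ∈ bSub m := by
  constructor
  · intro h
    change v ∈ (polySub f).toSubmodule ⊓ (bSub m).toSubmodule
    revert h
    change v ∈ Submodule.span ℂ _ → _
    intro h
    refine Submodule.span_le.mpr ?_ h
    rintro _ (rfl | ⟨j, hj, rfl⟩)
    · exact ⟨z_mem_polySub f, z_mem_bSub m⟩
    · refine ⟨x_mem_polySub f j, Submodule.sum_mem _ fun i _ =>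
        Submodule.smul_mem _ _ (e_mem_bSub (by omega))⟩
  · rintro ⟨h₁, h₂⟩
    obtain ⟨w, hw⟩ := mem_polySub_iff.mp h₁
    rw [mem_bSub_iff, hw] at h₂
    rw [eq_ofPoly_add v, hw]
    refine (bPolySub f m).add_mem ?_ ((bPolySub f m).smul_mem _ (z_mem_bPolySub f m))
    refine (lowOrder_of_mul hf0 h₂).mem ((bPolySub f m).toSubmodule.comap
      (ofPoly.comp (LinearMap.mulRight ℂ (toLaurent f)))) fun j hj => ?_
    change ofPoly (T j * toLaurent f) ∈ bPolySub f m
    rw [ofPoly_T_mul]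
    exact x_mem_bPolySub f hj

/-- `span {e_j ∣ j ≥ k}`. -/
def eSub (k : ℕ) : LieSubalgebra ℂ Vir where
  toSubmodule := Submodule.span ℂ {v | ∃ j : ℤ, (k : ℤ) ≤ j ∧ v = e j}
  lie_mem' := by
    intro v w hv hw
    refine lie_mem_span ?_ hv hw
    rintro a ⟨i, hi, rfl⟩ b ⟨j, hj, rfl⟩
    rw [lie_e_e]
    refine Submodule.add_mem _
      (Submodule.smul_mem _ _ (Submodule.subset_span ⟨i + j, by omega, rfl⟩)) ?_
    split_ifs with h
    -- Opposite indices that are both nonnegative are zero, and the cocycle vanishes there. So the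
    -- span is closed without `z`, on which `μ̂` may be nonzero.
    · have : i = 0 := by omega
      subst this
      simp
    · rw [zero_smul]
      exact Submodule.zero_mem _

theorem e_mem_eSub {k : ℕ} {j : ℤ} (h : (k : ℤ) ≤ j) : e j ∈ eSub k :=
  Submodule.subset_span ⟨j, h, rfl⟩

theorem eSub_le {k : ℕ} {P : Submodule ℂ Vir} (h : ∀ j : ℤ, (k : ℤ) ≤ j → e j ∈ P) :
    (eSub k).toSubmodule ≤ P := by
  refine Submodule.span_le.mpr ?_
  rintro _ ⟨j, hj, rfl⟩
  exact h j hj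

theorem ofPoly_mem_eSub {k : ℕ} {w : ℂ[T;T⁻¹]} (h : LowOrder k w) : ofPoly w ∈ eSub k :=
  h.mem ((eSub k).toSubmodule.comap ofPoly) fun _ hj => e_mem_eSub hj

theorem eSub_antitone : Antitone eSub := fun _ _ hkl =>
  eSub_le fun _ hj => e_mem_eSub (le_trans (by exact_mod_cast hkl) hj)

theorem eSub_ad (x : Vir) (k : ℕ) : ∃ l, ∀ a ∈ eSub l, ⁅x, a⁆ ∈ eSub k := by
  let P : Submodule ℂ Vir :=
    { carrier := {x | ∃ l, ∀ a ∈ eSub l, ⁅x, a⁆ ∈ eSub k}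
      zero_mem' := ⟨0, fun a _ => by rw [zero_lie]; exact (eSub k).zero_mem⟩
      add_mem' := by
        rintro x y ⟨l, hl⟩ ⟨l', hl'⟩
        refine ⟨max l l', fun a ha => ?_⟩
        rw [add_lie]
        exact (eSub k).add_mem (hl a (eSub_antitone (le_max_left l l') ha))
          (hl' a (eSub_antitone (le_max_right l l') ha))
      smul_mem' := by
        rintro c x ⟨l, hl⟩
        exact ⟨l, fun a ha => by rw [smul_lie]; exact (eSub k).smul_mem c (hl a ha)⟩ }
  refine Vir.mem_of_basis (P := P) ⟨0, fun a _ => by rw [lie_z]; exact (eSub k).zero_mem⟩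
    -- The first summand brings the index of the bracket up to `k`; the second makes it positive,
    -- which removes the central term.
    (fun j => ⟨(k - j).toNat + (1 - j).toNat, fun a ha => ?_⟩) x
  refine eSub_le (P := (eSub k).toSubmodule.comap (lieRep Vir (e j))) (fun i hi => ?_) ha
  change ⁅e j, e i⁆ ∈ eSub k
  rw [lie_e_e, if_neg (by omega), zero_smul, add_zero]
  exact (eSub k).smul_mem _ (e_mem_eSub (by omega))

theorem eSub_eq {k : ℕ} {v : Vir} (h : v ∈ eSub k) : LowOrder k v.poly ∧ v.cen = 0 := by
  change v ∈ (lowOrderSub k).comap theta ⊓ LinearMap.ker central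
  exact eSub_le (P := (lowOrderSub k).comap theta ⊓ LinearMap.ker central)
    (fun j hj => ⟨lowOrder_T hj, rfl⟩) h

theorem eSub_le_bSub {k m : ℕ} (h : m ≤ k) {v : Vir} (hv : v ∈ eSub k) : v ∈ bSub m :=
  eSub_le (P := (bSub m).toSubmodule)
    (fun _ hj => e_mem_bSub (le_trans (by exact_mod_cast h) hj)) hv

theorem mem_polySub_iff_dvd {f : ℂ[X]} {v : Vir} : v ∈ polySub f ↔ toLaurent f ∣ v.poly := by
  rw [mem_polySub, Ideal.mem_span_singleton]
  rfl

/-- By the Leibniz rule a derivation lowers the exponent by at most one; this is what shifts the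
level in `lie_mem_polySub_pow`. -/
theorem pow_dvd_euler {G w : ℂ[T;T⁻¹]} {k : ℕ} (h : G ^ (k + 1) ∣ w) : G ^ k ∣ euler w := by
  obtain ⟨u, rfl⟩ := h
  induction k generalizing u with
  | zero => simp
  | succ k ih =>
    rw [pow_succ' G (k + 1), mul_assoc, euler_mul]
    refine dvd_add ((dvd_mul_right _ u).mul_left _) ?_
    · have := mul_dvd_mul_left G (ih u)
      rwa [← pow_succ'] at this

theorem lie_mem_polySub_pow {g : ℂ[X]} {k : ℕ} {a : Vir} (ha : a ∈ polySub (g ^ (k + 1))) (x : Vir) :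
    ⁅x, a⁆ ∈ polySub (g ^ k) := by
  rw [mem_polySub_iff_dvd, map_pow] at ha ⊢
  rw [Vir.lie_poly]
  exact dvd_sub ((pow_dvd_euler ha).mul_left _)
    (((pow_dvd_pow _ (Nat.le_succ k)).trans ha).mul_left _)

theorem polySub_pow_antitone (g : ℂ[X]) : Antitone fun k : ℕ => polySub (g ^ k) :=
  fun _ _ hkl => polySub_le_of_dvd (pow_dvd_pow g hkl)

/-- Two members span `Vir` by a Bézout identity between `t^(k+N)` and `f^k`, where `t^N` clears the
denominators of the given element. -/
theorem separating_polySub_eSub {f : ℂ[X]} (hf0 : f.coeff 0 ≠ 0) :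
    Separating (fun k : ℕ => polySub (f ^ k)) eSub where
  antitone_left := polySub_pow_antitone f
  antitone_right := eSub_antitone
  ad_left x k := ⟨k + 1, fun _ ha => lie_mem_polySub_pow ha x⟩
  ad_right := eSub_ad
  exists_sub_mem k v := by
    obtain ⟨N, P, hP⟩ := v.poly.exists_T_pow
    have hcop : IsCoprime (X : ℂ[X]) f := by
      refine (Polynomial.irreducible_X.coprime_iff_not_dvd).mpr ?_
      rwa [Polynomial.X_dvd_iff]
    obtain ⟨a, b, hab⟩ := (hcop.pow_left (m := k + N)).pow_right (n := k)
    have hv : v.poly = T (-N) * toLaurent P := by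
      rw [hP, mul_comm, mul_assoc, ← T_add, add_neg_cancel, T_zero, mul_one]
    have hk : T k * toLaurent (a * P) + T (-N) * toLaurent (b * P) * toLaurent (f ^ k) = v.poly := by
      have : (T k : ℂ[T;T⁻¹]) = T (-N) * toLaurent (X ^ (k + N)) := by
        rw [toLaurent_X_pow, ← T_add]
        congr 1
        push_cast
        ring
      rw [hv, this, mul_assoc, mul_assoc, ← mul_add, ← map_mul, ← map_mul, ← map_add]
      congr 2
      linear_combination P * hab
    refine ⟨ofPoly (T k * toLaurent (a * P)), ofPoly_mem_eSub (lowOrder_iff.mpr ⟨_, rfl⟩), ?_⟩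
    refine mem_polySub_iff.mpr ⟨T (-N) * toLaurent (b * P), ?_⟩
    rw [Vir.sub_poly, ofPoly_poly, ← hk, add_sub_cancel_left]

theorem separating_polySub_polySub {g h : ℂ[X]} (hgh : IsCoprime g h) :
    Separating (fun k : ℕ => polySub (g ^ k)) (fun k : ℕ => polySub (h ^ k)) where
  antitone_left := polySub_pow_antitone g
  antitone_right := polySub_pow_antitone h
  ad_left x k := ⟨k + 1, fun _ ha => lie_mem_polySub_pow ha x⟩
  ad_right x k := ⟨k + 1, fun _ ha => lie_mem_polySub_pow ha x⟩
  exists_sub_mem k v := by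
    obtain ⟨a, b, hab⟩ := (hgh.pow (m := k) (n := k)).map (toLaurent : ℂ[X] →+* ℂ[T;T⁻¹])
    refine ⟨ofPoly (v.poly * b * toLaurent (h ^ k)), mem_polySub_iff.mpr ⟨_, rfl⟩,
      mem_polySub_iff.mpr ⟨v.poly * a, ?_⟩⟩
    rw [Vir.sub_poly, ofPoly_poly]
    linear_combination (-v.poly) * hab

theorem mem_polySub_mul_iff {g h : ℂ[X]} (hgh : IsCoprime g h) {v : Vir} :
    v ∈ polySub (g * h) ↔ v ∈ polySub g ∧ v ∈ polySub h := by
  rw [mem_polySub_iff_dvd, mem_polySub_iff_dvd, mem_polySub_iff_dvd, map_mul]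
  exact ⟨fun hv => ⟨(dvd_mul_right _ _).trans hv, (dvd_mul_left _ _).trans hv⟩,
    fun hv => (hgh.map (toLaurent : ℂ[X] →+* ℂ[T;T⁻¹])).mul_dvd hv.1 hv.2⟩

/-! ### Characters of the polynomial subalgebras -/

section Characters

variable {f : ℂ[X]}

/-- The linear form `w ↦ ν (f w)` on Laurent polynomials attached to a character `ν` of `Vir^f`. -/
def form (ν : LieCharacter ℂ (polySub f)) : ℂ[T;T⁻¹] →ₗ[ℂ] ℂ :=
  (ν : polySub f →ₗ[ℂ] ℂ).comp
    ((ofPoly.comp (LinearMap.mulRight ℂ (toLaurent f))).codRestrict (polySub f).toSubmodule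
      (ofPoly_mul_mem_polySub f))

theorem form_apply (ν : LieCharacter ℂ (polySub f)) (w : ℂ[T;T⁻¹]) :
    form ν w = ν ⟨ofPoly (w * toLaurent f), ofPoly_mul_mem_polySub f w⟩ := rfl

theorem form_T (ν : LieCharacter ℂ (polySub f)) (j : ℤ) : form ν (T j) = polyVal ν j := by
  rw [form_apply, polyVal]
  congr 2
  exact ofPoly_T_mul f j

theorem char_apply (ν : LieCharacter ℂ (polySub f)) (v : polySub f) {w : ℂ[T;T⁻¹]}
    (hw : (v : Vir).poly = w * toLaurent f) :
    ν v = form ν w + (v : Vir).cen * ν ⟨z, z_mem_polySub f⟩ := by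
  have hv : v = ⟨ofPoly (w * toLaurent f), ofPoly_mul_mem_polySub f w⟩
      + (v : Vir).cen • ⟨z, z_mem_polySub f⟩ := by
    apply Subtype.ext
    change (v : Vir) = ofPoly (w * toLaurent f) + (v : Vir).cen • z
    rw [← hw]
    exact eq_ofPoly_add _
  conv_lhs => rw [hv, map_add, map_smul, smul_eq_mul]
  rfl

/-- The relation given by the vanishing of `ν` on `[f t^j, f t^k]`. -/
theorem form_relation (ν : LieCharacter ℂ (polySub f)) (j k : ℤ) :
    ((k : ℂ) - j) * form ν (T (j + k) * toLaurent f)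
      + ⁅xf f j, xf f k⁆.cen * ν ⟨z, z_mem_polySub f⟩ = 0 := by
  have h0 := lieCharacter_apply_lie ν ⟨xf f j, x_mem_polySub f j⟩ ⟨xf f k, x_mem_polySub f k⟩
  rw [char_apply ν _ (w := ((k : ℂ) - j) • (T (j + k) * toLaurent f)), map_smul, smul_eq_mul] at h0
  · exact h0
  · change theta (xf f j) * euler (theta (xf f k)) - euler (theta (xf f j)) * theta (xf f k) = _
    rw [theta_x, theta_x, euler_mul, euler_mul, euler_T, euler_T, T_add]
    simp only [LaurentPolynomial.smul_eq_C_mul, map_sub]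
    ring

end Characters

end VirasoroInduced

end

noncomputable section

namespace VirasoroInduced

/-! ### Characters of `Vir^f` as linear forms modulo `f` -/

section Characters

attribute [local instance 100] LieRing.ofAssociativeRing

variable {f : ℂ[X]}

/-- For this value of `j + k`, the indices `j + i` and `k + l` are opposite only when `i` and `l`
both equal the degree of `f`, so only the leading coefficient enters. -/
theorem lie_xf_cen (f : ℂ[X]) {j k : ℤ} (h : j + k = -2 * f.natDegree) :
    ⁅xf f j, xf f k⁆.cen = f.leadingCoeff ^ 2 *
      ((((j + f.natDegree : ℤ) : ℂ) ^ 3 - ((j + f.natDegree : ℤ) : ℂ)) / 12) := by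
  have h1 : ⁅xf f j, xf f k⁆.cen = ∑ i ∈ Finset.range (f.natDegree + 1),
      ∑ l ∈ Finset.range (f.natDegree + 1), f.coeff i * (f.coeff l * ⁅e (j + i), e (k + l)⁆.cen) := by
    change central ⁅xf f j, xf f k⁆ = _
    simp only [xf, sum_lie, lie_sum, smul_lie, lie_smul, map_sum, map_smul,
      smul_eq_mul]
    rw [Finset.sum_comm]
    refine Finset.sum_congr rfl fun i _ => ?_
    rw [Finset.mul_sum]
    refine Finset.sum_congr rfl fun l _ => ?_
    exact mul_left_comm _ _ _
  have h2 : ∀ i l : ℕ, ⁅e (j + i), e (k + l)⁆.cen = if k + l = -(j + i) then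
      (((j + i : ℤ) : ℂ) ^ 3 - ((j + i : ℤ) : ℂ)) / 12 else 0 := by
    intro i l
    rw [lie_e_e, Vir.add_cen, Vir.smul_cen, Vir.smul_cen, e_cen, z_cen, smul_zero, zero_add, smul_eq_mul, mul_one]
  rw [h1, Finset.sum_eq_single f.natDegree, Finset.sum_eq_single f.natDegree]
  · rw [h2, if_pos (by omega), Polynomial.leadingCoeff]
    ring
  · intro l hl hne
    rw [Finset.mem_range] at hl
    rw [h2, if_neg (by omega), mul_zero, mul_zero]
  · simp
  · intro i hi hne
    rw [Finset.mem_range] at hi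
    refine Finset.sum_eq_zero fun l hl => ?_
    rw [Finset.mem_range] at hl
    rw [h2, if_neg (by omega), mul_zero, mul_zero]
  · simp

/-- Brackets with the same index sum involve the same multiple of `f^2` but different central terms.
The pairs `1, -1` and `2, -2`, shifted by the degree, have cocycle values `0` and `1/2`; eliminating
the common term isolates the value at `z`. -/
theorem char_z (hf : f.Monic) (ν : LieCharacter ℂ (polySub f)) :
    ν ⟨z, z_mem_polySub f⟩ = 0 := by
  have h1 := form_relation ν (1 - f.natDegree) (-1 - f.natDegree)
  have h2 := form_relation ν (2 - f.natDegree) (-2 - f.natDegree)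
  rw [lie_xf_cen f (by ring), hf.leadingCoeff] at h1 h2
  rw [show (1 - f.natDegree : ℤ) + (-1 - f.natDegree) = -2 * f.natDegree by ring] at h1
  rw [show (2 - f.natDegree : ℤ) + (-2 - f.natDegree) = -2 * f.natDegree by ring] at h2
  push_cast at h1 h2
  linear_combination 2 * h2 - 4 * h1

/-- Writing `n = j + k` with `j ≠ k` exhibits `t^n f^2` as a nonzero multiple of a bracket, up to a
central term that `char_z` removes. -/
theorem form_mul (hf : f.Monic) (ν : LieCharacter ℂ (polySub f)) (w : ℂ[T;T⁻¹]) :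
    form ν (w * toLaurent f) = 0 := by
  suffices h : ∀ n, form ν (T n * toLaurent f) = 0 from
    LinearMap.mem_ker.mp (laurent_eq_top
      (P := LinearMap.ker ((form ν).comp (LinearMap.mulRight ℂ (toLaurent f)))) h w)
  intro n
  obtain ⟨j, k, hjk, hne⟩ : ∃ j k : ℤ, j + k = n ∧ j ≠ k := by
    by_cases h : n = 0
    · exact ⟨1, -1, by omega, by omega⟩
    · exact ⟨n, 0, by omega, h⟩
  have := form_relation ν j k
  rw [char_z hf, mul_zero, add_zero, hjk, mul_eq_zero] at this
  refine this.resolve_left fun h => hne ?_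
  rw [sub_eq_zero] at h
  exact_mod_cast h.symm

theorem char_eq_form (hf : f.Monic) (ν : LieCharacter ℂ (polySub f)) (v : polySub f)
    {w : ℂ[T;T⁻¹]} (hw : (v : Vir).poly = w * toLaurent f) : ν v = form ν w := by
  rw [char_apply ν v hw, char_z hf, mul_zero, add_zero]

theorem char_ext (hf : f.Monic) {ν ν' : LieCharacter ℂ (polySub f)} (h : form ν = form ν') :
    ν = ν' := by
  ext v
  obtain ⟨w, hw⟩ := mem_polySub_iff.mp v.2
  rw [char_eq_form hf ν v hw, char_eq_form hf ν' v hw, h]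

/-- The quotient by `f` of an element of `Vir^f`. -/
def quot (hf : f ≠ 0) : polySub f →ₗ[ℂ] ℂ[T;T⁻¹] :=
  (LinearEquiv.ofInjective (LinearMap.mulRight ℂ (toLaurent f))
    (mul_left_injective₀ (toLaurent_ne_zero.mpr hf))).symm.toLinearMap.comp
    ((theta.comp (polySub f).toSubmodule.subtype).codRestrict _ fun v => by
      obtain ⟨w, hw⟩ := mem_polySub_iff.mp v.2
      exact ⟨w, hw.symm⟩)

theorem quot_mul (hf : f ≠ 0) (v : polySub f) : quot hf v * toLaurent f = (v : Vir).poly := by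
  have := (LinearEquiv.ofInjective (LinearMap.mulRight ℂ (toLaurent f))
    (mul_left_injective₀ (toLaurent_ne_zero.mpr hf))).apply_symm_apply
    (((theta.comp (polySub f).toSubmodule.subtype).codRestrict _ fun v => by
      obtain ⟨w, hw⟩ := mem_polySub_iff.mp v.2
      exact ⟨w, hw.symm⟩) v)
  exact congrArg Subtype.val this

/-- A linear form which vanishes on a multiple of `f` gives a character of `Vir^f`. -/
theorem exists_char (hf : f.Monic) (ξ : ℂ[T;T⁻¹] →ₗ[ℂ] ℂ)
    (hξ : ∀ w, ξ (w * toLaurent f) = 0) : ∃ ν : LieCharacter ℂ (polySub f), form ν = ξ := by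
  refine ⟨{ ξ.comp (quot hf.ne_zero) with
    map_lie' := fun {v w} => ?_ }, ?_⟩
  -- In the bracket of two multiples of `f` the terms containing the derivative of `f` cancel,
  -- leaving a multiple of `f^2`.
  · have hlie : quot hf.ne_zero ⁅v, w⁆ = (quot hf.ne_zero v * euler (quot hf.ne_zero w)
        - euler (quot hf.ne_zero v) * quot hf.ne_zero w) * toLaurent f := by
      refine mul_left_injective₀ (toLaurent_ne_zero.mpr hf.ne_zero) ?_
      change quot hf.ne_zero ⁅v, w⁆ * toLaurent f = _ * toLaurent f
      rw [quot_mul]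
      change (v : Vir).poly * euler (w : Vir).poly - euler (v : Vir).poly * (w : Vir).poly = _
      rw [← quot_mul hf.ne_zero v, ← quot_mul hf.ne_zero w, euler_mul, euler_mul]
      ring
    change ξ (quot hf.ne_zero ⁅v, w⁆) = _
    rw [hlie, hξ]
    exact (sub_eq_zero.mpr (mul_comm _ _)).symm
  · refine LinearMap.ext fun w => ?_
    change ξ (quot hf.ne_zero ⟨ofPoly (w * toLaurent f), ofPoly_mul_mem_polySub f w⟩) = ξ w
    congr 1
    exact mul_left_injective₀ (toLaurent_ne_zero.mpr hf.ne_zero) (quot_mul _ _)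

end Characters

/-! ### Exponential polynomials -/

section Exponential

/-- Evaluation of a Laurent polynomial at `r ≠ 0`. -/
def evalAt {r : ℂ} (hr : r ≠ 0) : ℂ[T;T⁻¹] →ₐ[ℂ] ℂ where
  toRingHom := LaurentPolynomial.eval₂ (RingHom.id ℂ) (Units.mk0 r hr)
  commutes' c := by
    change LaurentPolynomial.eval₂ (RingHom.id ℂ) (Units.mk0 r hr) (LaurentPolynomial.C c) = c
    rw [LaurentPolynomial.eval₂_C, RingHom.id_apply]

variable {r : ℂ} (hr : r ≠ 0)

@[simp] theorem evalAt_T (j : ℤ) : evalAt hr (T j) = r ^ j := by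
  change LaurentPolynomial.eval₂ (RingHom.id ℂ) (Units.mk0 r hr) (T j) = _
  rw [LaurentPolynomial.eval₂_T, Units.val_zpow_eq_zpow_val, Units.val_mk0]

@[simp] theorem evalAt_toLaurent (g : ℂ[X]) : evalAt hr (toLaurent g) = g.eval r := by
  change LaurentPolynomial.eval₂ (RingHom.id ℂ) (Units.mk0 r hr) (toLaurent g) = _
  rw [LaurentPolynomial.eval₂_toLaurent]
  rfl

/-- `t - r` as a Laurent polynomial. -/
abbrev lin (r : ℂ) : ℂ[T;T⁻¹] := toLaurent (X - Polynomial.C r)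

theorem lin_eq (r : ℂ) : lin r = T 1 - LaurentPolynomial.C r := by simp

theorem euler_lin (r : ℂ) : euler (lin r) = T 1 := by
  have hC : euler (LaurentPolynomial.C r) = 0 := by
    rw [← mul_one (LaurentPolynomial.C r), ← T_zero, ← LaurentPolynomial.smul_eq_C_mul, map_smul,
      euler_T]
    simp
  rw [lin_eq, map_sub, hC, euler_T]
  simp

theorem euler_lin_pow_mul (r : ℂ) (k : ℕ) (w : ℂ[T;T⁻¹]) : euler (lin r ^ (k + 1) * w)
    = lin r ^ k * (((k : ℂ) + 1) • (T 1 * w) + lin r * euler w) := by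
  have h : ∀ k : ℕ, euler (lin r ^ (k + 1)) = ((k : ℂ) + 1) • (lin r ^ k * T 1) := by
    intro k
    induction k with
    | zero => rw [zero_add, pow_one, pow_zero, one_mul, Nat.cast_zero, zero_add, one_smul, euler_lin]
    | succ k ih =>
      rw [pow_succ, euler_mul, ih, euler_lin]
      simp only [LaurentPolynomial.smul_eq_C_mul, map_add, map_one, Nat.cast_add, Nat.cast_one]
      ring
  rw [euler_mul, h]
  simp only [LaurentPolynomial.smul_eq_C_mul]
  ring

theorem evalAt_lin : evalAt hr (lin r) = 0 := by
  rw [evalAt_toLaurent]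
  simp

theorem exists_eq_add_lin_mul (w : ℂ[T;T⁻¹]) :
    ∃ w', w = LaurentPolynomial.C (evalAt hr w) + lin r * w' := by
  obtain ⟨N, P, hP⟩ := w.exists_T_pow
  have hw : w = T (-N) * toLaurent P := by
    rw [hP, mul_comm, mul_assoc, ← T_add, add_neg_cancel, T_zero, mul_one]
  have hval : P.eval r = evalAt hr w * r ^ N := by
    rw [← evalAt_toLaurent hr, hP, map_mul, evalAt_T, zpow_natCast]
  have hroot : (P - Polynomial.C (evalAt hr w) * X ^ N).IsRoot r := by
    simp [Polynomial.IsRoot, hval]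
  obtain ⟨Q, hQ⟩ := Polynomial.dvd_iff_isRoot.mpr hroot
  refine ⟨T (-N) * toLaurent Q, ?_⟩
  have h2 := congrArg toLaurent hQ
  rw [map_sub, map_mul, map_mul, toLaurent_C, toLaurent_X_pow] at h2
  have h3 : (T (-N) * T N : ℂ[T;T⁻¹]) = 1 := by rw [← T_add, neg_add_cancel, T_zero]
  have h4 : T (-N) * (toLaurent P - LaurentPolynomial.C (evalAt hr w) * T N)
      = T (-N) * (lin r * toLaurent Q) := by rw [h2]
  rw [← sub_eq_iff_eq_add']
  conv_lhs => arg 1; rw [hw]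
  linear_combination h4 + (LaurentPolynomial.C (evalAt hr w)) * h3

theorem evalAt_euler_pow_of_lt (i : ℕ) : ∀ (k : ℕ), i < k → ∀ w,
    evalAt hr ((euler ^ i) (lin r ^ k * w)) = 0 := by
  induction i with
  | zero =>
    intro k hk w
    rw [pow_zero, Module.End.one_apply, map_mul, map_pow, evalAt_lin, zero_pow (by omega), zero_mul]
  | succ i ih =>
    intro k hk w
    obtain ⟨k, rfl⟩ : ∃ k', k = k' + 1 := ⟨k - 1, by omega⟩
    rw [pow_succ, Module.End.mul_apply, euler_lin_pow_mul]
    exact ih k (by omega) _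

/-- Each derivation must remove one factor `t - r`, since any term that keeps one too many vanishes
at `r`. -/
theorem evalAt_euler_pow_self (i : ℕ) : ∀ w,
    evalAt hr ((euler ^ i) (lin r ^ i * w)) = i.factorial * r ^ i * evalAt hr w := by
  induction i with
  | zero => intro w; simp
  | succ i ih =>
    intro w
    rw [pow_succ, Module.End.mul_apply, euler_lin_pow_mul, ih, map_add, map_mul, evalAt_lin,
      zero_mul, add_zero, map_smul, map_mul, evalAt_T, Nat.factorial_succ, zpow_one, smul_eq_mul]
    push_cast
    ring

/-- The linear form `t ^ j ↦ q(j) r ^ j`. -/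
def expForm (q : ℂ[X]) : ℂ[T;T⁻¹] →ₗ[ℂ] ℂ :=
  (evalAt hr).toLinearMap.comp (Polynomial.aeval (R := ℂ) euler q)

theorem expForm_apply (q : ℂ[X]) (w : ℂ[T;T⁻¹]) :
    expForm hr q w = q.sum fun i a => a * evalAt hr ((euler ^ i) w) := by
  change evalAt hr (Polynomial.aeval (R := ℂ) euler q w) = _
  rw [Polynomial.aeval_eq_sum_range, Polynomial.sum_over_range _ (fun i => zero_mul _)]
  simp [LinearMap.sum_apply, map_sum]

theorem euler_pow_T (i : ℕ) (j : ℤ) : (euler ^ i) (T j) = ((j : ℂ) ^ i) • T j := by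
  induction i with
  | zero => simp
  | succ i ih => rw [pow_succ', Module.End.mul_apply, ih, map_smul, euler_T, smul_smul, pow_succ]

theorem expForm_T (q : ℂ[X]) (j : ℤ) : expForm hr q (T j) = q.eval (j : ℂ) * r ^ j := by
  rw [expForm_apply, Polynomial.eval_eq_sum, Polynomial.sum, Polynomial.sum, Finset.sum_mul]
  refine Finset.sum_congr rfl fun i _ => ?_
  rw [euler_pow_T, map_smul, evalAt_T, smul_eq_mul, mul_assoc]

theorem expForm_of_lt {q : ℂ[X]} {k : ℕ} (h : q.degree < k) (w : ℂ[T;T⁻¹]) :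
    expForm hr q (lin r ^ k * w) = 0 := by
  rw [expForm_apply, Polynomial.sum]
  refine Finset.sum_eq_zero fun i hi => ?_
  rw [evalAt_euler_pow_of_lt hr i k, mul_zero]
  have := (Polynomial.le_degree_of_mem_supp i hi).trans_lt h
  exact_mod_cast this

theorem expForm_natDegree (q : ℂ[X]) (w : ℂ[T;T⁻¹]) :
    expForm hr q (lin r ^ q.natDegree * w)
      = q.leadingCoeff * (q.natDegree.factorial * r ^ q.natDegree * evalAt hr w) := by
  rw [expForm_apply, Polynomial.sum_over_range _ (fun i => zero_mul _),
    Finset.sum_range_succ, Finset.sum_eq_zero, zero_add, evalAt_euler_pow_self]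
  · rfl
  · intro i hi
    rw [evalAt_euler_pow_of_lt hr i _ (Finset.mem_range.mp hi), mul_zero]

/-- A linear form vanishing on the multiples of `(t - r) ^ n` is an exponential polynomial. -/
theorem exists_expForm (n : ℕ) : ∀ (ξ : ℂ[T;T⁻¹] →ₗ[ℂ] ℂ),
    (∀ w, ξ (lin r ^ n * w) = 0) → ∃ q : ℂ[X], q.degree < n ∧ ξ = expForm hr q := by
  induction n with
  | zero =>
    intro ξ hξ
    refine ⟨0, by simp, ?_⟩
    refine LinearMap.ext fun w => ?_
    simpa [expForm_apply] using hξ w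
  | succ n ih =>
    intro ξ hξ
    -- The value for which the monomial `c X^n` agrees with `ξ` on `(t - r)^n`; the difference then
    -- kills all multiples of `(t - r)^n`.
    let c : ℂ := ξ (lin r ^ n) / (n.factorial * r ^ n)
    have hc : c * (n.factorial * r ^ n) = ξ (lin r ^ n) :=
      div_mul_cancel₀ _ (mul_ne_zero (by exact_mod_cast n.factorial_ne_zero) (pow_ne_zero n hr))
    obtain ⟨q, hq, hq'⟩ := ih (ξ - expForm hr (Polynomial.C c * X ^ n)) (fun w => by
      obtain ⟨w', hw'⟩ := exists_eq_add_lin_mul hr w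
      have h1 : ξ (lin r ^ n * w) = evalAt hr w * ξ (lin r ^ n) := by
        conv_lhs => rw [hw', mul_add, map_add, ← mul_assoc, ← pow_succ, hξ, add_zero, mul_comm,
          ← LaurentPolynomial.smul_eq_C_mul, map_smul, smul_eq_mul]
      have h2 : expForm hr (Polynomial.C c * X ^ n) (lin r ^ n * w)
          = c * (n.factorial * r ^ n * evalAt hr w) := by
        rw [expForm_apply, Polynomial.C_mul_X_pow_eq_monomial,
          Polynomial.sum_monomial_index c (fun i (a : ℂ) => a * evalAt hr ((euler ^ i) (lin r ^ n * w))) (zero_mul _), evalAt_euler_pow_self]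
      rw [LinearMap.sub_apply, h1, h2, ← hc]
      ring)
    refine ⟨q + Polynomial.C c * X ^ n, ?_, ?_⟩
    · refine lt_of_le_of_lt (Polynomial.degree_add_le _ _) (max_lt ?_ ?_)
      · exact hq.trans (by exact_mod_cast Nat.lt_succ_self n)
      · exact lt_of_le_of_lt (Polynomial.degree_C_mul_X_pow_le n c)
          (by exact_mod_cast Nat.lt_succ_self n)
    · rw [sub_eq_iff_eq_add] at hq'
      rw [hq']
      refine LinearMap.ext fun w => ?_
      simp [expForm]

end Exponential

end VirasoroInduced

end

noncomputable section

namespace VirasoroInduced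

/-! ### The Whittaker factor -/

section WhittakerFactor

theorem LowOrder.mono {k l : ℤ} (h : k ≤ l) {w : ℂ[T;T⁻¹]} (hw : LowOrder l w) : LowOrder k w :=
  fun j hj => hw j (by omega)

theorem LowOrder.mul {k l : ℤ} {v w : ℂ[T;T⁻¹]} (hv : LowOrder k v) (hw : LowOrder l w) :
    LowOrder (k + l) (v * w) := by
  obtain ⟨P, rfl⟩ := lowOrder_iff.mp hv
  obtain ⟨Q, rfl⟩ := lowOrder_iff.mp hw
  refine lowOrder_iff.mpr ⟨P * Q, ?_⟩
  rw [map_mul, T_add]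
  ring

theorem LowOrder.euler {k : ℤ} {w : ℂ[T;T⁻¹]} (hw : LowOrder k w) : LowOrder k (euler w) :=
  fun j hj => by rw [euler_coeff, hw j hj, mul_zero]

theorem LowOrder.sub {k : ℤ} {v w : ℂ[T;T⁻¹]} (hv : LowOrder k v) (hw : LowOrder k w) :
    LowOrder k (v - w) :=
  (lowOrderSub k).sub_mem hv hw

theorem exists_lowOrder (w : ℂ[T;T⁻¹]) : ∃ l ≤ 0, LowOrder l w := by
  obtain ⟨N, P, hP⟩ := w.exists_T_pow
  refine ⟨-N, by omega, lowOrder_iff.mpr ⟨P, ?_⟩⟩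
  rw [hP, mul_comm, mul_assoc, ← T_add, add_neg_cancel, T_zero, mul_one]

/-- The span of the `e_j`, `j ≥ i`, together with `z` if `i ≤ 0`. -/
def lowFiltration (i : ℤ) : Submodule ℂ Vir where
  carrier := {v | LowOrder i v.poly ∧ (0 < i → v.cen = 0)}
  zero_mem' := ⟨(lowOrderSub i).zero_mem, fun _ => rfl⟩
  add_mem' := fun {v w} hv hw => ⟨(lowOrderSub i).add_mem hv.1 hw.1, fun hi => by
    rw [Vir.add_cen, hv.2 hi, hw.2 hi, add_zero]⟩
  smul_mem' := fun c v hv => ⟨(lowOrderSub i).smul_mem c hv.1, fun hi => by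
    rw [Vir.smul_cen, hv.2 hi, smul_zero]⟩

theorem e_mem_lowFiltration {i j : ℤ} (h : i ≤ j) : e j ∈ lowFiltration i :=
  ⟨lowOrder_T h, fun _ => rfl⟩

theorem lie_mem_lowFiltration {i j : ℤ} {u v : Vir} (hu : u ∈ lowFiltration i)
    (hv : v ∈ lowFiltration j) : ⁅u, v⁆ ∈ lowFiltration (i + j) := by
  refine ⟨(hu.1.mul hv.1.euler).sub (hu.1.euler.mul hv.1), fun hij => ?_⟩
  rw [Vir.lie_cen]
  have : LowOrder (i + j) ((euler (euler (euler u.poly)) - euler u.poly) * v.poly) :=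
    (hu.1.euler.euler.euler.sub hu.1.euler).mul hv.1
  change AddMonoidAlgebra.coeff _ 0 / 12 = 0
  rw [this 0 hij, zero_div]

variable {m : ℕ}

theorem whittaker_apply_eq_zero (ψ : LieCharacter ℂ (bSub m)) {M : ℤ} (hM : (m : ℤ) ≤ M + 1)
    (hψ : ∀ (j : ℤ) (hj : M + 1 ≤ j), ψ ⟨e j, e_mem_bSub (by omega)⟩ = 0) {w : ℂ[T;T⁻¹]}
    (hw : LowOrder (M + 1) w) (h : ofPoly w ∈ bSub m) : ψ ⟨ofPoly w, h⟩ = 0 := by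
  obtain ⟨a, ha, ha'⟩ := hw.mem (((LinearMap.ker (ψ : bSub m →ₗ[ℂ] ℂ)).map
    (bSub m).toSubmodule.subtype).comap ofPoly) fun j hj => ⟨_, hψ j hj, rfl⟩
  have : a = ⟨ofPoly w, h⟩ := Subtype.ext ha'
  rw [← this]
  exact ha

/-- The descent data of a Whittaker character. -/
def whittakerData (ψ : LieCharacter ℂ (bSub m)) (M : ℤ) (hM1 : 1 ≤ M) (hM : 2 * (m : ℤ) - 1 ≤ M)
    (hψ : ∀ (j : ℤ) (hj : M + 1 ≤ j), ψ ⟨e j, e_mem_bSub (by omega)⟩ = 0)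
    (h0 : ψ ⟨e M, e_mem_bSub (by omega)⟩ ≠ 0) : DescentData ψ {j : ℤ // j < m} where
  F := lowFiltration
  M := M
  y j := e j
  a j := j
  lie_mem := lie_mem_lowFiltration
  anti := fun i j hij u hu => ⟨hu.1.mono hij, fun hi => hu.2 (by omega)⟩
  exhaust u := by
    obtain ⟨l, hl, h⟩ := exists_lowOrder u.poly
    exact ⟨l, h, fun hl' => by omega⟩
  one_le := hM1
  y_mem c := e_mem_lowFiltration le_rfl
  a_lt c := by have := c.2; omega
  a_inj := Subtype.val_injective
  decomp i u hu := by
    have h1 : ofPoly u.poly ∈ Submodule.span ℂ {w | ∃ c : {j : ℤ // j < m}, i ≤ c ∧ w = e c}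
        ⊔ (bSub m).toSubmodule := by
      refine hu.1.mem (Submodule.comap ofPoly (_ ⊔ (bSub m).toSubmodule)) fun j hj => ?_
      by_cases hjm : j < m
      · exact Submodule.mem_sup_left (Submodule.subset_span ⟨⟨j, hjm⟩, hj, rfl⟩)
      · exact Submodule.mem_sup_right (e_mem_bSub (by omega))
    obtain ⟨v, hv, h, hh, hvh⟩ := Submodule.mem_sup.mp h1
    have hvF : v ∈ lowFiltration i := by
      refine Submodule.span_le.mpr ?_ hv
      rintro _ ⟨c, hc, rfl⟩
      exact e_mem_lowFiltration hc
    refine ⟨v, hv, ?_, (lowFiltration i).sub_mem hu hvF⟩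
    have hu' := eq_ofPoly_add u
    rw [← hvh] at hu'
    have : u - v = h + u.cen • z :=
      (congrArg (· - v) hu').trans (by simp only [add_assoc, add_sub_cancel_left])
    rw [this]
    exact (bSub m).add_mem hh ((bSub m).smul_mem _ (z_mem_bSub m))
  le u hu := mem_bSub_iff.mpr (hu.1.mono (by omega))
  kill u h hu := by
    have : u = ofPoly u.poly := Vir.ext' rfl (hu.2 (by omega))
    have h' : ofPoly u.poly ∈ bSub m := this ▸ h
    have := whittaker_apply_eq_zero ψ (by omega) hψ hu.1 h'
    rw [← this]
    congr 2
  -- With `c ≤ m - 1` and `M ≥ 2m - 1`, the index `M - c` is at least `m`.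
  dual c := e (M - c)
  dual_mem c := e_mem_bSub (by have := c.2; omega)
  dual_mem_F c := e_mem_lowFiltration le_rfl
  pairing c h := by
    have hc := c.2
    have h1 : (⟨_, h⟩ : bSub m) = ((c : ℂ) - ((M - c : ℤ) : ℂ)) • ⟨e M, e_mem_bSub (by omega)⟩ := by
      apply Subtype.ext
      change ⁅e (M - c), e c⁆ = _ • e M
      rw [lie_e_e, if_neg (by omega), zero_smul, add_zero, sub_add_cancel]
    rw [h1, map_smul, smul_eq_mul]
    -- The structure constant is `2c - M`, and `2c ≤ 2m - 2 < M`.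
    refine mul_ne_zero ?_ h0
    rw [sub_ne_zero]
    norm_cast
    omega

/-- The top level is the last index at which `ψ` is nonzero, either `2m` or `2m - 1`; the latter is
the least value for which all dual vectors still lie in `𝔟_m`. -/
theorem descends_whittaker (hm : 1 ≤ m) (ψ : LieCharacter ℂ (bSub m))
    (hψ : ∀ (j : ℤ) (hj : 2 * (m : ℤ) + 1 ≤ j), ψ ⟨e j, e_mem_bSub (by omega)⟩ = 0)
    (h : ψ ⟨e (2 * m), e_mem_bSub (by omega)⟩ ≠ 0 ∨
      ψ ⟨e (2 * m - 1), e_mem_bSub (by omega)⟩ ≠ 0) : Descends ψ := by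
  by_cases h0 : ψ ⟨e (2 * m), e_mem_bSub (by omega)⟩ = 0
  · refine (whittakerData ψ (2 * m - 1) (by omega) le_rfl (fun j hj => ?_)
      (h.resolve_left (not_not_intro h0))).descends
    obtain rfl | hj' : j = 2 * m ∨ 2 * (m : ℤ) + 1 ≤ j := by omega
    · exact h0
    · exact hψ j hj'
  · exact (whittakerData ψ (2 * m) (by omega) (by omega) hψ h0).descends

end WhittakerFactor

/-! ### The factors at a single root -/

section Point

variable {r : ℂ}

theorem euler_lin_pow (k : ℕ) : euler (lin r ^ k) = (k : ℂ) • (lin r ^ (k - 1) * T 1) := by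
  cases k with
  | zero =>
    rw [pow_zero, ← T_zero, euler_T]
    simp
  | succ k =>
    have := euler_lin_pow_mul r k 1
    have h1 : euler 1 = 0 := by
      rw [← T_zero, euler_T]
      simp
    rw [mul_one, mul_one, h1, mul_zero, add_zero, mul_smul_comm] at this
    rw [this]
    simp

theorem mem_polySub_lin {k : ℕ} {v : Vir} :
    v ∈ polySub ((X - Polynomial.C r) ^ k) ↔ lin r ^ k ∣ v.poly := by
  rw [mem_polySub_iff_dvd, map_pow]

/-- The filtration by order of vanishing at `r`. -/
def rootFiltration (r : ℂ) (i : ℤ) : Submodule ℂ Vir :=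
  (polySub ((X - Polynomial.C r) ^ (i + 1).toNat)).toSubmodule

theorem mem_rootFiltration {i : ℤ} {v : Vir} :
    v ∈ rootFiltration r i ↔ lin r ^ (i + 1).toNat ∣ v.poly := mem_polySub_lin

theorem rootFiltration_antitone : Antitone (rootFiltration r) := fun i j hij v hv => by
  rw [mem_rootFiltration] at hv ⊢
  exact (pow_dvd_pow _ (by omega)).trans hv

theorem pow_pred_dvd_euler {G w : ℂ[T;T⁻¹]} {k : ℕ} (h : G ^ k ∣ w) : G ^ (k - 1) ∣ euler w := by
  cases k with
  | zero => simp
  | succ k => exact pow_dvd_euler h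

theorem lie_mem_rootFiltration {i j : ℤ} {u v : Vir} (hu : u ∈ rootFiltration r i)
    (hv : v ∈ rootFiltration r j) : ⁅u, v⁆ ∈ rootFiltration r (i + j) := by
  rw [mem_rootFiltration] at hu hv ⊢
  rw [Vir.lie_poly]
  refine dvd_sub ?_ ?_
  · have := mul_dvd_mul hu (pow_pred_dvd_euler hv)
    rw [← pow_add] at this
    exact (pow_dvd_pow _ (by omega)).trans this
  · have := mul_dvd_mul (pow_pred_dvd_euler hu) hv
    rw [← pow_add] at this
    exact (pow_dvd_pow _ (by omega)).trans this

/-- This is Taylor expansion at `r`, truncated before order `n`; the induction variable `l` bounds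
the number of terms still to be split off. -/
theorem exists_lin_decomp (hr : r ≠ 0) (n : ℕ) : ∀ (l k : ℕ), n ≤ k + l → ∀ w : ℂ[T;T⁻¹],
    ∃ v ∈ Submodule.span ℂ {u | ∃ c : Fin n, k ≤ c ∧ u = lin r ^ (c : ℕ)},
      lin r ^ n ∣ lin r ^ k * w - v := by
  intro l
  induction l with
  | zero =>
    intro k hk w
    refine ⟨0, Submodule.zero_mem _, ?_⟩
    rw [sub_zero]
    exact (pow_dvd_pow _ (by omega)).mul_right _
  | succ l ih =>
    intro k hk w
    by_cases hkn : n ≤ k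
    · refine ⟨0, Submodule.zero_mem _, ?_⟩
      rw [sub_zero]
      exact (pow_dvd_pow _ hkn).mul_right _
    obtain ⟨w', hw'⟩ := exists_eq_add_lin_mul hr w
    obtain ⟨v, hv, hd⟩ := ih (k + 1) (by omega) w'
    refine ⟨evalAt hr w • lin r ^ k + v, Submodule.add_mem _ (Submodule.smul_mem _ _
      (Submodule.subset_span ⟨⟨k, by omega⟩, le_rfl, rfl⟩)) (Submodule.span_mono ?_ hv), ?_⟩
    · rintro _ ⟨c, hc, rfl⟩
      exact ⟨c, by omega, rfl⟩
    · have : lin r ^ k * w - (evalAt hr w • lin r ^ k + v) = lin r ^ (k + 1) * w' - v := by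
        conv_lhs => arg 1; rw [hw']
        rw [LaurentPolynomial.smul_eq_C_mul]
        ring
      rwa [this]

variable (hr : r ≠ 0) {n : ℕ} {p : ℂ[X]} {ν : LieCharacter ℂ (polySub ((X - Polynomial.C r) ^ n))}

theorem natDegree_lt_of_form (hp : p ≠ 0) (hν : form ν = expForm hr p) : p.natDegree < n := by
  by_contra hlt
  have h1 := form_mul ((monic_X_sub_C r).pow n) ν (lin r ^ (p.natDegree - n))
  rw [map_pow, ← pow_add, Nat.sub_add_cancel (by omega), hν] at h1
  have h2 := expForm_natDegree hr p 1
  rw [mul_one, h1, map_one, mul_one] at h2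
  exact mul_ne_zero (leadingCoeff_ne_zero.mpr hp)
    (mul_ne_zero (by exact_mod_cast p.natDegree.factorial_ne_zero) (pow_ne_zero _ hr)) h2.symm

/-- The descent data of a character of large degree at a root of multiplicity at least two. -/
def rootData (hn : 2 ≤ n) (hp : p ≠ 0) (hν : form ν = expForm hr p) (hd : n ≤ p.natDegree + 2) :
    DescentData ν (Fin n) where
  F := rootFiltration r
  -- Levels are orders of vanishing at `r` minus one, so that brackets add levels. The form `ν`
  -- kills `(t - r)^n w` when `(t - r)^(deg p + 1)` divides `w`, but not for `w = (t - r)^(deg p)`.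
  -- The bound `n ≥ 2` makes this level positive, which fails at a simple root.
  M := n + p.natDegree - 1
  y c := ofPoly (lin r ^ (c : ℕ))
  a c := c - 1
  lie_mem := lie_mem_rootFiltration
  anti := rootFiltration_antitone
  exhaust u := ⟨-1, mem_rootFiltration.mpr (by simp)⟩
  one_le := by omega
  y_mem c := mem_rootFiltration.mpr (by simp)
  a_lt c := by have := c.2; omega
  a_inj c c' h := by
    apply Fin.ext
    simpa using h
  decomp i u hu := by
    obtain ⟨w, hw⟩ := mem_rootFiltration.mp hu
    obtain ⟨v, hv, hdvd⟩ := exists_lin_decomp hr n n (i + 1).toNat (by omega) w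
    have hle : ∀ v ∈ Submodule.span ℂ {u | ∃ c : Fin n, (i + 1).toNat ≤ c ∧ u = lin r ^ (c : ℕ)},
        ofPoly v ∈ Submodule.span ℂ
          {w | ∃ c : Fin n, i ≤ (c : ℤ) - 1 ∧ w = ofPoly (lin r ^ (c : ℕ))} := by
      intro v hv
      have := Submodule.mem_map_of_mem (f := ofPoly) hv
      rw [Submodule.map_span] at this
      refine Submodule.span_mono ?_ this
      rintro _ ⟨_, ⟨c, hc, rfl⟩, rfl⟩
      exact ⟨c, by omega, rfl⟩
    refine ⟨ofPoly v, hle v hv, ?_, Submodule.sub_mem _ hu ?_⟩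
    · rw [mem_polySub_lin, Vir.sub_poly, ofPoly_poly, hw]
      exact hdvd
    · refine Submodule.span_le.mpr ?_ (hle v hv)
      rintro _ ⟨c, hc, rfl⟩
      exact rootFiltration_antitone hc (mem_rootFiltration.mpr (by simp))
  le u hu := by
    rw [mem_rootFiltration] at hu
    exact mem_polySub_lin.mpr ((pow_dvd_pow _ (by omega)).trans hu)
  kill u h hu := by
    obtain ⟨w, hw⟩ := mem_rootFiltration.mp hu
    rw [char_eq_form ((monic_X_sub_C r).pow n) ν ⟨u, h⟩ (w := lin r ^ (p.natDegree + 1) * w), hν]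
    · exact expForm_of_lt hr (by
        rw [Polynomial.degree_eq_natDegree hp]; exact_mod_cast Nat.lt_succ_self _) w
    · change u.poly = _
      rw [hw, map_pow, mul_right_comm, ← pow_add]
      congr 2
      omega
  -- The exponent is at least `n` precisely because `c ≤ n - 1` and `deg p ≥ n - 2`: the large
  -- degree condition puts the dual vectors in the subalgebra.
  dual c := ofPoly (lin r ^ (n + p.natDegree + 1 - c))
  dual_mem c := mem_polySub_lin.mpr (pow_dvd_pow _ (by have := c.2; omega))
  dual_mem_F c := mem_rootFiltration.mpr (pow_dvd_pow _ (by have := c.2; omega))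
  pairing c h := by
    have hc := c.2
    have h1 : (⁅ofPoly (lin r ^ (n + p.natDegree + 1 - c)), ofPoly (lin r ^ (c : ℕ))⁆ : Vir).poly
        = ((((c : ℕ) : ℂ) - ((n + p.natDegree + 1 - c : ℕ) : ℂ)) •
          (lin r ^ p.natDegree * T 1)) * toLaurent ((X - Polynomial.C r) ^ n) := by
      rw [Vir.lie_poly, ofPoly_poly, ofPoly_poly, euler_lin_pow, euler_lin_pow, map_pow]
      have h2 : (((c : ℕ) : ℂ) • (lin r ^ (n + p.natDegree + 1 - c) * lin r ^ ((c : ℕ) - 1)) : ℂ[T;T⁻¹])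
          = ((c : ℕ) : ℂ) • (lin r ^ (n + p.natDegree)) := by
        rcases Nat.eq_zero_or_pos (c : ℕ) with h0 | h0
        · rw [h0]; simp
        · rw [← pow_add]
          congr 2
          omega
      have h3 : (lin r ^ (n + p.natDegree + 1 - c - 1) * lin r ^ (c : ℕ) : ℂ[T;T⁻¹])
          = lin r ^ (n + p.natDegree) := by
        rw [← pow_add]
        congr 1
        omega
      rw [mul_smul_comm, ← mul_assoc, ← smul_mul_assoc, h2, smul_mul_assoc, smul_mul_assoc,
        mul_right_comm _ (T 1), h3, ← sub_smul, smul_mul_assoc, pow_add]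
      congr 1
      ring
    rw [char_eq_form ((monic_X_sub_C r).pow n) ν _ h1, hν, map_smul, expForm_natDegree, evalAt_T,
      smul_eq_mul]
    refine mul_ne_zero ?_ (mul_ne_zero (leadingCoeff_ne_zero.mpr hp) (mul_ne_zero
      (mul_ne_zero (by exact_mod_cast p.natDegree.factorial_ne_zero) (pow_ne_zero _ hr))
      (zpow_ne_zero _ hr)))
    -- The structure constant is `2c - (n + deg p + 1)`, which is negative because `2c ≤ 2n - 2` and
    -- `deg p ≥ n - 2`.
    rw [sub_ne_zero]
    norm_cast
    omega

/-- A polynomial computing `φ ((y - j) ^ k v)` as a function of `j`. -/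
theorem exists_eval_eq_sub_pow {W : Type} [AddCommGroup W] [Module ℂ W] (y : Module.End ℂ W)
    (k : ℕ) : ∀ (φ : W →ₗ[ℂ] ℂ) (v : W), ∃ Q : ℂ[X], Q.natDegree ≤ k ∧
      Q.coeff k = (-1) ^ k * φ v ∧
      ∀ j : ℂ, Q.eval j = φ (((y - j • (1 : Module.End ℂ W)) ^ k) v) := by
  induction k with
  | zero =>
    intro φ v
    exact ⟨Polynomial.C (φ v), by simp, by simp, by simp⟩
  | succ k ih =>
    intro φ v
    obtain ⟨Q, hQ, hc, he⟩ := ih (φ.comp y) v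
    obtain ⟨R, hR, hc', he'⟩ := ih φ v
    refine ⟨Q - X * R, ?_, ?_, fun j => ?_⟩
    · refine (Polynomial.natDegree_sub_le _ _).trans (max_le (by omega) ?_)
      refine Polynomial.natDegree_mul_le.trans ?_
      have := Polynomial.natDegree_X_le (R := ℂ)
      omega
    · rw [Polynomial.coeff_sub, Polynomial.coeff_eq_zero_of_natDegree_lt (by omega),
        Polynomial.coeff_X_mul, hc', pow_succ]
      ring
    · rw [Polynomial.eval_sub, Polynomial.eval_mul, Polynomial.eval_X, he, he', pow_succ',
        Module.End.mul_apply]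
      simp

/-- The complement is spanned by `y = e_0`, so the module consists of polynomials `∑ y^k x_k` with
`x_k ∈ Y`. On such a vector `e_j` acts as `r^j ∑ (y - j)^k (y + j c/r) x_k`. Up to `r^j` this is a
polynomial in `j` with top coefficient `± (c/r) x_D`; since a submodule contains its values at all
integers, it contains `x_D`. -/
theorem descends_simple_root (hp : p ≠ 0) {ν : LieCharacter ℂ (polySub ((X - Polynomial.C r) ^ 1))}
    (hν : form ν = expForm hr p) : Descends ν := by
  have hmonic := (monic_X_sub_C r).pow 1
  have hd := natDegree_lt_of_form hr hp hν
  obtain ⟨c, rfl⟩ := Polynomial.natDegree_eq_zero.mp (Nat.lt_one_iff.mp hd)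
  have hc : c ≠ 0 := by
    rintro rfl
    exact hp (map_zero _)
  intro X' _ _ ρ hρ Y hY hgen N hN hN0
  have hform : ∀ w, form ν w = c * evalAt hr w := fun w => by
    rw [hν, expForm_apply, Polynomial.sum_C_index (by simp)]
    simp
  have hνv : ∀ (v : Vir) (hv : v ∈ polySub ((X - Polynomial.C r) ^ 1)),
      ν ⟨v, hv⟩ = c / r * evalAt hr (euler v.poly) := by
    intro v hv
    obtain ⟨w, hw⟩ := mem_polySub_lin.mp hv
    rw [char_eq_form hmonic ν ⟨v, hv⟩ (w := w) (by
      change v.poly = _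
      rw [hw, map_pow, mul_comm]), hform, hw, euler_lin_pow_mul, map_mul, pow_zero, map_one, one_mul,
      map_add, map_mul, evalAt_lin, zero_mul, map_smul, map_mul, evalAt_T]
    simp
    field_simp
  -- the action on `Y`
  let y : Module.End ℂ X' := ρ (e 0)
  have hz : ∀ x ∈ Y, ρ z x = 0 := fun x hx => by
    have := hY ⟨z, z_mem_polySub _⟩ x hx
    rwa [char_z hmonic, zero_smul] at this
  -- The difference `e_j - r^j e_0` vanishes at `r`, so on `Y` it acts by the value of `ν`, which is
  -- `c/r` times its Euler derivative at `r`.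
  have he : ∀ (j : ℤ), ∀ x ∈ Y, ρ (e j) x = r ^ j • (y x + ((j : ℂ) * (c / r)) • x) := by
    intro j x hx
    have hmem : e j - r ^ j • e 0 ∈ polySub ((X - Polynomial.C r) ^ 1) := by
      rw [mem_polySub_lin, pow_one]
      obtain ⟨w, hw⟩ := exists_eq_add_lin_mul hr (e j - r ^ j • e 0).poly
      have : evalAt hr (e j - r ^ j • e 0).poly = 0 := by simp
      rw [this, map_zero, zero_add] at hw
      exact ⟨w, hw⟩
    have := hY ⟨_, hmem⟩ x hx
    rw [hνv] at this
    change ρ (e j - r ^ j • e 0) x = _ at this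
    have h2 : evalAt hr (euler (e j - r ^ j • e 0).poly) = j * r ^ j := by
      simp [euler_T, -T_zero]
    rw [h2, map_sub, LinearMap.sub_apply, map_smul, LinearMap.smul_apply, sub_eq_iff_eq_add] at this
    rw [this, smul_add, smul_smul, add_comm]
    congr 2
    ring
  have hcomm : ∀ (j : ℤ) (x : X'), ρ (e j) (y x) = (y - (j : ℂ) • (1 : Module.End ℂ X')) (ρ (e j) x) := by
    intro j x
    have h1 := hρ (e j) (e 0) x
    have h2 : ⁅e j, e 0⁆ = (-(j : ℂ)) • e j := by
      rw [lie_e_e, add_zero, Int.cast_zero, zero_sub]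
      split_ifs with h
      · have : j = 0 := by omega
        simp [this]
      · simp
    rw [h2, map_smul, LinearMap.smul_apply, eq_sub_iff_add_eq] at h1
    change ρ (e j) (ρ (e 0) x) = _
    rw [← h1]
    change _ = ρ (e 0) (ρ (e j) x) - (j : ℂ) • ρ (e j) x
    rw [neg_smul]
    abel
  have hpow : ∀ (j : ℤ) (k : ℕ) (x : X'), ρ (e j) ((y ^ k) x)
      = ((y - (j : ℂ) • (1 : Module.End ℂ X')) ^ k) (ρ (e j) x) := by
    intro j k x
    induction k with
    | zero => rfl
    | succ k ih => rw [pow_succ', Module.End.mul_apply, hcomm, ih, pow_succ', Module.End.mul_apply]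
  -- every vector is a polynomial in `y` with coefficients in `Y`
  let P : Submodule ℂ X' :=
    { carrier := {u | ∃ (D : ℕ) (x : ℕ → X'), (∀ k, x k ∈ Y) ∧ (∀ k, D ≤ k → x k = 0) ∧
        u = ∑ k ∈ Finset.range D, (y ^ k) (x k)}
      zero_mem' := ⟨0, 0, fun _ => Y.zero_mem, fun _ _ => rfl, by simp⟩
      add_mem' := by
        rintro u v ⟨D, x, hx, hx0, rfl⟩ ⟨D', x', hx', hx0', rfl⟩
        refine ⟨max D D', x + x', fun k => Y.add_mem (hx k) (hx' k), fun k hk => ?_, ?_⟩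
        · rw [Pi.add_apply, hx0 k (by omega), hx0' k (by omega), add_zero]
        · simp only [Pi.add_apply, map_add, Finset.sum_add_distrib]
          congr 1
          · refine Finset.sum_subset (Finset.range_subset_range.mpr (le_max_left _ _)) fun k _ hk => ?_
            rw [hx0 k (by simpa using hk), map_zero]
          · refine Finset.sum_subset (Finset.range_subset_range.mpr (le_max_right _ _)) fun k _ hk => ?_
            rw [hx0' k (by simpa using hk), map_zero]
      smul_mem' := by
        rintro a u ⟨D, x, hx, hx0, rfl⟩
        refine ⟨D, a • x, fun k => Y.smul_mem a (hx k), fun k hk => ?_, ?_⟩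
        · rw [Pi.smul_apply, hx0 k hk, smul_zero]
        · simp [Finset.smul_sum] }
  have hYP : Y ≤ P := fun x hx => by
    refine ⟨1, fun k => if k = 0 then x else 0, fun k => ?_, fun k hk => if_neg (by omega), by simp⟩
    dsimp only
    split_ifs
    · exact hx
    · exact Y.zero_mem
  have hPle : ∀ {Q : Submodule ℂ X'}, (∀ k : ℕ, ∀ x ∈ Y, (y ^ k) x ∈ Q) → P ≤ Q := by
    rintro Q hQ _ ⟨D, x, hx, -, rfl⟩
    exact Q.sum_mem fun k _ => hQ k _ (hx k)
  have hyP : ∀ u ∈ P, y u ∈ P := by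
    rintro _ ⟨D, x, hx, hx0, rfl⟩
    refine ⟨D + 1, fun k => if k = 0 then 0 else x (k - 1), fun k => ?_, fun k hk => ?_, ?_⟩
    · dsimp only
      split_ifs
      · exact Y.zero_mem
      · exact hx _
    · dsimp only
      rw [if_neg (by omega), hx0 _ (by omega)]
    · rw [Finset.sum_range_succ', map_sum]
      simp [pow_succ']
  have hsub : ∀ (j : ℂ) (k : ℕ), ∀ u ∈ P, ((y - j • (1 : Module.End ℂ X')) ^ k) u ∈ P := by
    intro j k
    induction k with
    | zero => exact fun u hu => hu
    | succ k ih =>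
      intro u hu
      rw [pow_succ', Module.End.mul_apply]
      exact P.sub_mem (hyP _ (ih u hu)) (P.smul_mem _ (ih u hu))
  have hPtop : P = ⊤ := by
    refine hgen P hYP fun u x hx => ?_
    have hu : u ∈ {u : Vir | ∀ x ∈ P, ρ u x ∈ P} := by
      let S : Submodule ℂ Vir :=
        { carrier := {u : Vir | ∀ x ∈ P, ρ u x ∈ P}
          zero_mem' := fun x _ => by rw [map_zero]; exact P.zero_mem
          add_mem' := fun {a b} ha hb x hx => by
            rw [map_add]; exact P.add_mem (ha x hx) (hb x hx)
          smul_mem' := fun a b hb x hx => by rw [map_smul]; exact P.smul_mem a (hb x hx) }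
      refine Vir.mem_of_basis (P := S) (fun x hx => ?_) (fun j x hx => ?_) u
      · refine hPle (Q := P.comap (ρ z)) (fun k x hx => ?_) hx
        have : ρ z ((y ^ k) x) = (y ^ k) (ρ z x) := by
          induction k with
          | zero => rfl
          | succ k ih =>
            have h1 := hρ z (e 0) ((y ^ k) x)
            rw [lie_z, map_zero, LinearMap.zero_apply] at h1
            rw [pow_succ', Module.End.mul_apply, Module.End.mul_apply, ← ih]
            exact (sub_eq_zero.mp h1.symm)
        change ρ z ((y ^ k) x) ∈ P
        rw [this, hz x hx, map_zero]
        exact P.zero_mem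
      · refine hPle (Q := P.comap (ρ (e j))) (fun k x hx => ?_) hx
        change ρ (e j) ((y ^ k) x) ∈ P
        rw [hpow, he j x hx]
        exact hsub _ _ _ (P.smul_mem _ (P.add_mem (hyP _ (hYP hx)) (P.smul_mem _ (hYP hx))))
    exact hu x hx
  obtain ⟨u, huN, hu0⟩ := N.ne_bot_iff.mp hN0
  obtain ⟨D, x, hx, hxD, hux⟩ : ∃ (D : ℕ) (x : ℕ → X'), (∀ k, x k ∈ Y) ∧ x D ≠ 0 ∧
      u = ∑ k ∈ Finset.range (D + 1), (y ^ k) (x k) := by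
    have hu : u ∈ P := hPtop ▸ Submodule.mem_top
    obtain ⟨D, x, hx, -, hux⟩ := hu
    induction D with
    | zero => exact absurd (hux.trans (by simp)) hu0
    | succ D ih =>
      by_cases hD : x D = 0
      · refine ih ?_
        rw [hux, Finset.sum_range_succ, hD, map_zero, add_zero]
      · exact ⟨D, x, hx, hD, hux⟩
  refine ⟨x D, ?_, hx D, hxD⟩
  by_contra hDN
  -- A functional vanishing on `N` but not at `x D` turns the action of all `e_j` on `u` into one
  -- scalar polynomial in `j` that vanishes at every integer.
  obtain ⟨φ, hφ, hNφ⟩ := Submodule.exists_le_ker_of_notMem hDN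
  choose Q hQ hQc hQe using fun k => exists_eval_eq_sub_pow y k φ (y (x k))
  choose R hR hRc hRe using fun k => exists_eval_eq_sub_pow y k φ (x k)
  let S : ℂ[X] := ∑ k ∈ Finset.range (D + 1), (Q k + Polynomial.C (c / r) * (X * R k))
  have hS : S = 0 := by
    refine Polynomial.eq_zero_of_infinite_isRoot S
      ((Set.infinite_range_of_injective (Int.cast_injective (α := ℂ))).mono ?_)
    rintro _ ⟨j, rfl⟩
    have h1 : φ (ρ (e j) u) = 0 := hNφ (hN (e j) u huN)
    rw [hux, map_sum, map_sum] at h1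
    have h2 : ∀ k, φ (ρ (e j) ((y ^ k) (x k)))
        = r ^ j * (Q k + Polynomial.C (c / r) * (X * R k)).eval (j : ℂ) := by
      intro k
      rw [hpow, he j _ (hx k), map_smul, map_add, map_smul, map_smul, map_add, map_smul,
        ← hQe, ← hRe]
      simp only [smul_eq_mul, Polynomial.eval_add, Polynomial.eval_mul, Polynomial.eval_C,
        Polynomial.eval_X]
      ring
    rw [Finset.sum_congr rfl fun k _ => h2 k, ← Finset.mul_sum, ← Polynomial.eval_finsetSum] at h1
    exact (mul_eq_zero.mp h1).resolve_left (zpow_ne_zero _ hr)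
  -- Only the summand `X * R D` reaches degree `D + 1`.
  have h3 : S.coeff (D + 1) = c / r * ((-1) ^ D * φ (x D)) := by
    rw [Polynomial.finsetSum_coeff, Finset.sum_range_succ, Finset.sum_eq_zero, zero_add,
      Polynomial.coeff_add, Polynomial.coeff_C_mul, Polynomial.coeff_X_mul, hRc,
      Polynomial.coeff_eq_zero_of_natDegree_lt (by have := hQ D; omega), zero_add]
    intro k hk
    rw [Finset.mem_range] at hk
    rw [Polynomial.coeff_add, Polynomial.coeff_C_mul, Polynomial.coeff_X_mul,
      Polynomial.coeff_eq_zero_of_natDegree_lt (by have := hQ k; omega),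
      Polynomial.coeff_eq_zero_of_natDegree_lt (by have := hR k; omega), mul_zero, zero_add]
  rw [hS, Polynomial.coeff_zero] at h3
  exact mul_ne_zero (div_ne_zero hc hr) (mul_ne_zero (pow_ne_zero _ (by norm_num)) hφ) h3.symm

/-- The characters of large degree at a single root. -/
theorem descends_root (hn : 1 ≤ n) (hp : p ≠ 0) (hd : n ≤ p.natDegree + 2)
    (hν : form ν = expForm hr p) : Descends ν := by
  obtain rfl | hn' : n = 1 ∨ 2 ≤ n := by omega
  · exact descends_simple_root hr hp hν
  · exact (rootData hr hn' hp hν hd).descends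

end Point

end VirasoroInduced

end

noncomputable section

namespace VirasoroInduced

/-! ### Extending and restricting characters -/

section Restriction

attribute [local instance 100] LieRing.ofAssociativeRing

theorem exists_comp_eq {V W : Type} [AddCommGroup V] [Module ℂ V] [AddCommGroup W] [Module ℂ W]
    (i : W →ₗ[ℂ] V) (φ : W →ₗ[ℂ] ℂ) (h : ∀ w, i w = 0 → φ w = 0) :
    ∃ φ' : V →ₗ[ℂ] ℂ, ∀ w, φ' (i w) = φ w := by
  have : φ ∈ LinearMap.range i.dualMap := by
    rw [LinearMap.range_dualMap_eq_dualAnnihilator_ker, Submodule.mem_dualAnnihilator]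
    exact h
  obtain ⟨φ', rfl⟩ := this
  exact ⟨φ', fun w => rfl⟩

/-- Linear forms prescribed on two subspaces glue as soon as they agree on the overlap; the maps
need not be injective. -/
theorem exists_comp_eq_comp_eq {V W₁ W₂ : Type} [AddCommGroup V] [Module ℂ V] [AddCommGroup W₁]
    [Module ℂ W₁] [AddCommGroup W₂] [Module ℂ W₂] (i₁ : W₁ →ₗ[ℂ] V) (i₂ : W₂ →ₗ[ℂ] V)
    (φ₁ : W₁ →ₗ[ℂ] ℂ) (φ₂ : W₂ →ₗ[ℂ] ℂ) (h : ∀ w₁ w₂, i₁ w₁ = i₂ w₂ → φ₁ w₁ = φ₂ w₂) :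
    ∃ φ : V →ₗ[ℂ] ℂ, (∀ w, φ (i₁ w) = φ₁ w) ∧ ∀ w, φ (i₂ w) = φ₂ w := by
  obtain ⟨φ, hφ⟩ := exists_comp_eq (i₁.coprod i₂) (φ₁.coprod φ₂) (by
    rintro ⟨w₁, w₂⟩ hw
    rw [LinearMap.coprod_apply] at hw ⊢
    rw [h w₁ (-w₂) (by rw [map_neg]; exact eq_neg_of_add_eq_zero_left hw), map_neg, neg_add_cancel])
  exact ⟨φ, fun w => by simpa using hφ (w, 0), fun w => by simpa using hφ (0, w)⟩

variable {L : Type} [LieRing L] [LieAlgebra ℂ L]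

/-- A linear form vanishing on the brackets of `H` restricts to a character of `H`. -/
def charOf (H : LieSubalgebra ℂ L) (φ : L →ₗ[ℂ] ℂ) (h : ∀ a ∈ H, ∀ b ∈ H, φ ⁅a, b⁆ = 0) :
    LieCharacter ℂ H where
  toLinearMap := φ.comp H.toSubmodule.subtype
  map_lie' := fun {a b} => by
    change φ ⁅(a : L), (b : L)⁆ = _
    rw [h a a.2 b b.2]
    exact (sub_eq_zero.mpr (mul_comm _ _)).symm

theorem charOf_apply {H : LieSubalgebra ℂ L} {φ : L →ₗ[ℂ] ℂ} (h : ∀ a ∈ H, ∀ b ∈ H, φ ⁅a, b⁆ = 0)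
    (v : H) : charOf H φ h v = φ v := rfl

theorem exists_linear {H : LieSubalgebra ℂ L} (χ : LieCharacter ℂ H) :
    ∃ φ : L →ₗ[ℂ] ℂ, ∀ v (h : v ∈ H), φ v = χ ⟨v, h⟩ := by
  obtain ⟨φ, hφ⟩ := exists_comp_eq H.toSubmodule.subtype (χ : H →ₗ[ℂ] ℂ) (fun w hw => by
    have : w = 0 := Subtype.ext hw
    rw [this]
    exact map_zero χ)
  exact ⟨φ, fun v h => hφ ⟨v, h⟩⟩

theorem linear_lie {H : LieSubalgebra ℂ L} {χ : LieCharacter ℂ H} {φ : L →ₗ[ℂ] ℂ}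
    (hφ : ∀ v (h : v ∈ H), φ v = χ ⟨v, h⟩) {a b : L} (ha : a ∈ H) (hb : b ∈ H) : φ ⁅a, b⁆ = 0 := by
  rw [hφ _ (H.lie_mem ha hb)]
  exact lieCharacter_apply_lie χ ⟨a, ha⟩ ⟨b, hb⟩

theorem descends_of_forall_mem {H : LieSubalgebra ℂ L} (χ : LieCharacter ℂ H)
    (h : ∀ a, a ∈ H) : Descends χ := by
  intro X _ _ ρ _ Y hY hgen N _ hN0
  have htop : Y = ⊤ := hgen Y le_rfl fun u x hx => by
    rw [hY ⟨u, h u⟩ x hx]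
    exact Y.smul_mem _ hx
  obtain ⟨y, hy, hy0⟩ := N.ne_bot_iff.mp hN0
  exact ⟨y, hy, htop ▸ Submodule.mem_top, hy0⟩

end Restriction

/-! ### Products over the roots -/

section Roots

variable {f : ℂ[X]}

theorem char_eq_zero_of_mem_sq (hf : f.Monic) (ν : LieCharacter ℂ (polySub f)) {v : Vir}
    (hv : v ∈ polySub (f ^ 2)) : ∃ h : v ∈ polySub f, ν ⟨v, h⟩ = 0 := by
  obtain ⟨w, hw⟩ := mem_polySub_iff.mp hv
  rw [map_pow, pow_two, ← mul_assoc] at hw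
  exact ⟨mem_polySub_iff.mpr ⟨_, hw⟩, by rw [char_eq_form hf ν ⟨v, _⟩ hw, form_mul hf]⟩

theorem coprime_prod_roots {S : Finset ℂ} {a : ℂ} (ha : a ∉ S) (n : ℂ → ℕ) :
    IsCoprime ((X - Polynomial.C a) ^ n a) (∏ r ∈ S, (X - Polynomial.C r) ^ n r) := by
  refine IsCoprime.prod_right fun r hr => IsCoprime.pow ?_
  refine Polynomial.isCoprime_X_sub_C_of_isUnit_sub (sub_ne_zero.mpr ?_).isUnit
  rintro rfl
  exact ha hr

theorem monic_prod_roots (S : Finset ℂ) (n : ℂ → ℕ) :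
    (∏ r ∈ S, (X - Polynomial.C r) ^ n r).Monic :=
  monic_prod_of_monic _ _ fun r _ => (monic_X_sub_C r).pow (n r)

theorem eq_prod_roots (hf : f.Monic) :
    f = ∏ r ∈ f.roots.toFinset, (X - Polynomial.C r) ^ f.rootMultiplicity r := by
  conv_lhs => rw [(IsAlgClosed.splits f).eq_prod_roots_of_monic hf,
    Polynomial.prod_multiset_root_eq_finset_root]

theorem ne_zero_of_mem_roots (hf0 : f.coeff 0 ≠ 0) {r : ℂ} (hr : r ∈ f.roots.toFinset) : r ≠ 0 := by
  rintro rfl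
  rw [Multiset.mem_toFinset, Polynomial.mem_roots', Polynomial.IsRoot.def,
    ← Polynomial.coeff_zero_eq_eval_zero] at hr
  exact hf0 hr.2

/-- Induction over the roots: the factor at one root descends, and the product of the others is
irreducible by induction. The linear extensions `N r` allow sums of characters of different
subalgebras. -/
theorem isIrreducible_of_descends (n : ℂ → ℕ)
    (ν : ∀ r, LieCharacter ℂ (polySub ((X - Polynomial.C r) ^ n r)))
    (N : ℂ → Vir →ₗ[ℂ] ℂ) (hN : ∀ r v h, N r v = ν r ⟨v, h⟩) (S : Finset ℂ)
    (hS : ∀ r ∈ S, Descends (ν r)) : ∀ (g : ℂ[X]), g = ∏ r ∈ S, (X - Polynomial.C r) ^ n r →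
    ∀ χ : LieCharacter ℂ (polySub g), (∀ v, χ v = ∑ r ∈ S, N r v) →
      LieModule.IsIrreducible ℂ Vir (Ind (polySub g) (OneDim χ)) := by
  induction S using Finset.induction_on with
  | empty =>
    rintro g hg χ -
    refine (descends_of_forall_mem χ fun v => mem_polySub_iff.mpr ⟨v.poly, ?_⟩).isIrreducible
    rw [hg, Finset.prod_empty, map_one, mul_one]
  | insert a S ha ih =>
    rintro g hg χ hχ
    let G : ℂ[X] := ∏ r ∈ S, (X - Polynomial.C r) ^ n r
    have hle : ∀ r ∈ S, polySub G ≤ polySub ((X - Polynomial.C r) ^ n r) := fun r hr =>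
      polySub_le_of_dvd (Finset.dvd_prod_of_mem (fun r => (X - Polynomial.C r) ^ n r) hr)
    let χ' : LieCharacter ℂ (polySub G) := charOf (polySub G) (∑ r ∈ S, N r) (by
      intro u hu v hv
      rw [LinearMap.sum_apply]
      exact Finset.sum_eq_zero fun r hr => linear_lie (hN r) (hle r hr hu) (hle r hr hv))
    have hχ' : ∀ v, χ' v = ∑ r ∈ S, N r v := fun v => by
      rw [charOf_apply, LinearMap.sum_apply]
    have hirr := ih (fun r hr => hS r (Finset.mem_insert_of_mem hr)) G rfl χ' hχ'
    have hcop := coprime_prod_roots ha n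
    have hg' : g = (X - Polynomial.C a) ^ n a * G := by rw [hg, Finset.prod_insert ha]
    refine Adapted.isIrreducible (χ₁ := ν a) (χ₂ := χ') ?_ (hS a (Finset.mem_insert_self _ _)) hirr
      (A := fun k => polySub (((X - Polynomial.C a) ^ n a) ^ k)) (B := fun k => polySub (G ^ k))
    exact
      { separating := separating_polySub_polySub hcop
        left := ⟨2, fun v hv => char_eq_zero_of_mem_sq ((monic_X_sub_C a).pow (n a)) (ν a) hv⟩
        right := ⟨2, fun v hv => char_eq_zero_of_mem_sq (monic_prod_roots S n) χ' hv⟩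
        mem_iff := fun v => by rw [hg', mem_polySub_mul_iff hcop]
        eq_add := fun v h h₁ h₂ => by
          rw [hχ, hχ', Finset.sum_insert ha, hN a v h₁] }

theorem form_eq_expForm {r : ℂ} (hr : r ≠ 0) {ν : LieCharacter ℂ (polySub f)} {p : ℂ[X]}
    (h : ∀ j, polyVal ν j = p.eval (j : ℂ) * r ^ j) : form ν = expForm hr p :=
  laurent_hom_ext fun j => by rw [form_T, expForm_T, h]

theorem LargeDegree.isIrreducible (hf : f.Monic) (hf0 : f.coeff 0 ≠ 0)
    {μ : LieCharacter ℂ (polySub f)} (h : LargeDegree f μ) :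
    LieModule.IsIrreducible ℂ Vir (VPoly f μ) := by
  obtain ⟨ν, p, hsum, hν, hp⟩ := h
  choose N hN using fun r => exists_linear (ν r)
  refine isIrreducible_of_descends (fun r => f.rootMultiplicity r) ν N hN f.roots.toFinset
    (fun r hr => ?_) f (eq_prod_roots hf) μ fun v => ?_
  · have h0 := ne_zero_of_mem_roots hf0 hr
    refine descends_root h0 ?_ (hp r hr).1 (hp r hr).2 (form_eq_expForm h0 (hν r hr))
    rw [Multiset.mem_toFinset, Polynomial.mem_roots'] at hr
    exact (Polynomial.rootMultiplicity_pos hr.1).mpr hr.2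
  · rw [hsum]
    exact Finset.sum_congr rfl fun r _ => (hN r v _).symm

/-- A linear form vanishing on the multiples of a product of powers of linear factors is a sum of
linear forms vanishing on the multiples of these powers. -/
theorem exists_eq_sum_forms (n : ℂ → ℕ) (S : Finset ℂ) : ∀ ξ : ℂ[T;T⁻¹] →ₗ[ℂ] ℂ,
    (∀ w, ξ (toLaurent (∏ r ∈ S, (X - Polynomial.C r) ^ n r) * w) = 0) →
    ∃ η : ℂ → ℂ[T;T⁻¹] →ₗ[ℂ] ℂ, (∀ r ∈ S, ∀ w, η r (lin r ^ n r * w) = 0) ∧ ξ = ∑ r ∈ S, η r := by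
  induction S using Finset.induction_on with
  | empty =>
    intro ξ hξ
    refine ⟨0, by simp, LinearMap.ext fun w => ?_⟩
    simpa using hξ w
  | insert a S ha ih =>
    intro ξ hξ
    obtain ⟨u, v, huv⟩ := (coprime_prod_roots ha n).map (toLaurent : ℂ[X] →+* ℂ[T;T⁻¹])
    rw [Finset.prod_insert ha] at hξ
    simp only [map_mul] at hξ
    change u * toLaurent ((X - Polynomial.C a) ^ n a) + v * toLaurent (∏ r ∈ S, _) = 1 at huv
    rw [map_pow] at huv hξ
    obtain ⟨η, hη, hsum⟩ := ih (ξ.comp (LinearMap.mulLeft ℂ (u * lin a ^ n a))) (fun w => by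
      have := hξ (u * w)
      rw [← this, LinearMap.comp_apply, LinearMap.mulLeft_apply]
      congr 1
      ring)
    refine ⟨Function.update η a
      (ξ.comp (LinearMap.mulLeft ℂ (v * toLaurent (∏ r ∈ S, (X - Polynomial.C r) ^ n r)))),
      fun r hr w => ?_, ?_⟩
    · by_cases hra : r = a
      · subst hra
        have := hξ (v * w)
        rw [Function.update_self, ← this, LinearMap.comp_apply, LinearMap.mulLeft_apply]
        congr 1
        ring
      · rw [Function.update_of_ne hra]
        exact hη r ((Finset.mem_insert.mp hr).resolve_left hra) w
    · have hupd : ∀ ζ, ∀ r ∈ S, Function.update η a ζ r = η r := fun ζ r hr =>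
        Function.update_of_ne (by rintro rfl; exact ha hr) _ _
      rw [Finset.sum_insert ha, Function.update_self, Finset.sum_congr rfl (hupd _), ← hsum]
      refine LinearMap.ext fun w => ?_
      simp only [LinearMap.add_apply, LinearMap.comp_apply, LinearMap.mulLeft_apply]
      rw [← map_add, ← add_mul, add_comm (v * _), huv, one_mul]

theorem exists_eq_sum_forms_roots (hf : f.Monic) (ξ : ℂ[T;T⁻¹] →ₗ[ℂ] ℂ)
    (hξ : ∀ w, ξ (w * toLaurent f) = 0) : ∃ η : ℂ → ℂ[T;T⁻¹] →ₗ[ℂ] ℂ,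
      (∀ r ∈ f.roots.toFinset, ∀ w, η r (lin r ^ f.rootMultiplicity r * w) = 0) ∧
      ξ = ∑ r ∈ f.roots.toFinset, η r :=
  exists_eq_sum_forms (fun r => f.rootMultiplicity r) f.roots.toFinset ξ fun w => by
    rw [← eq_prod_roots hf, mul_comm, hξ]

/-- Splitting the form over the roots yields a candidate decomposition into characters `νr`. If all
of them had large degree, so would `ν`; hence at some root the polynomial is zero or too short, and
the form vanishes two orders earlier than forced. -/
theorem exists_forall_form_eq_zero_of_not_largeDegree (hf : f.Monic) (hf0 : f.coeff 0 ≠ 0)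
    (ν : LieCharacter ℂ (polySub f)) (hν : ¬ LargeDegree f ν) :
    ∃ (r : ℂ) (n : ℕ) (g : ℂ[X]), 1 ≤ n ∧ f = (X - Polynomial.C r) ^ n * g ∧
      IsCoprime (lin r) (toLaurent g) ∧
      ∀ w, form ν (lin r ^ (n - 2) * toLaurent g * w) = 0 := by
  obtain ⟨η, hη, hsum⟩ := exists_eq_sum_forms_roots hf (form ν) (form_mul hf ν)
  choose g hg hgr using fun r => Polynomial.exists_eq_pow_rootMultiplicity_mul_and_not_dvd f
    hf.ne_zero r
  have hcop : ∀ r k, IsCoprime (lin r ^ k) (toLaurent (g r)) := fun r k => by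
    have := ((Polynomial.irreducible_X_sub_C r).coprime_iff_not_dvd.mpr (hgr r)).map
      (toLaurent : ℂ[X] →+* ℂ[T;T⁻¹])
    exact this.pow_left
  have hex : ∀ r, ∃ (νr : LieCharacter ℂ (polySub ((X - Polynomial.C r) ^ f.rootMultiplicity r)))
      (p : ℂ[X]), r ∈ f.roots.toFinset → (∀ w, form νr (w * toLaurent (g r)) = η r w) ∧
        (∀ j : ℤ, form νr (T j) = p.eval (j : ℂ) * r ^ j) ∧
        (¬(p ≠ 0 ∧ f.rootMultiplicity r ≤ p.natDegree + 2) →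
          ∀ w, form νr (lin r ^ (f.rootMultiplicity r - 2) * w) = 0) := by
    intro r
    by_cases hr : r ∈ f.roots.toFinset
    · have h0 := ne_zero_of_mem_roots hf0 hr
      -- Restricting a character from `Vir^((t-r)^n)` to `Vir^f` multiplies the argument of its form
      -- by `g r`. To undo this, `η r` is twisted by `v`, the inverse of `g r` modulo `(t - r)^n`.
      obtain ⟨u, v, huv⟩ := hcop r (f.rootMultiplicity r)
      have hkill : ∀ w, ((η r).comp (LinearMap.mulLeft ℂ v))
          (lin r ^ f.rootMultiplicity r * w) = 0 := fun w => by
        rw [LinearMap.comp_apply, LinearMap.mulLeft_apply, mul_left_comm, hη r hr]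
      obtain ⟨νr, hνr⟩ := exists_char ((monic_X_sub_C r).pow (f.rootMultiplicity r))
        ((η r).comp (LinearMap.mulLeft ℂ v)) (fun w => by rw [map_pow, mul_comm, hkill])
      obtain ⟨p, hp, hpe⟩ := exists_expForm h0 _ _ hkill
      refine ⟨νr, p, fun _ => ⟨fun w => ?_, fun j => by rw [hνr, hpe, expForm_T], fun hnot w => ?_⟩⟩
      · rw [hνr, LinearMap.comp_apply, LinearMap.mulLeft_apply]
        have : v * (w * toLaurent (g r)) = w - lin r ^ f.rootMultiplicity r * (u * w) := by
          linear_combination w * huv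
        rw [this, map_sub, hη r hr, sub_zero]
      · rw [hνr, hpe]
        -- For multiplicity at most two the degree bound is automatic, so failure means `p = 0`; the
        -- truncated subtraction is then harmless.
        by_cases hp0 : p = 0
        · rw [hp0]
          simp [expForm_apply]
        · refine expForm_of_lt h0 ?_ w
          rw [Polynomial.degree_eq_natDegree hp0]
          norm_cast
          have : ¬ f.rootMultiplicity r ≤ p.natDegree + 2 := fun h => hnot ⟨hp0, h⟩
          omega
    · exact ⟨0, 0, fun h => absurd h hr⟩
  choose νr p hνp using hex
  obtain ⟨r, hr, hnot⟩ : ∃ r ∈ f.roots.toFinset,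
      ¬(p r ≠ 0 ∧ f.rootMultiplicity r ≤ (p r).natDegree + 2) := by
    by_contra! hall
    refine hν ⟨νr, p, fun v => ?_, fun r hr j => ?_, fun r hr => hall r hr⟩
    · obtain ⟨w, hw⟩ := mem_polySub_iff.mp v.2
      rw [char_eq_form hf ν v hw, hsum, LinearMap.sum_apply]
      refine Finset.sum_congr rfl fun r hr => ?_
      rw [char_eq_form ((monic_X_sub_C r).pow (f.rootMultiplicity r)) (νr r) _
        (w := w * toLaurent (g r)), (hνp r hr).1]
      change (v : Vir).poly = _
      conv_lhs => rw [hw, hg r]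
      rw [map_mul]
      ring
    · rw [← form_T, (hνp r hr).2.1]
  have hmult : 1 ≤ f.rootMultiplicity r := by
    rw [Multiset.mem_toFinset, Polynomial.mem_roots'] at hr
    exact (Polynomial.rootMultiplicity_pos hr.1).mpr hr.2
  refine ⟨r, f.rootMultiplicity r, g r, hmult, hg r, by simpa using hcop r 1, fun w => ?_⟩
  · rw [hsum, LinearMap.sum_apply]
    refine Finset.sum_eq_zero fun s hs => ?_
    by_cases hsr : s = r
    · subst hsr
      rw [← (hνp s hs).1, mul_assoc, mul_assoc]
      exact (hνp s hs).2.2 hnot _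
    · have hdvd : (X - Polynomial.C s) ^ f.rootMultiplicity s ∣ g r := by
        have h1 : (X - Polynomial.C s) ^ f.rootMultiplicity s ∣
            (X - Polynomial.C r) ^ f.rootMultiplicity r * g r := by
          rw [← hg r]
          exact pow_rootMultiplicity_dvd f s
        refine IsCoprime.dvd_of_dvd_mul_left (IsCoprime.pow ?_) h1
        exact Polynomial.isCoprime_X_sub_C_of_isUnit_sub (sub_ne_zero.mpr hsr).isUnit
      obtain ⟨q, hq⟩ := hdvd
      have h3 : toLaurent (g r) = lin s ^ f.rootMultiplicity s * toLaurent q := by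
        rw [hq, map_mul, map_pow]
      have h4 : lin r ^ (f.rootMultiplicity r - 2) * toLaurent (g r) * w
          = lin s ^ f.rootMultiplicity s * (lin r ^ (f.rootMultiplicity r - 2) * toLaurent q * w) := by
        rw [h3]
        ring
      rw [h4, hη s hs]

/-- A character of `Vir^f` which is not of large degree extends to `Vir^G` for a proper divisor
`G` of `f`. -/
theorem exists_extension_of_not_largeDegree (hf : f.Monic) (hf0 : f.coeff 0 ≠ 0)
    (ν : LieCharacter ℂ (polySub f)) (hν : ¬ LargeDegree f ν) :
    ∃ (r : ℂ) (G : ℂ[X]) (ν' : LieCharacter ℂ (polySub G)), f = (X - Polynomial.C r) * G ∧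
      ∀ v (h : v ∈ polySub f) (h' : v ∈ polySub G), ν' ⟨v, h'⟩ = ν ⟨v, h⟩ := by
  obtain ⟨r, n, g, hn, hg, hcop, hkill⟩ :=
    exists_forall_form_eq_zero_of_not_largeDegree hf hf0 ν hν
  let G : ℂ[X] := (X - Polynomial.C r) ^ (n - 1) * g
  have hfG : f = (X - Polynomial.C r) * G := by
    conv_lhs => rw [hg]
    change _ = (X - Polynomial.C r) * ((X - Polynomial.C r) ^ (n - 1) * g)
    rw [← mul_assoc, ← pow_succ', Nat.sub_add_cancel hn]
  have hGmonic : G.Monic := (monic_X_sub_C r).of_mul_monic_left (hfG ▸ hf)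
  have hlin0 : lin r ≠ 0 := toLaurent_ne_zero.mpr (monic_X_sub_C r).ne_zero
  -- The form of the extension must agree with that of `ν` after division by `t - r`, and must kill
  -- multiples of `G`. The two prescriptions are compatible because `form ν` vanishes on multiples
  -- of `(t - r)^(n-2) g`.
  obtain ⟨ξ, hξ1, hξ2⟩ := exists_comp_eq_comp_eq (LinearMap.mulLeft ℂ (lin r))
    (LinearMap.mulLeft ℂ (toLaurent G)) (form ν) 0 (fun w₁ w₂ h => by
      rw [LinearMap.mulLeft_apply, LinearMap.mulLeft_apply, map_mul, map_pow] at h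
      have hdvd : lin r ^ (n - 2) * toLaurent (g) ∣ w₁ := by
        -- For `n = 1` there is no factor `t - r` left in `G` to cancel, and coprimality of `g` with
        -- `t - r` is used instead.
        by_cases hn1 : n = 1
        · rw [show n - 1 = 0 by omega, pow_zero, one_mul] at h
          rw [show n - 2 = 0 by omega, pow_zero, one_mul]
          exact hcop.symm.dvd_of_dvd_mul_left ⟨w₂, h⟩
        · refine ⟨w₂, mul_left_cancel₀ hlin0 ?_⟩
          rw [h, show n - 1 = n - 2 + 1 by omega]
          ring
      obtain ⟨w, rfl⟩ := hdvd
      exact hkill w)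
  obtain ⟨ν', hν'⟩ := exists_char hGmonic ξ (fun w => by
    rw [mul_comm]
    exact hξ2 w)
  refine ⟨r, G, ν', hfG, fun v h h' => ?_⟩
  obtain ⟨w, hw⟩ := mem_polySub_iff.mp h
  rw [char_eq_form hf ν ⟨v, h⟩ hw, char_eq_form hGmonic ν' ⟨v, h'⟩ (w := lin r * w), hν']
  · exact hξ1 w
  · change v.poly = _
    rw [hw, hfG, map_mul]
    ring

end Roots

end VirasoroInduced

end

noncomputable section

namespace VirasoroInduced

/-! ### The characters attached to a character of a restricted polynomial subalgebra -/

section Attached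

variable {f : ℂ[X]} {m : ℕ}

theorem lowOrder_toLaurent (f : ℂ[X]) : LowOrder 0 (toLaurent f) :=
  lowOrder_iff.mpr ⟨f, by rw [T_zero, one_mul]⟩

theorem LowOrder.mul_toLaurent {l : ℤ} {w : ℂ[T;T⁻¹]} (h : LowOrder l w) (f : ℂ[X]) :
    LowOrder l (w * toLaurent f) := by
  simpa using h.mul (lowOrder_toLaurent f)

theorem xf_mem_lowFiltration (f : ℂ[X]) (j : ℤ) : xf f j ∈ lowFiltration j := by
  rw [← ofPoly_T_mul]
  exact ⟨(lowOrder_T le_rfl).mul_toLaurent f, fun _ => rfl⟩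

theorem T_mul_toLaurent (f : ℂ[X]) (j : ℤ) : T j * toLaurent f
    = ∑ i ∈ Finset.range (f.natDegree + 1), f.coeff i • (T (j + i) : ℂ[T;T⁻¹]) := by
  rw [← theta_x, xf, map_sum]
  rfl

/-- The vectors of `𝔟_m` bracket into the span of the `e_j`, `j ≥ 2m + 1`. -/
theorem lie_bSub_mem {a b : Vir} (ha : a ∈ bSub m) (hb : b ∈ bSub m) :
    ⁅a, b⁆ ∈ eSub (2 * m + 1) := by
  change a ∈ Submodule.span ℂ _ at ha
  change b ∈ Submodule.span ℂ _ at hb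
  induction ha, hb using Submodule.span_induction₂ with
  | mem_mem a b ha hb =>
    obtain rfl | ⟨j, hj, rfl⟩ := ha
    · rw [lie_z]; exact (eSub _).zero_mem
    obtain rfl | ⟨k, hk, rfl⟩ := hb
    · rw [lie_z']; exact (eSub _).zero_mem
    by_cases h : k = j
    · rw [h, lie_self]; exact (eSub _).zero_mem
    · rw [lie_e_e, if_neg (by omega), zero_smul, add_zero]
      exact (eSub _).smul_mem _ (e_mem_eSub (by push_cast; omega))
  | zero_left y hy => rw [zero_lie]; exact (eSub _).zero_mem
  | zero_right y hy => rw [lie_zero]; exact (eSub _).zero_mem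
  | add_left a b c _ _ _ h₁ h₂ => rw [add_lie]; exact (eSub _).add_mem h₁ h₂
  | add_right a b c _ _ _ h₁ h₂ => rw [lie_add]; exact (eSub _).add_mem h₁ h₂
  | smul_left r a b _ _ h₁ => rw [smul_lie]; exact (eSub _).smul_mem _ h₁
  | smul_right r a b _ _ h₁ => rw [lie_smul]; exact (eSub _).smul_mem _ h₁

/-- The relations satisfied by a character of `𝔟_m^f`. -/
theorem apply_mul_sq_eq_zero (hm : 1 ≤ m) {μ : LieCharacter ℂ (bPolySub f m)} {φ : Vir →ₗ[ℂ] ℂ}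
    (hφ : ∀ v (h : v ∈ bPolySub f m), φ v = μ ⟨v, h⟩) {w : ℂ[T;T⁻¹]}
    (hw : LowOrder (2 * m + 1) w) : φ (ofPoly (w * toLaurent f * toLaurent f)) = 0 := by
  refine hw.mem (LinearMap.ker (φ.comp (ofPoly.comp ((LinearMap.mulRight ℂ (toLaurent f)).comp
    (LinearMap.mulRight ℂ (toLaurent f)))))) fun j hj => ?_
  change φ (ofPoly (T j * toLaurent f * toLaurent f)) = 0
  -- The bracket of `x_m` and `x_(j-m)` is `(j - 2m) t^j f^2`: the factor is nonzero from `j = 2m +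
  -- 1` on, and positive indices exclude a central term.
  have h1 := linear_lie hφ (x_mem_bPolySub f (le_refl (m : ℤ)))
    (x_mem_bPolySub f (show (m : ℤ) ≤ j - m by omega))
  have h2 : ⁅xf f m, xf f (j - m)⁆ = (((j - m : ℤ) : ℂ) - ((m : ℤ) : ℂ)) •
      ofPoly (T j * toLaurent f * toLaurent f) := by
    apply Vir.ext'
    · change theta (xf f m) * euler (theta (xf f (j - m)))
        - euler (theta (xf f m)) * theta (xf f (j - m)) = _ • (T j * toLaurent f * toLaurent f)
      have hT : (T j : ℂ[T;T⁻¹]) = T m * T (j - m) := by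
        rw [← T_add]
        congr 1
        ring
      rw [theta_x, theta_x, euler_mul, euler_mul, euler_T, euler_T, hT]
      simp only [LaurentPolynomial.smul_eq_C_mul, map_sub]
      ring
    · rw [(lie_mem_lowFiltration (xf_mem_lowFiltration f _) (xf_mem_lowFiltration f _)).2
        (by omega)]
      simp
  rw [h2, map_smul, smul_eq_mul] at h1
  refine (mul_eq_zero.mp h1).resolve_left (sub_ne_zero.mpr ?_)
  norm_cast
  omega

/-- On `t^(2m+1) ℂ[t]` the form `w ↦ φ(f w)` already kills the multiples of `f`, so it glues with
zero on the ideal generated by `f`. -/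
theorem exists_form_restrict (hf0 : f.coeff 0 ≠ 0) (hm : 1 ≤ m)
    {μ : LieCharacter ℂ (bPolySub f m)} {φ : Vir →ₗ[ℂ] ℂ}
    (hφ : ∀ v (h : v ∈ bPolySub f m), φ v = μ ⟨v, h⟩) :
    ∃ ξ : ℂ[T;T⁻¹] →ₗ[ℂ] ℂ, (∀ w, ξ (w * toLaurent f) = 0) ∧
      ∀ w, LowOrder (2 * m + 1) w → ξ w = φ (ofPoly (w * toLaurent f)) := by
  obtain ⟨ξ, h1, h2⟩ := exists_comp_eq_comp_eq (lowOrderSub (2 * m + 1)).subtype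
    (LinearMap.mulRight ℂ (toLaurent f)) ((φ.comp (ofPoly.comp
      (LinearMap.mulRight ℂ (toLaurent f)))).comp (lowOrderSub (2 * m + 1)).subtype) 0
    (fun w₁ w₂ h => by
      change (w₁ : ℂ[T;T⁻¹]) = w₂ * toLaurent f at h
      change φ (ofPoly (w₁ * toLaurent f)) = 0
      rw [h]
      refine apply_mul_sq_eq_zero hm hφ ?_
      have := w₁.2
      rw [h] at this
      exact_mod_cast lowOrder_of_mul (m := 2 * m + 1) hf0 (by exact_mod_cast this))
  exact ⟨ξ, h2, fun w hw => h1 ⟨w, hw⟩⟩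

theorem exists_isDDot (hf : f.Monic) (hf0 : f.coeff 0 ≠ 0) (hm : 1 ≤ m)
    (μ : LieCharacter ℂ (bPolySub f m)) : ∃ μdd, IsDDot μ μdd := by
  obtain ⟨φ, hφ⟩ := exists_linear μ
  obtain ⟨ξ, hξ, hξφ⟩ := exists_form_restrict hf0 hm hφ
  obtain ⟨ν, hν⟩ := exists_char hf ξ hξ
  obtain ⟨η, hη, hsum⟩ := exists_eq_sum_forms_roots hf ξ hξ
  have hq : ∀ r, ∃ q : ℂ[X], r ∈ f.roots.toFinset → q.degree < f.rootMultiplicity r ∧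
      ∀ j : ℤ, η r (T j) = q.eval (j : ℂ) * r ^ j := by
    intro r
    by_cases hr : r ∈ f.roots.toFinset
    · have h0 := ne_zero_of_mem_roots hf0 hr
      obtain ⟨q, hq, he⟩ := exists_expForm h0 _ _ (hη r hr)
      exact ⟨q, fun _ => ⟨hq, fun j => by rw [he, expForm_T]⟩⟩
    · exact ⟨0, fun h => absurd h hr⟩
  choose q hq using hq
  have hξT : ∀ j : ℤ, ξ (T j) = ∑ r ∈ f.roots.toFinset, (q r).eval (j : ℂ) * r ^ j := fun j => by
    rw [hsum, LinearMap.sum_apply]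
    exact Finset.sum_congr rfl fun r hr => (hq r hr).2 j
  refine ⟨ν, ⟨q, fun r hr => (hq r hr).1, fun j hj => ?_, fun j => ?_⟩, char_z hf ν⟩
  · rw [← hξT, hξφ _ (lowOrder_T hj), ofPoly_T_mul, hφ _ (x_mem_bPolySub f (by omega))]
    rfl
  · rw [← form_T, hν, hξT]

theorem IsDDot.val_eq {μ : LieCharacter ℂ (bPolySub f m)} {μdd : LieCharacter ℂ (polySub f)}
    (h : IsDDot μ μdd) (j : ℤ) (hj : 2 * (m : ℤ) + 1 ≤ j) :
    val μ j (by omega) = polyVal μdd j := by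
  obtain ⟨⟨q, -, h1, h2⟩, -⟩ := h
  rw [h1 j hj, h2]

/-- Every Laurent polynomial is congruent modulo `f` to one of order at least `2m + 1`, where the
form is prescribed by `μ`. -/
theorem IsDDot.unique (hf : f.Monic) (hf0 : f.coeff 0 ≠ 0) {μ : LieCharacter ℂ (bPolySub f m)}
    {ν ν' : LieCharacter ℂ (polySub f)} (h : IsDDot μ ν) (h' : IsDDot μ ν') : ν = ν' := by
  refine char_ext hf (LinearMap.ext fun w => ?_)
  obtain ⟨y, hy, hy'⟩ := (separating_polySub_eSub hf0).exists_sub_mem (2 * m + 1) (ofPoly w)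
  obtain ⟨u, hu⟩ := mem_polySub_iff.mp (polySub_le_of_dvd (dvd_pow_self f (Nat.succ_ne_zero _)) hy')
  have hw : w = y.poly + u * toLaurent f := by
    rw [← hu]
    simp
  rw [hw, map_add, map_add, form_mul hf, form_mul hf]
  congr 1
  refine (eSub_eq hy).1.mem (LinearMap.eqLocus (form ν) (form ν')) fun j hj => ?_
  rw [LinearMap.mem_eqLocus, form_T, form_T, ← h.val_eq j (by exact_mod_cast hj),
    ← h'.val_eq j (by exact_mod_cast hj)]

theorem linear_xf (φ : Vir →ₗ[ℂ] ℂ) (f : ℂ[X]) (j : ℤ) :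
    φ (xf f j) = ∑ i ∈ Finset.range (f.natDegree + 1), f.coeff i * φ (e (j + i)) := by
  rw [xf, map_sum]
  exact Finset.sum_congr rfl fun i _ => map_smul φ _ _

/-- The form is zero from `t^(2m+1)` on and is given by `μ - μ̈` on `f t^m ℂ[t]`; these agree on the
overlap because `μ` and `μ̈` coincide from index `2m + 1`. It is a character since brackets of `𝔟_m`
only reach indices from `2m + 1` on. -/
theorem exists_isHat (hf0 : f.coeff 0 ≠ 0) {μ : LieCharacter ℂ (bPolySub f m)}
    {μdd : LieCharacter ℂ (polySub f)} (h : IsDDot μ μdd) : ∃ μh, IsHat μ μdd μh := by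
  obtain ⟨φ, hφ⟩ := exists_linear μ
  have hφT : ∀ (j : ℤ) (hj : (m : ℤ) ≤ j), φ (ofPoly (T j * toLaurent f)) = val μ j hj :=
    fun j hj => by
      rw [ofPoly_T_mul, hφ _ (x_mem_bPolySub f hj)]
      rfl
  obtain ⟨η, h1, h2⟩ := exists_comp_eq_comp_eq (lowOrderSub (2 * m + 1)).subtype
    ((LinearMap.mulRight ℂ (toLaurent f)).comp (lowOrderSub m).subtype) 0
    ((φ.comp (ofPoly.comp (LinearMap.mulRight ℂ (toLaurent f))) - form μdd).comp
      (lowOrderSub m).subtype) (fun w₁ w₂ hw => by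
      change (w₁ : ℂ[T;T⁻¹]) = w₂ * toLaurent f at hw
      have hlow := w₁.2
      rw [hw] at hlow
      have hlow2 : LowOrder (2 * m + 1) (w₂ : ℂ[T;T⁻¹]) := by
        exact_mod_cast lowOrder_of_mul (m := 2 * m + 1) hf0 (by exact_mod_cast hlow)
      refine Eq.symm (hlow2.mem (LinearMap.ker
        (φ.comp (ofPoly.comp (LinearMap.mulRight ℂ (toLaurent f))) - form μdd)) fun j hj => ?_)
      change φ (ofPoly (T j * toLaurent f)) - form μdd (T j) = 0
      rw [hφT j (by omega), h.val_eq j hj, form_T, sub_self])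
  have he : ∀ j : ℤ, 2 * (m : ℤ) + 1 ≤ j → η (T j) = 0 := fun j hj => h1 ⟨T j, lowOrder_T hj⟩
  let Φ : Vir →ₗ[ℂ] ℂ := η.comp theta + μ ⟨z, z_mem_bPolySub f m⟩ • central
  have hΦe : ∀ j, Φ (e j) = η (T j) := fun j => by
    change η (T j) + μ ⟨z, z_mem_bPolySub f m⟩ • (e j).cen = _
    rw [e_cen, smul_zero, add_zero]
  have hΦ : ∀ a ∈ bSub m, ∀ b ∈ bSub m, Φ ⁅a, b⁆ = 0 := fun a ha b hb =>
    eSub_le (P := LinearMap.ker Φ) (fun j hj => (hΦe j).trans (he j (by exact_mod_cast hj)))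
      (lie_bSub_mem ha hb)
  refine ⟨charOf _ Φ hΦ, ?_, fun j hj => (hΦe j).trans (he j hj), fun j hj hj' => ?_⟩
  · change η 0 + μ ⟨z, z_mem_bPolySub f m⟩ • (1 : ℂ) = _
    rw [map_zero, zero_add, smul_eq_mul, mul_one]
  · change ∑ i ∈ Finset.range (f.natDegree + 1), f.coeff i * Φ (e (j + i)) = _
    rw [← linear_xf, ← ofPoly_T_mul]
    change η (T j * toLaurent f) + μ ⟨z, z_mem_bPolySub f m⟩ • (0 : ℂ) = _
    rw [smul_zero, add_zero]
    refine (h2 ⟨T j, lowOrder_T hj⟩).trans ?_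
    change φ (ofPoly (T j * toLaurent f)) - form μdd (T j) = _
    rw [hφT j hj, form_T]

/-- Descending induction on the index: once the higher values vanish, `φ(x_j)` reduces to `a_0
φ(e_j)`. -/
theorem linear_eq_zero_of_xf (hf0 : f.coeff 0 ≠ 0) {φ : Vir →ₗ[ℂ] ℂ}
    (h1 : ∀ j : ℤ, 2 * (m : ℤ) + 1 ≤ j → φ (e j) = 0)
    (h2 : ∀ j : ℤ, (m : ℤ) ≤ j → j ≤ 2 * m → φ (xf f j) = 0) (k : ℕ) :
    ∀ j : ℤ, (m : ℤ) ≤ j → 2 * (m : ℤ) + 1 - k ≤ j → φ (e j) = 0 := by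
  induction k with
  | zero => exact fun j _ hj => h1 j (by omega)
  | succ k ih =>
    intro j hj hjk
    by_cases hjk' : 2 * (m : ℤ) + 1 - k ≤ j
    · exact ih j hj hjk'
    · have := h2 j hj (by omega)
      rw [linear_xf, Finset.sum_range_succ', Finset.sum_eq_zero, zero_add] at this
      · simpa [hf0] using this
      · intro i _
        rw [ih _ (by omega) (by push_cast; omega), mul_zero]

theorem IsHat.unique (hf0 : f.coeff 0 ≠ 0) {μ : LieCharacter ℂ (bPolySub f m)}
    {μdd : LieCharacter ℂ (polySub f)} {ψ ψ' : LieCharacter ℂ (bSub m)}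
    (h : IsHat μ μdd ψ) (h' : IsHat μ μdd ψ') : ψ = ψ' := by
  obtain ⟨φ, hφ⟩ := exists_linear ψ
  obtain ⟨φ', hφ'⟩ := exists_linear ψ'
  have hxf : ∀ (χ : LieCharacter ℂ (bSub m)) (θ : Vir →ₗ[ℂ] ℂ), IsHat μ μdd χ →
      (∀ v h, θ v = χ ⟨v, h⟩) → ∀ j (hj : (m : ℤ) ≤ j), j ≤ 2 * m →
        θ (xf f j) = val μ j hj - polyVal μdd j := by
    intro χ θ hχ hθ j hj hj'
    rw [linear_xf, ← hχ.2.2 j hj hj']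
    exact Finset.sum_congr rfl fun i _ => by rw [hθ _ (e_mem_bSub (by omega))]
  have h0 := linear_eq_zero_of_xf (m := m) hf0 (φ := φ - φ') (fun j hj => by
      rw [LinearMap.sub_apply, hφ _ (e_mem_bSub (by omega)), hφ' _ (e_mem_bSub (by omega)),
        h.2.1 j hj, h'.2.1 j hj, sub_self])
    (fun j hj hj' => by
      rw [LinearMap.sub_apply, hxf ψ φ h hφ j hj hj', hxf ψ' φ' h' hφ' j hj hj', sub_self])
    (2 * m + 1)
  refine DFunLike.ext _ _ fun v => ?_
  rw [← hφ v v.2, ← hφ' v v.2, ← sub_eq_zero, ← LinearMap.sub_apply]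
  have hle : (bSub m).toSubmodule ≤ LinearMap.ker (φ - φ') := by
    refine Submodule.span_le.mpr ?_
    rintro _ (rfl | ⟨j, hj, rfl⟩)
    · change (φ - φ') z = 0
      rw [LinearMap.sub_apply, hφ _ (z_mem_bSub m), hφ' _ (z_mem_bSub m), h.1, h'.1, sub_self]
    · exact h0 j hj (by push_cast; omega)
  exact hle v.2

theorem existsUnique_attached (hf : f.Monic) (hf0 : f.coeff 0 ≠ 0) (hm : 1 ≤ m)
    (μ : LieCharacter ℂ (bPolySub f m)) :
    ∃! d : LieCharacter ℂ (polySub f) × LieCharacter ℂ (bSub m),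
      IsDDot μ d.1 ∧ IsHat μ d.1 d.2 := by
  obtain ⟨ν, hν⟩ := exists_isDDot hf hf0 hm μ
  obtain ⟨ψ, hψ⟩ := exists_isHat hf0 hν
  refine ⟨(ν, ψ), ⟨hν, hψ⟩, ?_⟩
  rintro ⟨ν', ψ'⟩ ⟨hν', hψ'⟩
  obtain rfl := IsDDot.unique hf hf0 hν hν'
  exact Prod.ext rfl (IsHat.unique hf0 hψ' hψ)

end Attached

end VirasoroInduced

end

noncomputable section

namespace VirasoroInduced

/-! ### The main theorem -/

section Main

variable {f : ℂ[X]} {m : ℕ} {μ : LieCharacter ℂ (bPolySub f m)} {μdd : LieCharacter ℂ (polySub f)}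
  {μh : LieCharacter ℂ (bSub m)}

theorem IsHat.apply_xf (hdd : IsDDot μ μdd) (hh : IsHat μ μdd μh) {φ : Vir →ₗ[ℂ] ℂ}
    (hφ : ∀ v (h : v ∈ bSub m), φ v = μh ⟨v, h⟩) (j : ℤ) (hj : (m : ℤ) ≤ j) :
    val μ j hj = polyVal μdd j + φ (xf f j) := by
  have h1 : φ (xf f j) = ∑ i ∈ Finset.range (f.natDegree + 1),
      f.coeff i * μh ⟨e (j + i), e_mem_bSub (by omega)⟩ := by
    rw [linear_xf]
    exact Finset.sum_congr rfl fun i _ => by rw [hφ _ (e_mem_bSub (by omega))]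
  rw [h1]
  by_cases hj' : j ≤ 2 * (m : ℤ)
  · rw [hh.2.2 j hj hj', add_sub_cancel]
  · rw [hdd.val_eq j (by omega), Finset.sum_eq_zero, add_zero]
    intro i _
    rw [hh.2.1 _ (by omega), mul_zero]

theorem IsHat.eq_add (hdd : IsDDot μ μdd) (hh : IsHat μ μdd μh) (a : Vir) (h : a ∈ bPolySub f m)
    (h₁ : a ∈ polySub f) (h₂ : a ∈ bSub m) : μ ⟨a, h⟩ = μdd ⟨a, h₁⟩ + μh ⟨a, h₂⟩ := by
  obtain ⟨φ, hφ⟩ := exists_linear μ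
  obtain ⟨φ₁, hφ₁⟩ := exists_linear μdd
  obtain ⟨φ₂, hφ₂⟩ := exists_linear μh
  have hle : (bPolySub f m).toSubmodule ≤ LinearMap.eqLocus φ (φ₁ + φ₂) := by
    refine Submodule.span_le.mpr ?_
    rintro _ (rfl | ⟨j, hj, rfl⟩)
    · change φ z = φ₁ z + φ₂ z
      rw [hφ _ (z_mem_bPolySub f m), hφ₁ _ (z_mem_polySub f), hφ₂ _ (z_mem_bSub m), hdd.2, hh.1,
        zero_add]
    · change φ (xf f j) = φ₁ (xf f j) + φ₂ (xf f j)
      rw [hφ _ (x_mem_bPolySub f hj), hφ₁ _ (x_mem_polySub f j)]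
      exact hh.apply_xf hdd hφ₂ j hj
  have : φ a = φ₁ a + φ₂ a := hle h
  rwa [hφ a h, hφ₁ a h₁, hφ₂ a h₂] at this

theorem adapted_attached (hf : f.Monic) (hf0 : f.coeff 0 ≠ 0) (hdd : IsDDot μ μdd)
    (hh : IsHat μ μdd μh) : Adapted (fun k : ℕ => polySub (f ^ k)) eSub μdd μh μ where
  separating := separating_polySub_eSub hf0
  left := ⟨2, fun v hv => char_eq_zero_of_mem_sq hf μdd hv⟩
  right := ⟨2 * m + 1, fun v hv => by
    have hv' : v ∈ bSub m := eSub_le_bSub (by omega) hv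
    refine ⟨hv', ?_⟩
    obtain ⟨φ, hφ⟩ := exists_linear μh
    rw [← hφ v hv']
    refine eSub_le (P := LinearMap.ker φ) (fun j hj => ?_) hv
    rw [LinearMap.mem_ker, hφ _ (e_mem_bSub (by omega))]
    exact hh.2.1 j (by exact_mod_cast hj)⟩
  mem_iff v := mem_bPolySub_iff hf0
  eq_add := hh.eq_add hdd

/-- The two scalars of the simplicity criterion in terms of the Whittaker character. -/
theorem IsHat.sum_eq (hf : f.Monic) (hdd : IsDDot μ μdd) (hh : IsHat μ μdd μh) {φ : Vir →ₗ[ℂ] ℂ}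
    (hφ : ∀ v (h : v ∈ bSub m), φ v = μh ⟨v, h⟩) (n : ℤ) (hn : (m : ℤ) ≤ n) :
    ∑ i ∈ Finset.range (f.natDegree + 1), f.coeff i * val μ (n + i) (by omega)
      = φ (ofPoly (T n * toLaurent (f * f))) := by
  -- The same combination of the values of `μ̈` is its value at `t^n f^2`, hence zero.
  have h1 : ∑ i ∈ Finset.range (f.natDegree + 1), f.coeff i * polyVal μdd (n + i) = 0 := by
    have := form_mul hf μdd (T n)
    rw [T_mul_toLaurent, map_sum] at this
    rw [← this]
    exact Finset.sum_congr rfl fun i _ => by rw [map_smul, form_T, smul_eq_mul]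
  have h2 : ofPoly (T n * toLaurent (f * f))
      = ∑ i ∈ Finset.range (f.natDegree + 1), f.coeff i • xf f (n + i) := by
    rw [map_mul toLaurent, ← mul_assoc, T_mul_toLaurent, Finset.sum_mul, map_sum]
    refine Finset.sum_congr rfl fun i _ => ?_
    rw [smul_mul_assoc, map_smul, ofPoly_T_mul]
  rw [h2, map_sum, ← zero_add (∑ i ∈ _, φ _), ← h1, ← Finset.sum_add_distrib]
  refine Finset.sum_congr rfl fun i _ => ?_
  rw [hh.apply_xf hdd hφ, map_smul, smul_eq_mul, mul_add]

/-- From `n = 2m - 1` on, the terms of `f^2` of degree two or more reach indices at least `2m + 1`,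
where `μ̂` vanishes. -/
theorem IsHat.apply_sq (hh : IsHat μ μdd μh) {φ : Vir →ₗ[ℂ] ℂ}
    (hφ : ∀ v (h : v ∈ bSub m), φ v = μh ⟨v, h⟩) (n : ℤ) (hn : 2 * (m : ℤ) - 1 ≤ n) :
    φ (ofPoly (T n * toLaurent (f * f)))
      = f.coeff 0 ^ 2 * φ (e n) + 2 * f.coeff 0 * f.coeff 1 * φ (e (n + 1)) := by
  obtain ⟨g, hg⟩ : ∃ g : ℂ[X], f * f = Polynomial.C (f.coeff 0 ^ 2)
      + Polynomial.C (2 * f.coeff 0 * f.coeff 1) * X + X ^ 2 * g := by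
    have hf1 := Polynomial.divX_mul_X_add f
    have hf2 := Polynomial.divX_mul_X_add f.divX
    have hc : f.divX.coeff 0 = f.coeff 1 := Polynomial.coeff_divX
    rw [hc] at hf2
    have hf3 : f = Polynomial.C (f.coeff 0) + Polynomial.C (f.coeff 1) * X + X ^ 2 * f.divX.divX := by
      conv_lhs => rw [← hf1, ← hf2]
      ring
    generalize f.coeff 0 = a at *
    generalize f.coeff 1 = b at *
    generalize f.divX.divX = h at *
    refine ⟨Polynomial.C b ^ 2 + 2 * Polynomial.C a * h + 2 * Polynomial.C b * X * h + X ^ 2 * h ^ 2, ?_⟩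
    rw [hf3]
    simp only [map_mul, map_pow, map_ofNat]
    ring
  have h0 : φ (ofPoly (T n * toLaurent (X ^ 2 * g))) = 0 := by
    have hlow : LowOrder (2 * m + 1) (T n * toLaurent (X ^ 2 * g)) := by
      rw [map_mul, toLaurent_X_pow, ← mul_assoc, ← T_add]
      exact (lowOrder_T (by push_cast; omega)).mul_toLaurent g
    refine hlow.mem (LinearMap.ker (φ.comp ofPoly)) fun j hj => ?_
    change φ (e j) = 0
    rw [hφ _ (e_mem_bSub (by omega))]
    exact hh.2.1 j hj
  rw [hg, map_add, map_add, mul_add, mul_add, map_add, map_add, map_add, map_add, h0, add_zero,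
    map_mul toLaurent, toLaurent_C, toLaurent_C, toLaurent_X, mul_left_comm,
    mul_comm (T n) (LaurentPolynomial.C _),
    ← T_add, ← LaurentPolynomial.smul_eq_C_mul, ← LaurentPolynomial.smul_eq_C_mul,
    map_smul, map_smul, map_smul, map_smul, ofPoly_T, ofPoly_T, smul_eq_mul, smul_eq_mul]

/-- The extension of `μ` to `𝔟_{m-1}^f` when `μ̂` vanishes on `e_{2m}` and `e_{2m-1}`. -/
theorem not_isIrreducible_of_whittaker (hf0 : f.coeff 0 ≠ 0) (hm : 1 ≤ m) (hdd : IsDDot μ μdd)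
    (hh : IsHat μ μdd μh) (h1 : μh ⟨e (2 * m), e_mem_bSub (by omega)⟩ = 0)
    (h2 : μh ⟨e (2 * m - 1), e_mem_bSub (by omega)⟩ = 0) :
    ¬ LieModule.IsIrreducible ℂ Vir (VRestricted f m μ) := by
  obtain ⟨k, rfl⟩ : ∃ k, m = k + 1 := ⟨m - 1, by omega⟩
  obtain ⟨φ₁, hφ₁⟩ := exists_linear μdd
  obtain ⟨φ₂, hφ₂⟩ := exists_linear μh
  -- the truncation of `φ₂` below `k + 1`
  let coeff : Vir →ₗ[ℂ] ℂ :=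
    { toFun := fun v => v.poly.coeff k
      map_add' := fun v w => by simp
      map_smul' := fun c v => by simp }
  let η : Vir →ₗ[ℂ] ℂ := φ₂ - φ₂ (e k) • coeff
  have hη : ∀ v, η v = φ₂ v - φ₂ (e k) * v.poly.coeff k := fun v => rfl
  have hηe : ∀ (j : ℤ) (_ : (k : ℤ) + 1 ≤ j), η (e j) = μh ⟨e j, e_mem_bSub (by push_cast; omega)⟩ := by
    intro j hj
    rw [hη, e_poly, T_apply, if_neg (by omega), mul_zero, sub_zero,
      hφ₂ _ (e_mem_bSub (by push_cast; omega))]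
  have hηb : ∀ v (hv : v ∈ bSub (k + 1)), η v = μh ⟨v, hv⟩ := fun v hv => by
    rw [hη, mem_bSub_iff.mp hv k (by push_cast; omega), mul_zero, sub_zero, hφ₂ v hv]
  -- With `m = k + 1` this range starts at `2m - 1`, so the two vanishing hypotheses cover exactly
  -- what the brackets of `𝔟_k` need beyond the definition of `μ̂`.
  have hηbig : ∀ j : ℤ, 2 * (k : ℤ) + 1 ≤ j → η (e j) = 0 := by
    intro j hj
    rw [hηe j (by omega)]
    obtain rfl | rfl | h : j = 2 * ((k + 1 : ℕ) : ℤ) - 1 ∨ j = 2 * ((k + 1 : ℕ) : ℤ) ∨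
        2 * ((k + 1 : ℕ) : ℤ) + 1 ≤ j := by push_cast; omega
    · exact h2
    · exact h1
    · exact hh.2.1 j h
  have hbr : ∀ a ∈ bSub k, ∀ b ∈ bSub k, η ⁅a, b⁆ = 0 := fun a ha b hb =>
    eSub_le (P := LinearMap.ker η) (fun j hj => hηbig j (by exact_mod_cast hj))
      (lie_bSub_mem ha hb)
  have hle : bPolySub f (k + 1) ≤ bPolySub f k := fun v hv => by
    rw [mem_bPolySub_iff hf0, mem_bSub_iff] at hv ⊢
    exact ⟨hv.1, hv.2.mono (by push_cast; omega)⟩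
  refine Ind.not_isIrreducible_of_extension μ hle (charOf (bPolySub f k) (φ₁ + η) fun a ha b hb => ?_)
    (fun v => ?_) fun hle' => ?_
  · rw [mem_bPolySub_iff hf0] at ha hb
    rw [LinearMap.add_apply, linear_lie hφ₁ ha.1 hb.1, hbr a ha.2 b hb.2, add_zero]
  · rw [charOf_apply, LinearMap.add_apply]
    have hv := (mem_bPolySub_iff hf0).mp v.2
    change φ₁ v + η v = _
    rw [hφ₁ _ hv.1, hηb _ hv.2]
    exact (hh.eq_add hdd v v.2 hv.1 hv.2).symm
  · have hx := hle' (x_mem_bPolySub f (le_refl (k : ℤ)))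
    rw [mem_bPolySub_iff hf0, mem_bSub_iff] at hx
    have h3 : LowOrder ((k + 1 : ℕ) : ℤ) (T k * toLaurent f) := by
      rw [← theta_x]
      exact hx.2
    have h4 := lowOrder_of_mul hf0 h3 k (by push_cast; omega)
    rw [T_apply, if_pos rfl] at h4
    exact one_ne_zero h4

/-- The extension of `μ̈` to `Vir^G`, added to `μ̂`, extends `μ` to `𝔟_m^G`; this is strictly larger
because `G` is a proper divisor of `f` and no power of `t` is divisible by `t - r`. -/
theorem not_isIrreducible_of_not_largeDegree (hf : f.Monic) (hf0 : f.coeff 0 ≠ 0)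
    (hdd : IsDDot μ μdd) (hh : IsHat μ μdd μh) (hl : ¬ LargeDegree f μdd) :
    ¬ LieModule.IsIrreducible ℂ Vir (VRestricted f m μ) := by
  obtain ⟨r, G, ν, hG, hν⟩ := exists_extension_of_not_largeDegree hf hf0 μdd hl
  have hG0 : G.coeff 0 ≠ 0 := by
    intro h
    rw [hG, Polynomial.mul_coeff_zero, h, mul_zero] at hf0
    exact hf0 rfl
  obtain ⟨φ₁, hφ₁⟩ := exists_linear ν
  obtain ⟨φ₂, hφ₂⟩ := exists_linear μh
  have hfG : polySub f ≤ polySub G := polySub_le_of_dvd (Dvd.intro_left _ hG.symm)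
  have hle : bPolySub f m ≤ bPolySub G m := fun v hv => by
    rw [mem_bPolySub_iff hf0] at hv
    rw [mem_bPolySub_iff hG0]
    exact ⟨hfG hv.1, hv.2⟩
  refine Ind.not_isIrreducible_of_extension μ hle (charOf (bPolySub G m) (φ₁ + φ₂) fun a ha b hb => ?_)
    (fun v => ?_) fun hle' => ?_
  · rw [mem_bPolySub_iff hG0] at ha hb
    rw [LinearMap.add_apply, linear_lie hφ₁ ha.1 hb.1, linear_lie hφ₂ ha.2 hb.2, add_zero]
  · rw [charOf_apply, LinearMap.add_apply]
    have hv := (mem_bPolySub_iff hf0).mp v.2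
    change φ₁ v + φ₂ v = _
    rw [hφ₁ _ (hfG hv.1), hφ₂ _ hv.2, hν v hv.1]
    exact (hh.eq_add hdd v v.2 hv.1 hv.2).symm
  · have hx := ((mem_bPolySub_iff hf0).mp (hle' (x_mem_bPolySub G (le_refl (m : ℤ))))).1
    obtain ⟨w, hw⟩ := mem_polySub_iff.mp hx
    have h1 : T m * toLaurent G = w * toLaurent f := by
      rw [← theta_x]
      exact hw
    have hr0 : r ≠ 0 := by
      rintro rfl
      rw [hG] at hf0
      simp at hf0
    rw [hG, map_mul, ← mul_assoc] at h1
    have h2 := mul_right_cancel₀ (toLaurent_ne_zero.mpr (by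
      rintro rfl
      exact hG0 (Polynomial.coeff_zero 0))) h1
    have h3 := congrArg (evalAt hr0) h2
    rw [map_mul, evalAt_lin, mul_zero, evalAt_T] at h3
    exact zpow_ne_zero _ hr0 h3

/-- For sufficiency the Whittaker factor descends while the polynomial factor is only needed to be
simple, hence the exchange of the two factors. -/
theorem isIrreducible_iff (hf : f.Monic) (hf0 : f.coeff 0 ≠ 0) (hm : 1 ≤ m) (hdd : IsDDot μ μdd)
    (hh : IsHat μ μdd μh) : LieModule.IsIrreducible ℂ Vir (VRestricted f m μ) ↔
      LargeDegree f μdd ∧ (μh ⟨e (2 * m), e_mem_bSub (by omega)⟩ ≠ 0 ∨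
        μh ⟨e (2 * m - 1), e_mem_bSub (by omega)⟩ ≠ 0) := by
  constructor
  · intro h
    refine ⟨?_, ?_⟩
    · by_contra hl
      exact not_isIrreducible_of_not_largeDegree hf hf0 hdd hh hl h
    · by_contra! hw
      exact not_isIrreducible_of_whittaker hf0 hm hdd hh hw.1 hw.2 h
  · rintro ⟨hl, hw⟩
    exact (adapted_attached hf hf0 hdd hh).symm.isIrreducible
      (descends_whittaker hm μh hh.2.1 hw) (hl.isIrreducible hf hf0)

theorem criterion_iff (hf : f.Monic) (hf0 : f.coeff 0 ≠ 0) (hm : 1 ≤ m) (hdd : IsDDot μ μdd)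
    (hh : IsHat μ μdd μh) (h₀ : ∀ i : ℕ, (m : ℤ) ≤ 2 * (m : ℤ) + i)
    (h₁ : ∀ i : ℕ, (m : ℤ) ≤ 2 * (m : ℤ) + i - 1) :
    (∑ i ∈ Finset.range (f.natDegree + 1), f.coeff i * val μ (2 * (m : ℤ) + i) (h₀ i) ≠ 0 ∨
      f.coeff 0 * ∑ i ∈ Finset.range (f.natDegree + 1),
          f.coeff i * val μ (2 * (m : ℤ) + i - 1) (h₁ i) -
        2 * f.coeff 1 * ∑ i ∈ Finset.range (f.natDegree + 1),
          f.coeff i * val μ (2 * (m : ℤ) + i) (h₀ i) ≠ 0) ↔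
      μh ⟨e (2 * m), e_mem_bSub (by omega)⟩ ≠ 0 ∨
        μh ⟨e (2 * m - 1), e_mem_bSub (by omega)⟩ ≠ 0 := by
  obtain ⟨φ, hφ⟩ := exists_linear μh
  have h0 := hh.sum_eq hf hdd hφ (2 * m) (by omega)
  have h1 : ∑ i ∈ Finset.range (f.natDegree + 1), f.coeff i * val μ (2 * (m : ℤ) + i - 1) (h₁ i)
      = ∑ i ∈ Finset.range (f.natDegree + 1), f.coeff i * val μ (2 * (m : ℤ) - 1 + i) (by omega) :=
    Finset.sum_congr rfl fun i _ => by
      congr 2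
      ring
  rw [h1, hh.sum_eq hf hdd hφ (2 * m - 1) (by omega), h0, hh.apply_sq hφ _ (by omega),
    hh.apply_sq hφ _ le_rfl, sub_add_cancel, ← hφ, ← hφ]
  have h2 : φ (e (2 * m + 1)) = 0 := by
    rw [hφ _ (e_mem_bSub (by omega))]
    exact hh.2.1 _ le_rfl
  rw [h2, mul_zero, add_zero]
  -- The second scalar of the criterion is built to eliminate `μ̂(e_(2m))`, leaving `a_0^3
  -- μ̂(e_(2m-1))`.
  have h3 : f.coeff 0 * (f.coeff 0 ^ 2 * φ (e (2 * m - 1)) + 2 * f.coeff 0 * f.coeff 1 * φ (e (2 * m)))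
      - 2 * f.coeff 1 * (f.coeff 0 ^ 2 * φ (e (2 * m))) = f.coeff 0 ^ 3 * φ (e (2 * m - 1)) := by
    ring
  rw [h3, mul_ne_zero_iff, mul_ne_zero_iff]
  simp [hf0]

end Main

end VirasoroInduced

end

theorem mainTheorem12 (f : ℂ[X]) (hf : f.Monic) (hf0 : f.coeff 0 ≠ 0) (m : ℕ) (hm : 1 ≤ m)
    (μ : LieCharacter ℂ (bPolySub f m)) :
    (∃! d : LieCharacter ℂ (polySub f) × LieCharacter ℂ (bSub m),
      IsDDot μ d.1 ∧ IsHat μ d.1 d.2) ∧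
    ∀ (μdd : LieCharacter ℂ (polySub f)) (μh : LieCharacter ℂ (bSub m)),
      IsDDot μ μdd → IsHat μ μdd μh →
        Nonempty (VRestricted f m μ ≃ₗ⁅ℂ, Vir⁆ VPoly f μdd ⊗[ℂ] Whittaker m μh) ∧
        (LieModule.IsIrreducible ℂ Vir (VRestricted f m μ) ↔
          LargeDegree f μdd ∧
          (∑ i ∈ Finset.range (f.natDegree + 1),
              f.coeff i * val μ (2 * (m : ℤ) + i) (by omega) ≠ 0 ∨
            f.coeff 0 * ∑ i ∈ Finset.range (f.natDegree + 1),
                f.coeff i * val μ (2 * (m : ℤ) + i - 1) (by omega) -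
              2 * f.coeff 1 * ∑ i ∈ Finset.range (f.natDegree + 1),
                f.coeff i * val μ (2 * (m : ℤ) + i) (by omega) ≠ 0)) := by
  exact ⟨existsUnique_attached hf hf0 hm μ, fun μdd μh hdd hh =>
    ⟨(adapted_attached hf hf0 hdd hh).nonempty_equiv,
      (isIrreducible_iff hf hf0 hm hdd hh).trans
        (and_congr_right fun _ => (criterion_iff hf hf0 hm hdd hh _ _).symm)⟩⟩
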